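/- Let $N\ge 1$ be an integer, let $\lambda,p,q>0$, $0\le\alpha\le N$ and $\beta>\alpha-N$, and let $K_{\alpha,\beta}(x)=|x|^{-\alpha}\log^{\beta}(1+|x|)$ on $\mathbb{R}^N$. By a classical non-negative solution of $$\Delta^2u-\lambda\Delta u\ \ge\ (K_{\alpha,\beta}*u^p)\,u^q\quad\text{in }\mathbb{R}^N \tag{$P^+$}$$ we mean a function $u\in C^4(\mathbb{R}^N)$ such that $u(x)\ge 0$ and $(K_{\alpha,\beta}*u^p)(x)=\int_{\mathbb{R}^N}K_{\alpha,\beta}(x-y)\,u(y)^p\,dy<\infty$ for all $x\in\mathbb{R}^N$, and which satisfies the inequality pointwise in $\mathbb{R}^N$. Then $(P^+)$ has no classical non-negative solution $u\not\equiv 0$ if one of the following conditions holds: (i) $1\le N\le 2$; (ii) $N\ge 3$, $0\le\alpha\le 2$ and $1\le p<\frac{N-\alpha}{N-2}$; (iii) $N\ge 3$, $0\le\alpha\le 2$, $p=\frac{N-\alpha}{N-2}$ and $\beta\ge -1$; (iv) $N\ge 3$, $p\ge 1$ and $p+q<\frac{2N-\alpha}{N-2}$; (v) $N\ge 3$, $p\ge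 1$, $p+q=\frac{2N-\alpha}{N-2}$ and $\beta>\frac{1}{p+q}-1$; (vi) $N\ge 3$, $0\le\alpha<2$ and $1<q<\frac{N-\alpha}{N-2}$; (vii) $N\ge 3$, $0\le\alpha<2$, $q=\frac{N-\alpha}{N-2}$ and $\beta>\frac1q-1$; (viii) $N\ge 3$, $0\le\alpha<2$, $p=\frac{N}{N-2}$, $q=\frac{N-\alpha}{N-2}$ and $\beta>-2+\frac1q$; (ix) $N\ge 3$, $0\le\alpha<2$, $p=\frac{N-\alpha}{N-2}$, $q=\frac{N}{N-2}$ and $\beta>-2+\frac1q$. -/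

import Mathlib

open MeasureTheory
open scoped ENNReal

noncomputable section

/-- The kernel `K_{α,β}(x) = |x|^{-α} log^β(1 + |x|)` on `ℝ^N`. -/
def logKernel {N : ℕ} (α β : ℝ) (x : EuclideanSpace ℝ (Fin N)) : ℝ :=
  ‖x‖ ^ (-α) * Real.log (1 + ‖x‖) ^ β

/-- The convolution `(K_{α,β} * u^p)(x) = ∫ K_{α,β}(x - y) u(y)^p dy` of non-negative functions,
with values in `[0, ∞]`. -/
def kernelConv {N : ℕ} (α β p : ℝ) (u : EuclideanSpace ℝ (Fin N) → ℝ)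
    (x : EuclideanSpace ℝ (Fin N)) : ℝ≥0∞ :=
  ∫⁻ y, ENNReal.ofReal (logKernel α β (x - y) * u y ^ p)

/-- `u` is a classical non-negative solution of
`Δ²u - lam * Δu ≥ (K_{α,β} * u^p) u^q` in `ℝ^N`. -/
structure IsNonnegSolution {N : ℕ} (lam p q α β : ℝ)
    (u : EuclideanSpace ℝ (Fin N) → ℝ) : Prop where
  contDiff : ContDiff ℝ 4 u
  nonneg : ∀ x, 0 ≤ u x
  conv_lt_top : ∀ x, kernelConv α β p u x < ∞
  inequality : ∀ x,
    (kernelConv α β p u x).toReal * u x ^ q ≤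
      Laplacian.laplacian (Laplacian.laplacian u) x - lam * Laplacian.laplacian u x

end

/-! Write E = Δ²u − λΔu ≥ 0 and w = λu − Δu, so that −Δw = E and w is superharmonic. If the ball
averages of u grow at most polynomially, then w ≥ 0 (`helmholtz_nonneg`). The mean value inequality
for w, a comparison principle for λ − Δ and Green's formula then produce a profile g with u ≥ c
R^(2−N) g(R) on the ball of radius R and g(R) ≥ c ∫ E over the ball of radius R/2
(`exists_profile`). In particular u is at least c R^(2−N) on the ball of radius R, with an extra
factor that dominates the mass of E.

This bound is fed back into the inequality on dyadic annuli. Let G_n be the mass of E on the ball of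
radius 2^n and g_n the profile at that scale. A lower bound of order 2^(−an) n^γ g_n^p' for the
convolution on the n-th annulus yields G_(n+1) − G_n ≥ c 2^(nθ) n^γ g_n^Q with Q = p' + q and θ = N
− a − (N−2)q, whereas G_(n+1) ≤ C g_n. These are incompatible if Q > 1 and either θ > 0, or θ = 0
and γ > 1/Q − 1 (`false_of_exp_increment_le`).

The cases differ only in how the convolution is bounded below. For N ≤ 2, and for p at or below
(N−α)/(N−2), it already diverges at the origin (`false_of_divergent`). Conditions on p + q use one
nearby annulus, which retains g_n^p. Conditions on q alone use one fixed annulus. When p is critical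
as well, about n annuli, inside or outside the n-th one, contribute equally, and γ gains 1.

Polynomial growth comes from finiteness of the convolution at the origin, which bounds ∫ u^p over
balls. This suffices if p ≥ 1. If q > 1, a test function argument absorbs u into E. If N ≤ 2 and p ≤
1, point values are bounded by averages and a weighted maximum argument closes the estimate. -/

/-! ### Averages against truncated powers: derivative in the radius and Green's formula. -/

section BumpCalculus

open Laplacian Metric

variable {N : ℕ}

/-- The truncated power `((1 - |x|²)₊)^k`. -/
noncomputable def bump (k : ℕ) (x : EuclideanSpace ℝ (Fin N)) : ℝ := max 0 (1 - ‖x‖ ^ 2) ^ k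

/-- The dilated average `∫ f(x₀ + t x) (1 - |x|²)₊^k dx`. -/
noncomputable def bumpMean (k : ℕ) (f : EuclideanSpace ℝ (Fin N) → ℝ)
    (x₀ : EuclideanSpace ℝ (Fin N)) (t : ℝ) : ℝ := ∫ x, f (x₀ + t • x) * bump k x

/-- The `i`-th partial derivative. -/
noncomputable def pderiv (i : Fin N) (f : EuclideanSpace ℝ (Fin N) → ℝ)
    (x : EuclideanSpace ℝ (Fin N)) : ℝ := fderiv ℝ f x (EuclideanSpace.single i 1)

lemma bump_nonneg (k : ℕ) (x : EuclideanSpace ℝ (Fin N)) : 0 ≤ bump k x :=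
  pow_nonneg (le_max_left _ _) _

lemma bump_le_one (k : ℕ) (x : EuclideanSpace ℝ (Fin N)) : bump k x ≤ 1 :=
  pow_le_one₀ (le_max_left _ _) (max_le zero_le_one (by nlinarith [sq_nonneg ‖x‖]))

lemma bump_anti {j k : ℕ} (h : j ≤ k) (x : EuclideanSpace ℝ (Fin N)) : bump k x ≤ bump j x :=
  pow_le_pow_of_le_one (le_max_left _ _) (max_le zero_le_one (by nlinarith [sq_nonneg ‖x‖])) h

lemma bump_eq_zero {k : ℕ} {x : EuclideanSpace ℝ (Fin N)} (hx : 1 ≤ ‖x‖) :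
    bump (k + 1) x = 0 := by
  rw [bump, max_eq_left (by nlinarith), zero_pow (by omega)]

lemma continuous_bump (k : ℕ) : Continuous (bump k : EuclideanSpace ℝ (Fin N) → ℝ) := by
  unfold bump; fun_prop

lemma hasCompactSupport_bump (k : ℕ) :
    HasCompactSupport (bump (k + 1) : EuclideanSpace ℝ (Fin N) → ℝ) := by
  refine HasCompactSupport.intro (isCompact_closedBall 0 1) fun x hx => bump_eq_zero ?_
  simpa using (not_le.1 (by simpa using hx) : 1 < ‖x‖).le

/-- On the support |x|² = 1 − (1 − |x|²), so a factor |x|² produced by differentiation becomes a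
shift of exponent. This is why Green's formula closes up within the family of averages. -/
lemma norm_sq_mul_bump (k : ℕ) (x : EuclideanSpace ℝ (Fin N)) :
    ‖x‖ ^ 2 * bump (k + 1) x = bump (k + 1) x - bump (k + 2) x := by
  rcases le_total 1 ‖x‖ with h | h
  · rw [bump_eq_zero h, show k + 2 = (k + 1) + 1 from rfl, bump_eq_zero h]; ring
  · simp only [bump, max_eq_right (show 0 ≤ 1 - ‖x‖ ^ 2 by nlinarith [norm_nonneg x])]; ring

/-- At the kink the function is O(|r|^(k+2)) with k + 2 ≥ 2, so its derivative there is zero. -/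
lemma hasDerivAt_max_zero_pow (k : ℕ) (r : ℝ) :
    HasDerivAt (fun r : ℝ => max 0 r ^ (k + 2)) ((k + 2) * max 0 r ^ (k + 1)) r := by
  rcases lt_trichotomy r 0 with h | h | h
  · rw [max_eq_left h.le, zero_pow (by omega), mul_zero]
    refine (hasDerivAt_const r (0 : ℝ)).congr_of_eventuallyEq ?_
    filter_upwards [gt_mem_nhds h] with s hs
    rw [max_eq_left (le_of_lt hs), zero_pow (by omega)]
  · subst h
    rw [max_self, zero_pow (by omega), mul_zero]
    have : HasFDerivAt (fun r : ℝ => max 0 r ^ (k + 2)) (0 : ℝ →L[ℝ] ℝ) 0 := by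
      refine Asymptotics.IsBigO.hasFDerivAt (n := k + 2) ?_ (by omega)
      refine Asymptotics.IsBigO.of_bound 1 (Filter.Eventually.of_forall fun s => ?_)
      simp only [sub_zero, one_mul, norm_pow, Real.norm_eq_abs, abs_abs]
      refine pow_le_pow_left₀ (abs_nonneg _) ?_ _
      rw [abs_of_nonneg (le_max_left _ _)]
      exact max_le (abs_nonneg _) (le_abs_self _)
    simpa using this.hasDerivAt
  · have h1 : HasDerivAt (fun r : ℝ => r ^ (k + 2)) ((k + 2) * max 0 r ^ (k + 1)) r := by
      have := hasDerivAt_pow (k + 2) r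
      rw [max_eq_right h.le]
      simpa using this
    refine h1.congr_of_eventuallyEq ?_
    filter_upwards [lt_mem_nhds h] with s hs
    rw [max_eq_right (le_of_lt hs)]

lemma hasFDerivAt_bump (k : ℕ) (x : EuclideanSpace ℝ (Fin N)) :
    HasFDerivAt (bump (k + 2)) ((-(2 * (k + 2)) * bump (k + 1) x) • innerSL ℝ x) x := by
  have h1 : HasFDerivAt (fun y : EuclideanSpace ℝ (Fin N) => 1 - ‖y‖ ^ 2)
      (-((2 : ℕ) • innerSL ℝ x)) x := by
    simpa using (hasStrictFDerivAt_norm_sq x).hasFDerivAt.const_sub 1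
  have h2 := (hasDerivAt_max_zero_pow k (1 - ‖x‖ ^ 2)).comp_hasFDerivAt x h1
  refine h2.congr_fderiv ?_
  ext y
  simp [bump]
  ring

lemma pderiv_bump (k : ℕ) (i : Fin N) (x : EuclideanSpace ℝ (Fin N)) :
    pderiv i (bump (k + 2)) x = -(2 * (k + 2)) * (x i * bump (k + 1) x) := by
  rw [pderiv, (hasFDerivAt_bump k x).fderiv]
  simp [PiLp.inner_apply]
  ring

lemma differentiable_bump (k : ℕ) :
    Differentiable ℝ (bump (k + 2) : EuclideanSpace ℝ (Fin N) → ℝ) :=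
  fun x => (hasFDerivAt_bump k x).differentiableAt

lemma laplacian_eq_sum_pderiv (f : EuclideanSpace ℝ (Fin N) → ℝ) (hf : ContDiff ℝ 2 f)
    (x : EuclideanSpace ℝ (Fin N)) : (Δ f) x = ∑ i, pderiv i (pderiv i f) x := by
  rw [InnerProductSpace.laplacian_eq_iteratedFDeriv_orthonormalBasis f
    (EuclideanSpace.basisFun (Fin N) ℝ)]
  refine Finset.sum_congr rfl fun i _ => ?_
  rw [iteratedFDeriv_two_apply]
  have hd : DifferentiableAt ℝ (fderiv ℝ f) x :=
    (hf.fderiv_right (m := 1) (by norm_num)).differentiable (by norm_num) x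
  unfold pderiv
  rw [fderiv_clm_apply hd (differentiableAt_const _)]
  simp

lemma contDiff_pderiv {n : ℕ} (i : Fin N) {f : EuclideanSpace ℝ (Fin N) → ℝ}
    (hf : ContDiff ℝ (n + 1 : ℕ) f) : ContDiff ℝ n (pderiv i f) :=
  (hf.fderiv_right (m := n) (by norm_cast)).clm_apply contDiff_const

lemma contDiff_laplacian {n : ℕ} {f : EuclideanSpace ℝ (Fin N) → ℝ}
    (hf : ContDiff ℝ (n + 2 : ℕ) f) : ContDiff ℝ n (Δ f) := by
  have h2 : ContDiff ℝ 2 f := hf.of_le (by norm_cast; omega)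
  rw [show (Δ f) = fun x => ∑ i, pderiv i (pderiv i f) x from
    funext (laplacian_eq_sum_pderiv f h2)]
  exact ContDiff.sum fun i _ => contDiff_pderiv i (contDiff_pderiv i hf)

lemma integrable_mul_bump {f : EuclideanSpace ℝ (Fin N) → ℝ} (hf : Continuous f) (k : ℕ) :
    Integrable (fun x => f x * bump (k + 1) x) :=
  (hf.mul (continuous_bump _)).integrable_of_hasCompactSupport (hasCompactSupport_bump k).mul_left

/-- Integration by parts against a compactly supported function. -/
lemma integral_mul_pderiv {f g : EuclideanSpace ℝ (Fin N) → ℝ} (hf : ContDiff ℝ 1 f)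
    (hg : Differentiable ℝ g) (i : Fin N) (hg' : Continuous (pderiv i g))
    (hs : HasCompactSupport g) :
    ∫ x, f x * pderiv i g x = -∫ x, pderiv i f x * g x := by
  have hf' : Continuous (pderiv i f) :=
    (hf.continuous_fderiv (by norm_num)).clm_apply continuous_const
  have hs' : HasCompactSupport (pderiv i g) := by
    refine (hs.fderiv (𝕜 := ℝ)).comp_left (g := fun L => L (EuclideanSpace.single i 1)) rfl
  refine integral_mul_fderiv_eq_neg_fderiv_mul_of_integrable ?_ ?_ ?_
    (fun x _ => hf.differentiable (by norm_num) x) (fun x _ => hg x)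
  · exact (hf'.mul hg.continuous).integrable_of_hasCompactSupport hs.mul_left
  · exact (hf.continuous.mul hg').integrable_of_hasCompactSupport hs'.mul_left
  · exact (hf.continuous.mul hg.continuous).integrable_of_hasCompactSupport hs.mul_left

lemma pderiv_comp_affine {f : EuclideanSpace ℝ (Fin N) → ℝ} (hf : Differentiable ℝ f)
    (x₀ : EuclideanSpace ℝ (Fin N)) (t : ℝ) (i : Fin N) (x : EuclideanSpace ℝ (Fin N)) :
    pderiv i (fun y => f (x₀ + t • y)) x = t * pderiv i f (x₀ + t • x) := by
  have h1 : HasFDerivAt (fun y : EuclideanSpace ℝ (Fin N) => x₀ + t • y)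
      (t • ContinuousLinearMap.id ℝ (EuclideanSpace ℝ (Fin N))) x :=
    ((hasFDerivAt_id x).const_smul t).const_add x₀
  have h2 := (hf (x₀ + t • x)).hasFDerivAt.comp x h1
  unfold pderiv
  rw [show (fun y => f (x₀ + t • y)) = f ∘ fun y => x₀ + t • y from rfl, h2.fderiv]
  simp

lemma fderiv_apply_eq_sum (f : EuclideanSpace ℝ (Fin N) → ℝ) (x y : EuclideanSpace ℝ (Fin N)) :
    fderiv ℝ f x y = ∑ i, y i * pderiv i f x := by
  conv_lhs => rw [← (EuclideanSpace.basisFun (Fin N) ℝ).sum_repr y]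
  simp [pderiv]

/-- Integrating by parts once in each coordinate puts the derivative on the weight, whose gradient
is a multiple of x times the next lower power. What remains is the radial derivative of f, which is
the t-derivative of the integrand of the dilated average. -/
lemma mul_bumpMean_laplacian_eq {f : EuclideanSpace ℝ (Fin N) → ℝ} (hf : ContDiff ℝ 2 f)
    (k : ℕ) (x₀ : EuclideanSpace ℝ (Fin N)) (t : ℝ) :
    t * bumpMean (k + 2) (Δ f) x₀ t =
      2 * (k + 2) * ∫ x, fderiv ℝ f (x₀ + t • x) x * bump (k + 1) x := by
  have ha : Continuous fun x : EuclideanSpace ℝ (Fin N) => x₀ + t • x := by fun_prop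
  have hp (i : Fin N) : ContDiff ℝ 1 (pderiv i f) := contDiff_pderiv (n := 1) i (by simpa using hf)
  have hpp (i : Fin N) : Continuous (pderiv i (pderiv i f)) :=
    (contDiff_pderiv (n := 0) i (by simpa using hp i)).continuous
  have key (i : Fin N) : ∫ x, t * pderiv i (pderiv i f) (x₀ + t • x) * bump (k + 2) x =
      2 * (k + 2) * ∫ x, x i * pderiv i f (x₀ + t • x) * bump (k + 1) x := by
    have h := integral_mul_pderiv (f := fun x => pderiv i f (x₀ + t • x)) (g := bump (k + 2))
      ((hp i).comp (contDiff_const.add (contDiff_id.const_smul t))) (differentiable_bump k) i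
      (by
        rw [show pderiv i (bump (k + 2)) = _ from funext (pderiv_bump k i)]
        have := continuous_bump (N := N) (k + 1)
        fun_prop) (hasCompactSupport_bump _)
    simp only [pderiv_bump, pderiv_comp_affine ((hp i).differentiable (by norm_num))] at h
    rw [← neg_eq_iff_eq_neg] at h
    rw [← h, ← integral_neg, ← integral_const_mul]
    congr 1; ext x; ring
  have hI (i : Fin N) : Integrable fun x : EuclideanSpace ℝ (Fin N) =>
      t * pderiv i (pderiv i f) (x₀ + t • x) * bump (k + 2) x :=
    integrable_mul_bump (continuous_const.mul ((hpp i).comp ha)) (k + 1)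
  have hJ (i : Fin N) : Integrable fun x : EuclideanSpace ℝ (Fin N) =>
      x i * pderiv i f (x₀ + t • x) * bump (k + 1) x := by
    refine integrable_mul_bump (f := fun x => x i * pderiv i f (x₀ + t • x)) ?_ k
    exact (by fun_prop : Continuous fun x : EuclideanSpace ℝ (Fin N) => x i).mul
      ((hp i).continuous.comp ha)
  calc t * bumpMean (k + 2) (Δ f) x₀ t
      = ∫ x, ∑ i, t * pderiv i (pderiv i f) (x₀ + t • x) * bump (k + 2) x := by
        rw [bumpMean, ← integral_const_mul]
        congr 1; ext x
        rw [laplacian_eq_sum_pderiv f hf, Finset.sum_mul, Finset.mul_sum]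
        exact Finset.sum_congr rfl fun i _ => by ring
    _ = ∑ i, 2 * (k + 2) * ∫ x, x i * pderiv i f (x₀ + t • x) * bump (k + 1) x := by
        rw [integral_finsetSum _ fun i _ => hI i]
        exact Finset.sum_congr rfl fun i _ => key i
    _ = _ := by
        rw [← Finset.mul_sum, ← integral_finsetSum _ fun i _ => hJ i]
        congr 2; ext x
        rw [fderiv_apply_eq_sum, Finset.sum_mul]

/-- The derivative of a dilated average is a dilated average of the Laplacian. -/
lemma hasDerivAt_bumpMean {f : EuclideanSpace ℝ (Fin N) → ℝ} (hf : ContDiff ℝ 2 f)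
    (k : ℕ) (x₀ : EuclideanSpace ℝ (Fin N)) (t : ℝ) :
    HasDerivAt (bumpMean (k + 1) f x₀)
      (t / (2 * (k + 2)) * bumpMean (k + 2) (Δ f) x₀ t) t := by
  have hval : t / (2 * (k + 2)) * bumpMean (k + 2) (Δ f) x₀ t =
      ∫ x, fderiv ℝ f (x₀ + t • x) x * bump (k + 1) x := by
    have := mul_bumpMean_laplacian_eq hf k x₀ t
    have hk : (2 * ((k : ℝ) + 2)) ≠ 0 := by positivity
    field_simp
    linarith
  have hd : Continuous (fderiv ℝ f) := hf.continuous_fderiv (by norm_num)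
  have hc : Continuous fun q : ℝ × EuclideanSpace ℝ (Fin N) =>
      fderiv ℝ f (x₀ + q.1 • q.2) q.2 :=
    (hd.comp (by fun_prop)).clm_apply continuous_snd
  obtain ⟨C, hC⟩ := ((isCompact_closedBall t 1).prod
    (isCompact_closedBall (0 : EuclideanSpace ℝ (Fin N)) 1)).exists_bound_of_continuousOn
    hc.continuousOn
  rw [hval]
  refine (hasDerivAt_integral_of_dominated_loc_of_deriv_le (bound := fun x => C * bump (k + 1) x)
    (F := fun s x => f (x₀ + s • x) * bump (k + 1) x)
    (F' := fun s x => fderiv ℝ f (x₀ + s • x) x * bump (k + 1) x)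
    (closedBall_mem_nhds t one_pos) ?_ ?_ ?_ ?_ ?_ ?_).2
  · refine Filter.Eventually.of_forall fun s => Continuous.aestronglyMeasurable ?_
    exact (hf.continuous.comp (by fun_prop)).mul (continuous_bump _)
  · exact integrable_mul_bump (hf.continuous.comp (by fun_prop : Continuous fun x => x₀ + t • x)) k
  · exact Continuous.aestronglyMeasurable
      ((hc.comp (by fun_prop : Continuous fun x => (t, x))).mul (continuous_bump _))
  · refine Filter.Eventually.of_forall fun x s hs => ?_
    rcases le_total 1 ‖x‖ with h | h
    · simp [bump_eq_zero h]
    · rw [norm_mul, Real.norm_of_nonneg (bump_nonneg _ _)]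
      exact mul_le_mul_of_nonneg_right (hC (s, x) ⟨hs, by simpa using h⟩) (bump_nonneg _ _)
  · exact integrable_mul_bump continuous_const k
  · refine Filter.Eventually.of_forall fun x s _ => ?_
    have h1 : HasDerivAt (fun s : ℝ => x₀ + s • x) x s := by
      simpa using ((hasDerivAt_id s).smul_const x).const_add x₀
    exact (((hf.differentiable (by norm_num) _).hasFDerivAt.comp_hasDerivAt s h1)).mul_const _

/-- Green's formula for the truncated powers. -/
lemma sq_mul_bumpMean_laplacian {f : EuclideanSpace ℝ (Fin N) → ℝ} (hf : ContDiff ℝ 2 f)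
    (k : ℕ) (x₀ : EuclideanSpace ℝ (Fin N)) (t : ℝ) :
    t ^ 2 * bumpMean (k + 3) (Δ f) x₀ t =
      2 * (k + 3) * (2 * (k + 2) * bumpMean (k + 1) f x₀ t -
        (N + 2 * (k + 2)) * bumpMean (k + 2) f x₀ t) := by
  have ha : Continuous fun x : EuclideanSpace ℝ (Fin N) => x₀ + t • x := by fun_prop
  have hfa : ContDiff ℝ 1 (fun x => f (x₀ + t • x)) :=
    (hf.of_le (by norm_num)).comp (contDiff_const.add (contDiff_id.const_smul t))
  have hfac : Continuous (fun x => f (x₀ + t • x)) := hfa.continuous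
  have hp (i : Fin N) : Continuous (pderiv i f) :=
    (contDiff_pderiv (n := 1) i (by simpa using hf)).continuous
  have hx (i : Fin N) (x : EuclideanSpace ℝ (Fin N)) :
      HasFDerivAt (fun x : EuclideanSpace ℝ (Fin N) => x i)
        (EuclideanSpace.proj i : EuclideanSpace ℝ (Fin N) →L[ℝ] ℝ) x :=
    (EuclideanSpace.proj (𝕜 := ℝ) i).hasFDerivAt
  have hg (i : Fin N) (x : EuclideanSpace ℝ (Fin N)) :
      pderiv i (fun x => x i * bump (k + 2) x) x =
        bump (k + 2) x - 2 * (k + 2) * (x i ^ 2 * bump (k + 1) x) := by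
    unfold pderiv
    have h : HasFDerivAt (fun x : EuclideanSpace ℝ (Fin N) => x i * bump (k + 2) x) _ x :=
      (hx i x).mul (hasFDerivAt_bump k x)
    rw [h.fderiv]
    simp [PiLp.inner_apply]
    ring
  -- A second integration by parts, against the components of the field x · bump. Summed over i, its
  -- divergence is N bump − 2(k+2)|x|² times the bump of one lower exponent.
  have key (i : Fin N) : ∫ x, t * (x i * pderiv i f (x₀ + t • x) * bump (k + 2) x) =
      -∫ x, f (x₀ + t • x) * (bump (k + 2) x - 2 * (k + 2) * (x i ^ 2 * bump (k + 1) x)) := by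
    have h := integral_mul_pderiv (f := fun x => f (x₀ + t • x)) (g := fun x => x i * bump (k + 2) x)
      hfa (fun x => ((hx i x).differentiableAt).mul (differentiable_bump k x)) i
      (by
        rw [show pderiv i (fun x => x i * bump (k + 2) x) = _ from funext (hg i)]
        have := continuous_bump (N := N) (k + 1)
        have := continuous_bump (N := N) (k + 2)
        fun_prop) (hasCompactSupport_bump _).mul_left
    simp only [hg, pderiv_comp_affine (hf.differentiable (by norm_num))] at h
    rw [h, neg_neg]
    congr 1; ext x; ring
  have hJ (i : Fin N) : Integrable fun x : EuclideanSpace ℝ (Fin N) =>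
      t * (x i * pderiv i f (x₀ + t • x) * bump (k + 2) x) := by
    refine (integrable_mul_bump (f := fun x => x i * pderiv i f (x₀ + t • x)) ?_ (k + 1)).const_mul t
    exact (by fun_prop : Continuous fun x : EuclideanSpace ℝ (Fin N) => x i).mul ((hp i).comp ha)
  have hK (i : Fin N) : Integrable fun x : EuclideanSpace ℝ (Fin N) =>
      f (x₀ + t • x) * (bump (k + 2) x - 2 * (k + 2) * (x i ^ 2 * bump (k + 1) x)) := by
    have h1 := integrable_mul_bump hfac (k + 1)
    have h2 := (integrable_mul_bump (f := fun x => f (x₀ + t • x) * x i ^ 2)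
      (hfac.mul (by fun_prop)) k).const_mul (2 * (k + 2))
    refine (h1.sub h2).congr (Filter.Eventually.of_forall fun x => ?_)
    simp only [Pi.sub_apply]; ring
  have h0 := mul_bumpMean_laplacian_eq hf (k + 1) x₀ t
  have h1 : ∫ x, t * (fderiv ℝ f (x₀ + t • x) x * bump (k + 2) x) =
      -∫ x, f (x₀ + t • x) * (N * bump (k + 2) x - 2 * (k + 2) * (bump (k + 1) x - bump (k + 2) x)) := by
    calc _ = ∫ x, ∑ i, t * (x i * pderiv i f (x₀ + t • x) * bump (k + 2) x) := by
          congr 1; ext x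
          rw [fderiv_apply_eq_sum, Finset.sum_mul, Finset.mul_sum]
      _ = ∑ i, -∫ x, f (x₀ + t • x) *
            (bump (k + 2) x - 2 * (k + 2) * (x i ^ 2 * bump (k + 1) x)) := by
          rw [integral_finsetSum _ fun i _ => hJ i]
          exact Finset.sum_congr rfl fun i _ => key i
      _ = _ := by
          rw [Finset.sum_neg_distrib, ← integral_finsetSum _ fun i _ => hK i]
          congr 2; ext x
          rw [← norm_sq_mul_bump, EuclideanSpace.real_norm_sq_eq, ← Finset.mul_sum,
            Finset.sum_sub_distrib, ← Finset.mul_sum, ← Finset.sum_mul]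
          simp
  have h2 : ∫ x, f (x₀ + t • x) *
      (N * bump (k + 2) x - 2 * (k + 2) * (bump (k + 1) x - bump (k + 2) x)) =
      (N + 2 * (k + 2)) * bumpMean (k + 2) f x₀ t - 2 * (k + 2) * bumpMean (k + 1) f x₀ t := by
    unfold bumpMean
    rw [← integral_const_mul, ← integral_const_mul, ← integral_sub
      ((integrable_mul_bump hfac (k + 1)).const_mul _) ((integrable_mul_bump hfac k).const_mul _)]
    congr 1; ext x; ring
  rw [integral_const_mul, h2] at h1
  push_cast at h0
  have h3 : t ^ 2 * bumpMean (k + 3) (Δ f) x₀ t = t * (t * bumpMean (k + 1 + 2) (Δ f) x₀ t) := by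
    ring_nf
  rw [h3, h0]
  linear_combination (2 * ((k : ℝ) + 3)) * h1

end BumpCalculus

/-! ### Comparison principle, mean value inequality and comparison of averages over different balls.
-/

section MeanValue

open Laplacian Metric

variable {N : ℕ}

/-- Restrict to a line. A negative second derivative at a critical point would make the minimum a
local maximum too, hence the restriction locally constant, with zero second derivative. -/
lemma pderiv_pderiv_nonneg_of_isLocalMin {h : EuclideanSpace ℝ (Fin N) → ℝ} (hh : ContDiff ℝ 2 h)
    {y : EuclideanSpace ℝ (Fin N)} (hy : IsLocalMin h y) (i : Fin N) :
    0 ≤ pderiv i (pderiv i h) y := by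
  set e : EuclideanSpace ℝ (Fin N) := EuclideanSpace.single i 1 with he
  have hline (s : ℝ) : HasDerivAt (fun s : ℝ => y + s • e) e s := by
    simpa using ((hasDerivAt_id s).smul_const e).const_add y
  have hcomp {f : EuclideanSpace ℝ (Fin N) → ℝ} (hf : Differentiable ℝ f) (s : ℝ) :
      HasDerivAt (fun s : ℝ => f (y + s • e)) (pderiv i f (y + s • e)) s :=
    (hf _).hasFDerivAt.comp_hasDerivAt s (hline s)
  have hp : ContDiff ℝ 1 (pderiv i h) := contDiff_pderiv (n := 1) i (by simpa using hh)
  have h1 : deriv (fun s : ℝ => h (y + s • e)) = fun s => pderiv i h (y + s • e) :=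
    funext fun s => (hcomp (hh.differentiable (by norm_num)) s).deriv
  have h2 : deriv (deriv (fun s : ℝ => h (y + s • e))) 0 = pderiv i (pderiv i h) y := by
    rw [h1, (hcomp (hp.differentiable (by norm_num)) 0).deriv]; simp
  have hmin : IsLocalMin (fun s : ℝ => h (y + s • e)) 0 := by
    have hc : ContinuousAt (fun s : ℝ => y + s • e) 0 := (hline 0).continuousAt
    have : Filter.Tendsto (fun s : ℝ => y + s • e) (nhds 0) (nhds y) := by
      simpa [ContinuousAt] using hc
    simpa [IsLocalMin, IsMinFilter] using this.eventually hy
  by_contra! hneg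
  have hmax := isLocalMax_of_deriv_deriv_neg (by rw [h2]; exact hneg) hmin.deriv_eq_zero
    (hcomp (hh.differentiable (by norm_num)) 0).continuousAt
  have hconst : (fun s : ℝ => h (y + s • e)) =ᶠ[nhds 0] fun _ => h (y + (0 : ℝ) • e) := by
    filter_upwards [hmin, hmax] with s h1 h2
    exact le_antisymm h2 h1
  have h3 := hconst.deriv.deriv_eq
  rw [h2] at h3
  simp only [deriv_const'] at h3
  linarith

lemma pderiv_pderiv_norm_sub_sq (x y : EuclideanSpace ℝ (Fin N)) (i : Fin N) :
    pderiv i (pderiv i fun z => ‖z - x‖ ^ 2) y = 2 := by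
  have h1 : (pderiv i fun z : EuclideanSpace ℝ (Fin N) => ‖z - x‖ ^ 2) =
      fun z => 2 * (z i - x i) := by
    funext z
    have := ((hasStrictFDerivAt_norm_sq (z - x)).hasFDerivAt (𝕜 := ℝ)).comp z
      ((hasFDerivAt_id z).sub_const x)
    rw [pderiv, show (fun z : EuclideanSpace ℝ (Fin N) => ‖z - x‖ ^ 2) =
      (fun y => ‖y‖ ^ 2) ∘ fun z => id z - x from rfl, this.fderiv]
    simp [PiLp.inner_apply]
  have h2 : HasFDerivAt (fun z : EuclideanSpace ℝ (Fin N) => 2 * (z i - x i))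
      ((2 : ℝ) • (EuclideanSpace.proj i : EuclideanSpace ℝ (Fin N) →L[ℝ] ℝ)) y :=
    (((EuclideanSpace.proj (𝕜 := ℝ) i).hasFDerivAt (x := y)).sub_const (x i)).const_mul 2
  rw [h1, pderiv, h2.fderiv]
  simp

/-- A comparison principle on the unit ball for non-negative supersolutions of `lam u - Δ u ≥ A`. -/
lemma le_of_helmholtz_supersolution {u : EuclideanSpace ℝ (Fin N) → ℝ} (hu : ContDiff ℝ 2 u)
    (hu0 : ∀ x, 0 ≤ u x) {lam A : ℝ} (hlam : 0 < lam) (x : EuclideanSpace ℝ (Fin N))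
    (h : ∀ y, ‖y - x‖ ≤ 1 → A ≤ lam * u y - (Δ u) y) : A / (2 * N + lam) ≤ u x := by
  by_contra! hlt
  set ε := A / (2 * N + lam) with hε
  have hden : 0 < 2 * (N : ℝ) + lam := by positivity
  have hAε : A = ε * (2 * N + lam) := by rw [hε]; field_simp
  have hε0 : 0 < ε := (hu0 x).trans_lt hlt
  have hq : ContDiff ℝ 2 fun z : EuclideanSpace ℝ (Fin N) => ‖z - x‖ ^ 2 :=
    (contDiff_id.sub contDiff_const).norm_sq ℝ
  -- On the boundary of the unit ball the added paraboloid is ε > u(x), so the minimum is interior.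
  -- There Δu ≥ −2Nε and u < ε, hence λu − Δu < ε(2N + λ) = A.
  have hh : ContDiff ℝ 2 (u + ε • fun z => ‖z - x‖ ^ 2) := hu.add (hq.const_smul ε)
  obtain ⟨y, hy, hmin⟩ := (isCompact_closedBall x 1).exists_isMinOn ⟨x, by simp⟩
    hh.continuous.continuousOn
  have hyx : u y + ε * ‖y - x‖ ^ 2 ≤ u x := by
    have := hmin (show x ∈ closedBall x 1 by simp)
    simpa using this
  have hy1 : ‖y - x‖ < 1 := by
    by_contra! hge
    have : ε * 1 ≤ ε * ‖y - x‖ ^ 2 := by gcongr; nlinarith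
    linarith [hu0 y]
  have hloc : IsLocalMin (u + ε • fun z => ‖z - x‖ ^ 2) y := by
    refine hmin.isLocalMin (closedBall_mem_nhds_of_mem ?_)
    simpa [dist_eq_norm] using hy1
  have hlap : (Δ (u + ε • fun z => ‖z - x‖ ^ 2)) y = (Δ u) y + ε * (2 * N) := by
    rw [ContDiffAt.laplacian_add (f₂ := ε • fun z => ‖z - x‖ ^ 2) hu.contDiffAt
        (hq.const_smul ε).contDiffAt,
      InnerProductSpace.laplacian_smul ε hq.contDiffAt, laplacian_eq_sum_pderiv _ hq]
    simp [pderiv_pderiv_norm_sub_sq]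
    left; ring
  have h0 : 0 ≤ (Δ (u + ε • fun z => ‖z - x‖ ^ 2)) y := by
    rw [laplacian_eq_sum_pderiv _ hh]
    exact Finset.sum_nonneg fun i _ => pderiv_pderiv_nonneg_of_isLocalMin hh hloc i
  have h1 := h y hy1.le
  have h2 : lam * u y < lam * ε := by
    have : u y < ε := by nlinarith [sq_nonneg ‖y - x‖, mul_nonneg hε0.le (sq_nonneg ‖y - x‖)]
    gcongr
  nlinarith

lemma bumpMean_nonneg {f : EuclideanSpace ℝ (Fin N) → ℝ} (h : ∀ x, 0 ≤ f x) (k : ℕ)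
    (x₀ : EuclideanSpace ℝ (Fin N)) (t : ℝ) : 0 ≤ bumpMean k f x₀ t :=
  integral_nonneg fun _ => mul_nonneg (h _) (bump_nonneg _ _)

lemma bumpMean_anti {f : EuclideanSpace ℝ (Fin N) → ℝ} (hf : Continuous f) (h : ∀ x, 0 ≤ f x)
    {j k : ℕ} (hjk : j ≤ k) (x₀ : EuclideanSpace ℝ (Fin N)) (t : ℝ) :
    bumpMean (k + 1) f x₀ t ≤ bumpMean (j + 1) f x₀ t := by
  have ha : Continuous fun x : EuclideanSpace ℝ (Fin N) => x₀ + t • x := by fun_prop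
  exact integral_mono (integrable_mul_bump (hf.comp ha) k) (integrable_mul_bump (hf.comp ha) j)
    fun x => mul_le_mul_of_nonneg_left (bump_anti (by omega) _) (h _)

lemma bumpMean_mul_sub {f g : EuclideanSpace ℝ (Fin N) → ℝ} (hf : Continuous f)
    (hg : Continuous g) (a : ℝ) (k : ℕ) (x₀ : EuclideanSpace ℝ (Fin N)) (t : ℝ) :
    bumpMean (k + 1) (fun x => a * f x - g x) x₀ t =
      a * bumpMean (k + 1) f x₀ t - bumpMean (k + 1) g x₀ t := by
  have ha : Continuous fun x : EuclideanSpace ℝ (Fin N) => x₀ + t • x := by fun_prop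
  have h := integral_sub ((integrable_mul_bump (hf.comp ha) k).const_mul a)
    (integrable_mul_bump (hg.comp ha) k)
  rw [integral_const_mul] at h
  unfold bumpMean
  refine Eq.trans ?_ h
  congr 1; ext x; simp only [Function.comp]; ring

lemma bumpMean_zero_right (f : EuclideanSpace ℝ (Fin N) → ℝ) (k : ℕ)
    (x₀ : EuclideanSpace ℝ (Fin N)) : bumpMean k f x₀ 0 = f x₀ * ∫ x : EuclideanSpace ℝ (Fin N), bump k x := by
  simp [bumpMean, integral_const_mul]

variable (N) in
lemma integral_bump_pos (k : ℕ) : 0 < ∫ x : EuclideanSpace ℝ (Fin N), bump (k + 1) x := by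
  refine (continuous_bump _).integral_pos_of_hasCompactSupport_nonneg_nonzero
    (hasCompactSupport_bump k) (fun x => bump_nonneg _ _) (x := 0) ?_
  simp [bump]

/-- The mean value inequality for superharmonic functions. -/
lemma bumpMean_le_of_laplacian_nonpos {f : EuclideanSpace ℝ (Fin N) → ℝ} (hf : ContDiff ℝ 2 f)
    (h : ∀ x, (Δ f) x ≤ 0) (k : ℕ) (x₀ : EuclideanSpace ℝ (Fin N)) {t : ℝ} (ht : 0 ≤ t) :
    bumpMean (k + 1) f x₀ t ≤ f x₀ * ∫ x : EuclideanSpace ℝ (Fin N), bump (k + 1) x := by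
  rw [← bumpMean_zero_right]
  have hanti : AntitoneOn (bumpMean (k + 1) f x₀) (Set.Ici 0) := by
    refine antitoneOn_of_deriv_nonpos (convex_Ici 0)
      (fun s _ => (hasDerivAt_bumpMean hf k x₀ s).continuousAt.continuousWithinAt)
      (fun s _ => (hasDerivAt_bumpMean hf k x₀ s).differentiableAt.differentiableWithinAt) ?_
    intro s hs
    rw [interior_Ici, Set.mem_Ioi] at hs
    rw [(hasDerivAt_bumpMean hf k x₀ s).deriv]
    refine mul_nonpos_of_nonneg_of_nonpos (by positivity) ?_
    exact integral_nonpos fun x => mul_nonpos_of_nonpos_of_nonneg (h _) (bump_nonneg _ _)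
  exact hanti (by simp) ht ht

/-- Undoing the dilation turns averages with different centres and radii into integrals of the same
f against different weights, so they can be compared pointwise. -/
lemma pow_mul_bumpMean (f : EuclideanSpace ℝ (Fin N) → ℝ) (k : ℕ)
    (x₀ : EuclideanSpace ℝ (Fin N)) {t : ℝ} (ht : 0 < t) :
    t ^ N * bumpMean k f x₀ t = ∫ y, f y * bump k (t⁻¹ • (y - x₀)) := by
  have h1 := Measure.integral_comp_smul (volume : Measure (EuclideanSpace ℝ (Fin N)))
    (fun y => f (x₀ + y) * bump k (t⁻¹ • y)) t
  have h2 := integral_add_left_eq_self (μ := (volume : Measure (EuclideanSpace ℝ (Fin N))))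
    (fun y => f y * bump k (t⁻¹ • (y - x₀))) x₀
  simp only [add_sub_cancel_left] at h2
  rw [← h2]
  simp only [smul_smul, inv_mul_cancel₀ ht.ne', one_smul, finrank_euclideanSpace,
    Fintype.card_fin, smul_eq_mul] at h1
  rw [bumpMean, h1, abs_of_pos (by positivity)]
  field_simp

lemma hasCompactSupport_bump_affine (k : ℕ) (x₀ : EuclideanSpace ℝ (Fin N)) {t : ℝ} (ht : 0 < t) :
    HasCompactSupport fun y => bump (k + 1) (t⁻¹ • (y - x₀)) := by
  refine HasCompactSupport.intro (isCompact_closedBall x₀ t) fun x hx => bump_eq_zero ?_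
  rw [norm_smul, norm_inv, Real.norm_of_nonneg ht.le, ← div_eq_inv_mul, one_le_div ht]
  simpa [dist_eq_norm] using (not_le.1 (by simpa using hx) : t < dist x x₀).le

lemma integrable_mul_bump_affine {f : EuclideanSpace ℝ (Fin N) → ℝ} (hf : Continuous f) (k : ℕ)
    (x₀ : EuclideanSpace ℝ (Fin N)) {t : ℝ} (ht : 0 < t) :
    Integrable fun y => f y * bump (k + 1) (t⁻¹ • (y - x₀)) := by
  have := continuous_bump (N := N) (k + 1)
  exact (hf.mul (by fun_prop)).integrable_of_hasCompactSupport
    (hasCompactSupport_bump_affine k x₀ ht).mul_left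

lemma le_bump_affine (k : ℕ) {x₀ y : EuclideanSpace ℝ (Fin N)} {t θ : ℝ} (ht : 0 < t)
    (hθ : 0 ≤ θ) (hθ1 : θ ≤ 1) (h : ‖y - x₀‖ ≤ θ * t) :
    (1 - θ ^ 2) ^ k ≤ bump k (t⁻¹ • (y - x₀)) := by
  have h1 : ‖t⁻¹ • (y - x₀)‖ ≤ θ := by
    rw [norm_smul, norm_inv, Real.norm_of_nonneg ht.le, ← div_eq_inv_mul]
    exact (div_le_iff₀ ht).2 h
  refine pow_le_pow_left₀ (by nlinarith) (le_max_of_le_right ?_) _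
  nlinarith [norm_nonneg (t⁻¹ • (y - x₀))]

lemma bump_affine_eq_zero (k : ℕ) {x₀ y : EuclideanSpace ℝ (Fin N)} {t : ℝ} (ht : 0 < t)
    (h : t ≤ ‖y - x₀‖) : bump (k + 1) (t⁻¹ • (y - x₀)) = 0 := by
  refine bump_eq_zero ?_
  rwa [norm_smul, norm_inv, Real.norm_of_nonneg ht.le, ← div_eq_inv_mul, one_le_div ht]

/-- Averages over a ball are controlled by averages over a larger ball. -/
lemma bumpMean_le_bumpMean {f : EuclideanSpace ℝ (Fin N) → ℝ} (hf : Continuous f)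
    (h0 : ∀ x, 0 ≤ f x) (j k : ℕ) {x₀ x₁ : EuclideanSpace ℝ (Fin N)} {s t θ : ℝ} (hs : 0 < s)
    (ht : 0 < t) (hθ : 0 ≤ θ) (hθ1 : θ ≤ 1) (h : ‖x₀ - x₁‖ + s ≤ θ * t) :
    (1 - θ ^ 2) ^ (k + 1) * (s ^ N * bumpMean (j + 1) f x₀ s) ≤
      t ^ N * bumpMean (k + 1) f x₁ t := by
  rw [pow_mul_bumpMean f _ _ hs, pow_mul_bumpMean f _ _ ht, ← integral_const_mul]
  refine integral_mono ((integrable_mul_bump_affine hf _ _ hs).const_mul _)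
    (integrable_mul_bump_affine hf _ _ ht) fun y => ?_
  dsimp only
  rcases le_or_gt s ‖y - x₀‖ with hy | hy
  · rw [bump_affine_eq_zero j hs hy, mul_zero, mul_zero]
    exact mul_nonneg (h0 _) (bump_nonneg _ _)
  · rw [mul_left_comm]
    refine mul_le_mul_of_nonneg_left ?_ (h0 y)
    have h1 : ‖y - x₁‖ ≤ θ * t := by
      calc ‖y - x₁‖ ≤ ‖y - x₀‖ + ‖x₀ - x₁‖ := norm_sub_le_norm_sub_add_norm_sub _ _ _
        _ ≤ θ * t := by linarith
    have hpos : 0 ≤ (1 - θ ^ 2) ^ (k + 1) := pow_nonneg (by nlinarith) _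
    calc (1 - θ ^ 2) ^ (k + 1) * bump (j + 1) (s⁻¹ • (y - x₀))
        ≤ (1 - θ ^ 2) ^ (k + 1) * 1 := mul_le_mul_of_nonneg_left (bump_le_one _ _) hpos
      _ ≤ _ := by rw [mul_one]; exact le_bump_affine _ ht hθ hθ1 h1

lemma setIntegral_ball_le_bumpMean {f : EuclideanSpace ℝ (Fin N) → ℝ} (hf : Continuous f)
    (h0 : ∀ x, 0 ≤ f x) (k : ℕ) {x₀ : EuclideanSpace ℝ (Fin N)} {t θ : ℝ}
    (ht : 0 < t) (hθ : 0 ≤ θ) (hθ1 : θ ≤ 1) :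
    (1 - θ ^ 2) ^ (k + 1) * ∫ y in ball x₀ (θ * t), f y ≤ t ^ N * bumpMean (k + 1) f x₀ t := by
  rw [pow_mul_bumpMean f _ _ ht, ← integral_indicator measurableSet_ball, ← integral_const_mul]
  have hint : IntegrableOn f (ball x₀ (θ * t)) :=
    (hf.continuousOn.integrableOn_compact (isCompact_closedBall x₀ (θ * t))).mono_set
      ball_subset_closedBall
  refine integral_mono ((hint.integrable_indicator measurableSet_ball).const_mul _)
    (integrable_mul_bump_affine hf _ _ ht) fun y => ?_
  dsimp only
  by_cases hy : y ∈ ball x₀ (θ * t)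
  · rw [Set.indicator_of_mem hy, mul_comm]
    refine mul_le_mul_of_nonneg_left (le_bump_affine _ ht hθ hθ1 ?_) (h0 y)
    rw [← dist_eq_norm]; exact (mem_ball.1 hy).le
  · rw [Set.indicator_of_notMem hy, mul_zero]
    exact mul_nonneg (h0 _) (bump_nonneg _ _)

lemma bumpMean_le_setIntegral_ball {f : EuclideanSpace ℝ (Fin N) → ℝ} (hf : Continuous f)
    (h0 : ∀ x, 0 ≤ f x) (k : ℕ) {x₀ : EuclideanSpace ℝ (Fin N)} {t : ℝ} (ht : 0 < t) :
    t ^ N * bumpMean (k + 1) f x₀ t ≤ ∫ y in ball x₀ t, f y := by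
  rw [pow_mul_bumpMean f _ _ ht, ← integral_indicator measurableSet_ball]
  have hint : IntegrableOn f (ball x₀ t) :=
    (hf.continuousOn.integrableOn_compact (isCompact_closedBall x₀ t)).mono_set
      ball_subset_closedBall
  refine integral_mono (integrable_mul_bump_affine hf _ _ ht)
    (hint.integrable_indicator measurableSet_ball) fun y => ?_
  dsimp only
  by_cases hy : y ∈ ball x₀ t
  · rw [Set.indicator_of_mem hy]
    exact mul_le_of_le_one_right (h0 _) (bump_le_one _ _)
  · rw [Set.indicator_of_notMem hy, bump_affine_eq_zero _ ht, mul_zero]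
    rw [← dist_eq_norm]; simpa using hy

end MeanValue

/-! ### Positivity of λu − Δu and the profile bounding u from below. -/

section Helmholtz

open Laplacian Metric

variable {N : ℕ}

/-- Polynomial growth of the averages of a function over balls. -/
def PolyGrowth (u : EuclideanSpace ℝ (Fin N) → ℝ) : Prop :=
  ∃ (C : ℝ) (m : ℕ), ∀ R : ℝ, 1 ≤ R → bumpMean 1 u 0 R ≤ C * R ^ m

lemma contDiff_laplacian_two {u : EuclideanSpace ℝ (Fin N) → ℝ} (hu : ContDiff ℝ 4 u) :
    ContDiff ℝ 2 (Δ u) := contDiff_laplacian (n := 2) (by exact_mod_cast hu)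

lemma contDiff_helmholtz {u : EuclideanSpace ℝ (Fin N) → ℝ} (hu : ContDiff ℝ 4 u) (lam : ℝ) :
    ContDiff ℝ 2 fun x => lam * u x - (Δ u) x :=
  (contDiff_const.mul (hu.of_le (by norm_num))).sub (contDiff_laplacian_two hu)

lemma laplacian_helmholtz {u : EuclideanSpace ℝ (Fin N) → ℝ} (hu : ContDiff ℝ 4 u) (lam : ℝ)
    (x : EuclideanSpace ℝ (Fin N)) :
    (Δ fun x => lam * u x - (Δ u) x) x = lam * (Δ u) x - (Δ (Δ u)) x := by
  have h2 : ContDiff ℝ 2 u := hu.of_le (by norm_num)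
  have h := ContDiffAt.laplacian_sub (f₁ := lam • u) (f₂ := Δ u) (x := x)
    (h2.const_smul lam).contDiffAt (contDiff_laplacian_two hu).contDiffAt
  rw [InnerProductSpace.laplacian_smul lam h2.contDiffAt] at h
  exact h

lemma continuous_bilaplacian_sub {u : EuclideanSpace ℝ (Fin N) → ℝ} (hu : ContDiff ℝ 4 u)
    (lam : ℝ) : Continuous fun x => (Δ (Δ u)) x - lam * (Δ u) x :=
  ((contDiff_laplacian (n := 0) (by exact_mod_cast contDiff_laplacian_two hu)).continuous).sub
    (continuous_const.mul (contDiff_laplacian_two hu).continuous)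

/-- A function of polynomial growth with `λ u - Δ u` superharmonic satisfies `λ u - Δ u ≥ 0`. -/
lemma helmholtz_nonneg {u : EuclideanSpace ℝ (Fin N) → ℝ} (hu : ContDiff ℝ 4 u)
    (hu0 : ∀ x, 0 ≤ u x) {lam : ℝ} (hlam : 0 < lam)
    (hE : ∀ x, 0 ≤ (Δ (Δ u)) x - lam * (Δ u) x) (hg : PolyGrowth u)
    (x₀ : EuclideanSpace ℝ (Fin N)) : 0 ≤ lam * u x₀ - (Δ u) x₀ := by
  obtain ⟨C, m, hC⟩ := hg
  have hu2 : ContDiff ℝ 2 u := hu.of_le (by norm_num)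
  have hw := contDiff_helmholtz hu lam
  -- With this exponent b^(k+1) = (b²)^(m+1) · b. Where b² ≤ M/(λR²) this gains R^(−2(m+1)), which
  -- beats the growth R^m of the averages of u.
  set k : ℕ := 2 * m + 2 with hk
  set M : ℝ := 4 * (k + 3) * (k + 2) with hM
  have hM0 : 0 < M := by positivity
  set c := ∫ x : EuclideanSpace ℝ (Fin N), bump (k + 3) x with hc
  have hc0 : 0 < c := integral_bump_pos N _
  set B : ℝ := M * (M / lam) ^ (m + 1) * (4 / 3 * (4 ^ N * (|C| * 4 ^ m))) with hB
  have main (R : ℝ) (hR : 1 ≤ R) (hRx : ‖x₀‖ ≤ R) :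
      -B ≤ R ^ 2 * ((lam * u x₀ - (Δ u) x₀) * c) := by
    have hR0 : 0 < R := by linarith
    have h1 := bumpMean_le_of_laplacian_nonpos hw
      (fun x => by rw [laplacian_helmholtz hu]; linarith [hE x]) (k + 2) x₀ hR0.le
    rw [bumpMean_mul_sub hu.continuous (contDiff_laplacian_two hu).continuous] at h1
    have h2 := sq_mul_bumpMean_laplacian hu2 k x₀ R
    have hI0 (j : ℕ) : 0 ≤ bumpMean j u x₀ R := bumpMean_nonneg hu0 j x₀ R
    have h3 : R ^ 2 * bumpMean (k + 3) (Δ u) x₀ R ≤ M * bumpMean (k + 1) u x₀ R := by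
      rw [h2, hM]
      have : 0 ≤ 2 * ((k : ℝ) + 3) * ((N + 2 * (k + 2)) * bumpMean (k + 2) u x₀ R) :=
        mul_nonneg (by positivity) (mul_nonneg (by positivity) (hI0 _))
      linarith
    have h4 : M * bumpMean (k + 1) u x₀ R ≤ lam * R ^ 2 * bumpMean (k + 3) u x₀ R +
        M * (M / (lam * R ^ 2)) ^ (m + 1) * bumpMean 1 u x₀ R := by
      have ha : Continuous fun x => u (x₀ + R • x) := hu.continuous.comp (by fun_prop)
      unfold bumpMean
      rw [← integral_const_mul, ← integral_const_mul, ← integral_const_mul, ← integral_add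
        ((integrable_mul_bump ha (k + 2)).const_mul _) ((integrable_mul_bump ha 0).const_mul _)]
      refine integral_mono ((integrable_mul_bump ha k).const_mul _)
        (((integrable_mul_bump ha (k + 2)).const_mul _).add
          ((integrable_mul_bump ha 0).const_mul _)) fun x => ?_
      dsimp only
      set b := bump 1 x with hb
      have hb0 : 0 ≤ b := bump_nonneg _ _
      have hbk (j : ℕ) : bump j x = b ^ j := by simp [hb, bump]
      rw [hbk, hbk]
      have hden : 0 < lam * R ^ 2 := by positivity
      -- Where λR²b² ≥ M, the positive term λu of w absorbs the error left by Green's formula.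
      -- Elsewhere b is small, and the leftover is the last term.
      have key : M * b ^ (k + 1) ≤ lam * R ^ 2 * b ^ (k + 3) +
          M * (M / (lam * R ^ 2)) ^ (m + 1) * b := by
        rcases le_total M (lam * R ^ 2 * b ^ 2) with h | h
        · have h5 : M * b ^ (k + 1) ≤ lam * R ^ 2 * b ^ 2 * b ^ (k + 1) :=
            mul_le_mul_of_nonneg_right h (by positivity)
          have h6 : 0 ≤ M * (M / (lam * R ^ 2)) ^ (m + 1) * b := by positivity
          calc _ ≤ lam * R ^ 2 * b ^ 2 * b ^ (k + 1) := h5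
            _ = lam * R ^ 2 * b ^ (k + 3) := by ring
            _ ≤ _ := by linarith
        · have h5 : b ^ 2 ≤ M / (lam * R ^ 2) := by rw [le_div_iff₀ hden]; linarith
          have h6 : (b ^ 2) ^ (m + 1) ≤ (M / (lam * R ^ 2)) ^ (m + 1) :=
            pow_le_pow_left₀ (by positivity) h5 _
          have h7 : b ^ (k + 1) = (b ^ 2) ^ (m + 1) * b := by rw [hk]; ring
          have h8 : M * b ^ (k + 1) ≤ M * (M / (lam * R ^ 2)) ^ (m + 1) * b := by
            rw [h7, ← mul_assoc]; gcongr
          have h9 : 0 ≤ lam * R ^ 2 * b ^ (k + 3) := by positivity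
          linarith
      have := mul_le_mul_of_nonneg_left key (hu0 (x₀ + R • x))
      linarith
    have h5 : bumpMean 1 u x₀ R ≤ 4 / 3 * (4 ^ N * (|C| * 4 ^ m)) * R ^ m := by
      have h6 := bumpMean_le_bumpMean hu.continuous hu0 0 0 (x₀ := x₀) (x₁ := 0) (s := R)
        (t := 4 * R) (θ := 1 / 2) hR0 (by positivity) (by norm_num) (by norm_num)
        (by simp; linarith)
      have h7 := hC (4 * R) (by linarith)
      have h8 : bumpMean 1 u 0 (4 * R) ≤ |C| * (4 * R) ^ m :=
        h7.trans (mul_le_mul_of_nonneg_right (le_abs_self C) (by positivity))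
      simp only [zero_add] at h6
      rw [mul_pow, mul_left_comm, mul_comm (4 ^ N) (R ^ N), mul_assoc (R ^ N)] at h6
      have h9 := le_of_mul_le_mul_left h6 (by positivity)
      have h10 : 4 ^ N * bumpMean 1 u 0 (4 * R) ≤ 4 ^ N * (|C| * (4 * R) ^ m) := by gcongr
      rw [mul_pow] at h10
      nlinarith
    have h6 : M * (M / (lam * R ^ 2)) ^ (m + 1) * bumpMean 1 u x₀ R ≤ B := by
      have h7 : (M / (lam * R ^ 2)) ^ (m + 1) * R ^ m ≤ (M / lam) ^ (m + 1) := by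
        have : M / (lam * R ^ 2) = M / lam * (R ^ 2)⁻¹ := by field_simp
        rw [this, mul_pow, mul_assoc]
        refine mul_le_of_le_one_right (by positivity) ?_
        rw [inv_pow, ← pow_mul, ← div_eq_inv_mul, div_le_one (by positivity)]
        exact pow_le_pow_right₀ hR (by omega)
      calc M * (M / (lam * R ^ 2)) ^ (m + 1) * bumpMean 1 u x₀ R
          ≤ M * (M / (lam * R ^ 2)) ^ (m + 1) * (4 / 3 * (4 ^ N * (|C| * 4 ^ m)) * R ^ m) := by
            gcongr
        _ = M * ((M / (lam * R ^ 2)) ^ (m + 1) * R ^ m) * (4 / 3 * (4 ^ N * (|C| * 4 ^ m))) := by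
            ring
        _ ≤ B := by rw [hB]; gcongr
    have h7 := mul_le_mul_of_nonneg_left h1 (sq_nonneg R)
    rw [mul_sub] at h7
    change _ ≤ R ^ 2 * ((lam * u x₀ - (Δ u) x₀) * c) at h7
    refine le_trans ?_ h7
    have h8 : R ^ 2 * (lam * bumpMean (k + 2 + 1) u x₀ R) =
      lam * R ^ 2 * bumpMean (k + 3) u x₀ R := by ring_nf
    have h9 : R ^ 2 * bumpMean (k + 2 + 1) (Δ u) x₀ R = R ^ 2 * bumpMean (k + 3) (Δ u) x₀ R := rfl
    rw [h8, h9]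
    linarith
  by_contra! hneg
  set a := -(lam * u x₀ - (Δ u) x₀) * c with ha
  have ha0 : 0 < a := mul_pos (by linarith) hc0
  have hB0 : 0 ≤ B := by positivity
  -- The bound says R²a ≤ B for all large R. This radius gives R²a ≥ a + B.
  have h := main (1 + ‖x₀‖ + B / a) (by have := norm_nonneg x₀; have : 0 ≤ B / a := by positivity
                                        linarith) (by have : 0 ≤ B / a := by positivity
                                                      linarith)
  set R := 1 + ‖x₀‖ + B / a with hR
  have hR1 : 1 + B / a ≤ R := by linarith [norm_nonneg x₀]
  have h1 : R ^ 2 * a ≤ B := by nlinarith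
  have h2 : (1 + B / a) * a ≤ R ^ 2 * a := by
    gcongr
    have : 0 ≤ B / a := by positivity
    nlinarith
  have h3 : (1 + B / a) * a = a + B := by field_simp
  linarith

/-- Lower bound for `u` in terms of a profile `g`, which dominates the mass of
`Δ² u - λ Δ u` on balls. -/
lemma exists_profile {u : EuclideanSpace ℝ (Fin N) → ℝ} (hu : ContDiff ℝ 4 u)
    (hu0 : ∀ x, 0 ≤ u x) {lam : ℝ} (hlam : 0 < lam)
    (hE : ∀ x, 0 ≤ (Δ (Δ u)) x - lam * (Δ u) x)
    (hw0 : ∀ x, 0 ≤ lam * u x - (Δ u) x) :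
    ∃ c > 0, ∃ g : ℝ → ℝ, ∀ R : ℝ, 1 ≤ R → 0 ≤ g R ∧
      (∀ x : EuclideanSpace ℝ (Fin N), ‖x‖ ≤ R → c * (R ^ 2 * g R) ≤ R ^ N * u x) ∧
      c * ∫ y in ball (0 : EuclideanSpace ℝ (Fin N)) (R / 2), ((Δ (Δ u)) y - lam * (Δ u) y)
        ≤ g R := by
  have hw := contDiff_helmholtz hu lam
  set w := fun x => lam * u x - (Δ u) x with hwdef
  set E := fun x => (Δ (Δ u)) x - lam * (Δ u) x with hEdef
  have hEc : Continuous E := continuous_bilaplacian_sub hu lam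
  have hlap (x) : (Δ w) x = - E x := by
    rw [hwdef, laplacian_helmholtz hu]; simp only [hEdef]; ring
  set c₂ := ∫ x : EuclideanSpace ℝ (Fin N), bump 2 x with hc₂
  have hc₂0 : 0 < c₂ := integral_bump_pos N _
  set κ : ℝ := (7 / 16) ^ 2 / (4 ^ N * c₂ * (2 * N + lam)) with hκ
  have hκ0 : 0 < κ := by positivity
  set κ' : ℝ := (3 / 4) ^ 3 / (6 * (N + 4)) with hκ'
  have hκ'0 : 0 < κ' := by positivity
  -- The profile is R^(N−2) times the average of w over the ball of radius R. κ serves the lower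
  -- bound for u, and κ' the domination of the mass of E.
  refine ⟨min κ κ', lt_min hκ0 hκ'0, fun R => R ^ N * bumpMean 2 w 0 R / R ^ 2, fun R hR => ?_⟩
  have hR0 : 0 < R := by linarith
  have hm0 : 0 ≤ bumpMean 2 w 0 R := bumpMean_nonneg hw0 2 0 R
  refine ⟨by positivity, fun x hx => ?_, ?_⟩
  · have h1 (y : EuclideanSpace ℝ (Fin N)) (hy : ‖y - x‖ ≤ 1) :
        (7 / 16) ^ 2 * bumpMean 2 w 0 R / (4 ^ N * c₂) ≤ w y := by
      have hy' : ‖y‖ ≤ 2 * R := by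
        have := norm_le_norm_add_norm_sub x y
        rw [norm_sub_rev] at this
        linarith
      -- For |y| ≤ 2R the ball of radius R about 0 lies in the ball of radius 3R = (3/4)·4R about y.
      -- Hence the constant 1 − (3/4)² = 7/16.
      have h2 := bumpMean_le_bumpMean hw.continuous hw0 1 1 (x₀ := 0) (x₁ := y) (s := R)
        (t := 4 * R) (θ := 3 / 4) hR0 (by positivity) (by norm_num) (by norm_num)
        (by simp; linarith)
      have h3 := bumpMean_le_of_laplacian_nonpos hw
        (fun x => by rw [hlap]; linarith [hE x]) 1 y (t := 4 * R) (by positivity)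
      change _ ≤ w y * c₂ at h3
      norm_num only at h2 h3
      rw [mul_pow, mul_left_comm, mul_comm (4 ^ N) (R ^ N), mul_assoc (R ^ N)] at h2
      have h4 := le_of_mul_le_mul_left h2 (by positivity)
      rw [div_le_iff₀ (by positivity)]
      have h5 : 4 ^ N * bumpMean 2 w y (4 * R) ≤ 4 ^ N * (w y * c₂) := by gcongr
      nlinarith
    have h2 := le_of_helmholtz_supersolution (hu.of_le (by norm_num)) hu0 hlam x h1
    have h3 : κ * bumpMean 2 w 0 R ≤ u x := by
      refine le_trans (le_of_eq ?_) h2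
      rw [hκ]; field_simp
    calc min κ κ' * (R ^ 2 * (R ^ N * bumpMean 2 w 0 R / R ^ 2))
        = R ^ N * (min κ κ' * bumpMean 2 w 0 R) := by field_simp
      _ ≤ R ^ N * (κ * bumpMean 2 w 0 R) := by gcongr; exact min_le_left _ _
      _ ≤ R ^ N * u x := by gcongr
  -- Green's formula with −Δw = E: the average of w with exponent 1 enters with the favourable sign
  -- and is dropped, leaving the exponent-2 average that defines the profile.
  · have h1 := sq_mul_bumpMean_laplacian hw 0 (0 : EuclideanSpace ℝ (Fin N)) R
    have h2 : bumpMean 3 (Δ w) 0 R = - bumpMean 3 E 0 R := by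
      unfold bumpMean
      rw [← integral_neg]
      congr 1; ext x; rw [hlap]; ring
    simp only [zero_add, Nat.cast_zero, h2] at h1
    have h3 := setIntegral_ball_le_bumpMean hEc hE 2 (x₀ := 0) (t := R) (θ := 1 / 2) hR0
      (by norm_num) (by norm_num)
    have hm1 : 0 ≤ bumpMean 1 w 0 R := bumpMean_nonneg hw0 1 0 R
    have h4 : R ^ 2 * bumpMean 3 E 0 R ≤ 6 * (N + 4) * bumpMean 2 w 0 R := by linarith
    have hInt : 0 ≤ ∫ y in ball (0 : EuclideanSpace ℝ (Fin N)) (R / 2), E y :=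
      setIntegral_nonneg measurableSet_ball fun y _ => hE y
    rw [show 1 / 2 * R = R / 2 by ring] at h3
    norm_num only at h3
    have h5 : κ' * ∫ y in ball (0 : EuclideanSpace ℝ (Fin N)) (R / 2), E y ≤
        R ^ N * bumpMean 2 w 0 R / R ^ 2 := by
      rw [hκ', le_div_iff₀ (by positivity)]
      have h6 : R ^ 2 * (R ^ N * bumpMean 3 E 0 R) ≤ R ^ N * (6 * (N + 4) * bumpMean 2 w 0 R) := by
        rw [mul_left_comm]; gcongr
      have h7 : R ^ 2 * (27 / 64 * ∫ y in ball (0 : EuclideanSpace ℝ (Fin N)) (R / 2), E y) ≤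
        R ^ 2 * (R ^ N * bumpMean 3 E 0 R) := by gcongr
      have h8 := h7.trans h6
      rw [div_mul_eq_mul_div, div_mul_eq_mul_div, div_le_iff₀ (by positivity)]
      norm_num only
      linarith
    refine le_trans ?_ h5
    gcongr
    exact min_le_right _ _

end Helmholtz

/-! ### Kernel bounds, dyadic annuli and growth of the p-th moments. -/

section Kernel

open Laplacian Metric

variable {N : ℕ}

/-- The sign of β is not prescribed, so both comparisons of t with s are needed: the lower one acts
for β ≥ 0, the upper one for β ≤ 0. -/
lemma min_rpow_mul_le_rpow {a b s t : ℝ} (β : ℝ) (ha : 0 < a) (hb : 0 < b) (hs : 0 < s)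
    (h1 : a * s ≤ t) (h2 : t ≤ b * s) : min (a ^ β) (b ^ β) * s ^ β ≤ t ^ β := by
  have ht : 0 < t := lt_of_lt_of_le (by positivity) h1
  rcases le_total 0 β with h | h
  · calc min (a ^ β) (b ^ β) * s ^ β ≤ a ^ β * s ^ β := by gcongr; exact min_le_left _ _
      _ = (a * s) ^ β := (Real.mul_rpow ha.le hs.le).symm
      _ ≤ t ^ β := Real.rpow_le_rpow (by positivity) h1 h
  · calc min (a ^ β) (b ^ β) * s ^ β ≤ b ^ β * s ^ β := by gcongr; exact min_le_right _ _
      _ = (b * s) ^ β := (Real.mul_rpow hb.le hs.le).symm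
      _ ≤ t ^ β := Real.rpow_le_rpow_of_nonpos ht h2 h

lemma logKernel_nonneg (α β : ℝ) (z : EuclideanSpace ℝ (Fin N)) : 0 ≤ logKernel α β z :=
  mul_nonneg (Real.rpow_nonneg (norm_nonneg _) _)
    (Real.rpow_nonneg (Real.log_nonneg (by linarith [norm_nonneg z])) _)

variable (N) in
/-- The kernel is bounded below on dyadic annuli. -/
lemma exists_le_logKernel_dyadic {α : ℝ} (hα : 0 ≤ α) (β : ℝ) :
    ∃ κ > 0, ∀ i : ℕ, 2 ≤ i → ∀ z : EuclideanSpace ℝ (Fin N), 2 ^ i ≤ 2 * ‖z‖ →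
      ‖z‖ ≤ 2 ^ (i + 2) → κ * (((2 : ℝ) ^ i) ^ (-α) * (i : ℝ) ^ β) ≤ logKernel α β z := by
  have hl : 0 < Real.log 2 := Real.log_pos (by norm_num)
  set μ := min ((Real.log 2 / 2) ^ β) ((3 * Real.log 2) ^ β) with hμ
  have hμ0 : 0 < μ := lt_min (by positivity) (by positivity)
  refine ⟨(4 : ℝ) ^ (-α) * μ, by positivity, fun i hi z h1 h2 => ?_⟩
  have hi' : (2 : ℝ) ≤ i := by exact_mod_cast hi
  have hz : 0 < ‖z‖ := by
    have : (0 : ℝ) < 2 ^ i := by positivity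
    linarith
  have h3 : (4 : ℝ) ^ (-α) * ((2 : ℝ) ^ i) ^ (-α) ≤ ‖z‖ ^ (-α) := by
    rw [← Real.mul_rpow (by norm_num) (by positivity)]
    refine Real.rpow_le_rpow_of_nonpos hz ?_ (by linarith)
    calc ‖z‖ ≤ 2 ^ (i + 2) := h2
      _ = 4 * 2 ^ i := by ring
  -- Since i ≥ 2, log(1 + |z|) lies between (i−1) log 2 ≥ (i/2) log 2 and (i+3) log 2 ≤ 3i log 2.
  have h4 : μ * (i : ℝ) ^ β ≤ Real.log (1 + ‖z‖) ^ β := by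
    refine min_rpow_mul_le_rpow β (by positivity) (by positivity) (by linarith) ?_ ?_
    · have h5 : Real.log (2 ^ i) ≤ Real.log (2 * (1 + ‖z‖)) :=
        Real.log_le_log (by positivity) (by linarith)
      rw [Real.log_pow, Real.log_mul (by norm_num) (by positivity)] at h5
      nlinarith
    · have h5 : Real.log (1 + ‖z‖) ≤ Real.log (2 ^ (i + 3)) := by
        refine Real.log_le_log (by positivity) ?_
        have : (1 : ℝ) ≤ 2 ^ (i + 2) := one_le_pow₀ (by norm_num)
        calc 1 + ‖z‖ ≤ 2 ^ (i + 2) + 2 ^ (i + 2) := by linarith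
          _ = 2 ^ (i + 3) := by ring
      rw [Real.log_pow] at h5
      push_cast at h5
      nlinarith
  calc _ = ((4 : ℝ) ^ (-α) * ((2 : ℝ) ^ i) ^ (-α)) * (μ * (i : ℝ) ^ β) := by ring
    _ ≤ logKernel α β z := by unfold logKernel; gcongr

variable (N) in
/-- The kernel decays at most polynomially. -/
lemma exists_le_logKernel_mul_pow (α β : ℝ) :
    ∃ κ > 0, ∃ M : ℕ, ∀ z : EuclideanSpace ℝ (Fin N), 1 ≤ ‖z‖ →
      κ ≤ logKernel α β z * ‖z‖ ^ M := by
  have hl : 0 < Real.log 2 := Real.log_pos (by norm_num)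
  set μ := min 1 (Real.log 2 ^ β) with hμ
  have hμ0 : 0 < μ := lt_min one_pos (by positivity)
  obtain ⟨M, hM⟩ := exists_nat_ge (α + |β|)
  refine ⟨μ, hμ0, M, fun z hz => ?_⟩
  have hz0 : 0 < ‖z‖ := by linarith
  have h1 : μ * ‖z‖ ^ (-|β|) ≤ Real.log (1 + ‖z‖) ^ β := by
    rcases le_total 0 β with h | h
    · calc μ * ‖z‖ ^ (-|β|) ≤ Real.log 2 ^ β * 1 := by
            gcongr
            · exact min_le_right _ _
            · exact Real.rpow_le_one_of_one_le_of_nonpos hz (by simp)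
        _ ≤ _ := by
            rw [mul_one]
            exact Real.rpow_le_rpow hl.le (Real.log_le_log (by norm_num) (by linarith)) h
    · calc μ * ‖z‖ ^ (-|β|) ≤ 1 * ‖z‖ ^ β := by
            rw [abs_of_nonpos h, neg_neg]
            gcongr
            exact min_le_left _ _
        _ ≤ _ := by
            rw [one_mul]
            refine Real.rpow_le_rpow_of_nonpos (Real.log_pos (by linarith)) ?_ h
            have := Real.log_le_sub_one_of_pos (show 0 < 1 + ‖z‖ by linarith)
            linarith
  have h2 : 1 ≤ ‖z‖ ^ (-α) * ‖z‖ ^ (-|β|) * ‖z‖ ^ M := by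
    rw [← Real.rpow_natCast ‖z‖ M, ← Real.rpow_add hz0, ← Real.rpow_add hz0]
    exact Real.one_le_rpow hz (by linarith)
  calc μ ≤ μ * (‖z‖ ^ (-α) * ‖z‖ ^ (-|β|) * ‖z‖ ^ M) := le_mul_of_one_le_right hμ0.le h2
    _ = ‖z‖ ^ (-α) * (μ * ‖z‖ ^ (-|β|)) * ‖z‖ ^ M := by ring
    _ ≤ _ := by unfold logKernel; gcongr

/-- A lower bound for the convolution by a sum over disjoint sets. -/
lemma sum_le_toReal_kernelConv {α β p : ℝ} {u : EuclideanSpace ℝ (Fin N) → ℝ}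
    {x : EuclideanSpace ℝ (Fin N)} (hfin : kernelConv α β p u x < ∞) {ι : Type*} (s : Finset ι)
    (S : ι → Set (EuclideanSpace ℝ (Fin N))) (hS : ∀ i ∈ s, MeasurableSet (S i))
    (hd : Set.PairwiseDisjoint (s : Set ι) S) (a v : ι → ℝ)
    (ha0 : ∀ i ∈ s, 0 ≤ a i) (hv0 : ∀ i ∈ s, 0 ≤ v i)
    (hv : ∀ i ∈ s, ENNReal.ofReal (v i) ≤ volume (S i))
    (ha : ∀ i ∈ s, ∀ y ∈ S i, a i ≤ logKernel α β (x - y) * u y ^ p) :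
    ∑ i ∈ s, a i * v i ≤ (kernelConv α β p u x).toReal := by
  rw [← ENNReal.ofReal_le_iff_le_toReal hfin.ne,
    ENNReal.ofReal_sum_of_nonneg fun i hi => mul_nonneg (ha0 i hi) (hv0 i hi)]
  calc ∑ i ∈ s, ENNReal.ofReal (a i * v i)
      ≤ ∑ i ∈ s, ∫⁻ y in S i, ENNReal.ofReal (logKernel α β (x - y) * u y ^ p) := by
        refine Finset.sum_le_sum fun i hi => ?_
        rw [ENNReal.ofReal_mul (ha0 i hi)]
        calc ENNReal.ofReal (a i) * ENNReal.ofReal (v i)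
            ≤ ENNReal.ofReal (a i) * volume (S i) := by gcongr; exact hv i hi
          _ = ∫⁻ _ in S i, ENNReal.ofReal (a i) := by simp
          _ ≤ _ := setLIntegral_mono' (hS i hi) fun y hy => ENNReal.ofReal_le_ofReal (ha i hi y hy)
    _ = ∫⁻ y in ⋃ i ∈ s, S i, ENNReal.ofReal (logKernel α β (x - y) * u y ^ p) :=
        (lintegral_biUnion_finset hd hS _).symm
    _ ≤ kernelConv α β p u x := setLIntegral_le_lintegral _ _

lemma mul_le_toReal_kernelConv {α β p : ℝ} {u : EuclideanSpace ℝ (Fin N) → ℝ}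
    {x : EuclideanSpace ℝ (Fin N)} (hfin : kernelConv α β p u x < ∞)
    {S : Set (EuclideanSpace ℝ (Fin N))} (hS : MeasurableSet S) {a v : ℝ}
    (ha0 : 0 ≤ a) (hv0 : 0 ≤ v) (hv : ENNReal.ofReal v ≤ volume S)
    (ha : ∀ y ∈ S, a ≤ logKernel α β (x - y) * u y ^ p) :
    a * v ≤ (kernelConv α β p u x).toReal := by
  simpa using sum_le_toReal_kernelConv hfin {()} (fun _ => S) (fun _ _ => hS) (by simp)
    (fun _ => a) (fun _ => v) (fun _ _ => ha0) (fun _ _ => hv0) (fun _ _ => hv) fun _ _ => ha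

/-- The dyadic annulus `2^i ≤ |x| < 2^(i+1)`. -/
def dyadicAnnulus (N i : ℕ) : Set (EuclideanSpace ℝ (Fin N)) :=
  ball 0 (2 ^ (i + 1)) \ ball 0 (2 ^ i)

lemma mem_dyadicAnnulus {i : ℕ} {x : EuclideanSpace ℝ (Fin N)} :
    x ∈ dyadicAnnulus N i ↔ ‖x‖ < 2 ^ (i + 1) ∧ 2 ^ i ≤ ‖x‖ := by
  simp [dyadicAnnulus]

lemma measurableSet_dyadicAnnulus (i : ℕ) : MeasurableSet (dyadicAnnulus N i) :=
  measurableSet_ball.diff measurableSet_ball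

lemma disjoint_dyadicAnnulus {i j : ℕ} (h : i ≠ j) :
    Disjoint (dyadicAnnulus N i) (dyadicAnnulus N j) := by
  wlog hij : i < j generalizing i j
  · exact (this h.symm (by omega)).symm
  refine Set.disjoint_left.2 fun x hx hy => ?_
  rw [mem_dyadicAnnulus] at hx hy
  have : (2 : ℝ) ^ (i + 1) ≤ 2 ^ j := pow_le_pow_right₀ (by norm_num) hij
  linarith

variable (N) in
lemma volume_real_ball_pos : 0 < volume.real (ball (0 : EuclideanSpace ℝ (Fin N)) 1) :=
  ENNReal.toReal_pos (measure_ball_pos _ _ one_pos).ne' measure_ball_lt_top.ne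

lemma volume_real_ball_eq (x : EuclideanSpace ℝ (Fin N)) {r : ℝ} (hr : 0 < r) :
    volume.real (ball x r) = r ^ N * volume.real (ball (0 : EuclideanSpace ℝ (Fin N)) 1) := by
  rw [Measure.real, Measure.addHaar_ball_of_pos _ _ hr, ENNReal.toReal_mul,
    ENNReal.toReal_ofReal (by positivity), finrank_euclideanSpace, Fintype.card_fin, Measure.real]

lemma le_volume_real_dyadicAnnulus (hN : 1 ≤ N) (i : ℕ) :
    ((2 : ℝ) ^ i) ^ N * volume.real (ball (0 : EuclideanSpace ℝ (Fin N)) 1) ≤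
      volume.real (dyadicAnnulus N i) := by
  have hsub : ball (0 : EuclideanSpace ℝ (Fin N)) (2 ^ i) ⊆ ball 0 (2 ^ (i + 1)) :=
    ball_subset_ball (pow_le_pow_right₀ (by norm_num) (by omega))
  rw [dyadicAnnulus, measureReal_sdiff hsub measurableSet_ball,
    volume_real_ball_eq _ (r := 2 ^ (i + 1)) (by positivity),
    volume_real_ball_eq _ (r := 2 ^ i) (by positivity), ← sub_mul]
  refine mul_le_mul_of_nonneg_right ?_ measureReal_nonneg
  have h1 : ((2 : ℝ) ^ (i + 1)) ^ N = 2 ^ N * (2 ^ i) ^ N := by rw [pow_succ]; ring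
  have h2 : (2 : ℝ) ≤ 2 ^ N := by
    calc (2 : ℝ) = 2 ^ 1 := by norm_num
      _ ≤ 2 ^ N := pow_le_pow_right₀ (by norm_num) hN
  have h3 : (0 : ℝ) < (2 ^ i) ^ N := by positivity
  rw [h1]
  nlinarith

lemma ofReal_le_volume_dyadicAnnulus (hN : 1 ≤ N) (i : ℕ) :
    ENNReal.ofReal (((2 : ℝ) ^ i) ^ N * volume.real (ball (0 : EuclideanSpace ℝ (Fin N)) 1)) ≤
      volume (dyadicAnnulus N i) := by
  have h : volume (dyadicAnnulus N i) ≠ ∞ :=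
    ((measure_mono Set.sdiff_subset).trans_lt measure_ball_lt_top).ne
  exact (ENNReal.ofReal_le_iff_le_toReal h).2 (le_volume_real_dyadicAnnulus hN i)

/-- The annulus has at least the volume of the inner ball, because 2^N − 1 ≥ 1. This yields the
increment of the dyadic masses. -/
lemma add_le_setIntegral_ball (hN : 1 ≤ N) {f : EuclideanSpace ℝ (Fin N) → ℝ} (hf : Continuous f)
    (n : ℕ) {a : ℝ} (ha : 0 ≤ a) (h : ∀ x ∈ dyadicAnnulus N n, a ≤ f x) :
    (∫ y in ball (0 : EuclideanSpace ℝ (Fin N)) (2 ^ n), f y) +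
        volume.real (ball (0 : EuclideanSpace ℝ (Fin N)) 1) * ((2 ^ n) ^ N * a) ≤
      ∫ y in ball (0 : EuclideanSpace ℝ (Fin N)) (2 ^ (n + 1)), f y := by
  have hint (r : ℝ) : IntegrableOn f (ball (0 : EuclideanSpace ℝ (Fin N)) r) :=
    (hf.continuousOn.integrableOn_compact (isCompact_closedBall 0 r)).mono_set
      ball_subset_closedBall
  have hsub : ball (0 : EuclideanSpace ℝ (Fin N)) (2 ^ n) ⊆ ball 0 (2 ^ (n + 1)) :=
    ball_subset_ball (pow_le_pow_right₀ (by norm_num) (by omega))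
  have h1 := setIntegral_union (μ := volume) (f := f)
    (Set.disjoint_sdiff_right (s := ball (0 : EuclideanSpace ℝ (Fin N)) (2 ^ n))
      (t := ball 0 (2 ^ (n + 1)))) (measurableSet_ball.diff measurableSet_ball) (hint _)
    ((hint (2 ^ (n + 1))).mono_set Set.sdiff_subset)
  rw [Set.union_sdiff_cancel hsub] at h1
  rw [h1]
  have hfin : volume (dyadicAnnulus N n) ≠ ∞ :=
    ((measure_mono Set.sdiff_subset).trans_lt measure_ball_lt_top).ne
  have h2 := setIntegral_ge_of_const_le_real (measurableSet_dyadicAnnulus (N := N) n) hfin h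
    ((hint (2 ^ (n + 1))).mono_set Set.sdiff_subset)
  have h3 := mul_le_mul_of_nonneg_left (le_volume_real_dyadicAnnulus hN n) ha
  change _ ≤ _ + ∫ y in dyadicAnnulus N n, f y
  nlinarith

/-- Finiteness of the convolution gives polynomial growth of the `p`-th moments. -/
lemma exists_setIntegral_rpow_le {α β p : ℝ} (hp : 0 < p) {u : EuclideanSpace ℝ (Fin N) → ℝ}
    (hu : Continuous u) (hu0 : ∀ x, 0 ≤ u x) (hfin : kernelConv α β p u 0 < ∞) :
    ∃ (C : ℝ) (M : ℕ), 0 ≤ C ∧ ∀ R : ℝ, 1 ≤ R →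
      ∫ y in ball (0 : EuclideanSpace ℝ (Fin N)) R, u y ^ p ≤ C * R ^ M := by
  obtain ⟨κ, hκ, M, hM⟩ := exists_le_logKernel_mul_pow N α β
  have hup : Continuous fun y => u y ^ p := hu.rpow_const fun _ => Or.inr hp.le
  have hup0 (y) : 0 ≤ u y ^ p := Real.rpow_nonneg (hu0 y) p
  have hint (r : ℝ) : IntegrableOn (fun y => u y ^ p) (ball (0 : EuclideanSpace ℝ (Fin N)) r) :=
    (hup.continuousOn.integrableOn_compact (isCompact_closedBall 0 r)).mono_set
      ball_subset_closedBall
  set A := ∫ y in ball (0 : EuclideanSpace ℝ (Fin N)) 1, u y ^ p with hA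
  have hA0 : 0 ≤ A := setIntegral_nonneg measurableSet_ball fun y _ => hup0 y
  refine ⟨A + κ⁻¹ * (kernelConv α β p u 0).toReal, M, by positivity, fun R hR => ?_⟩
  have hR0 : 0 < R := by linarith
  have hsub : ball (0 : EuclideanSpace ℝ (Fin N)) 1 ⊆ ball 0 R := ball_subset_ball hR
  have h1 := setIntegral_union (μ := volume) (f := fun y => u y ^ p)
    (Set.disjoint_sdiff_right (s := ball (0 : EuclideanSpace ℝ (Fin N)) 1)
      (t := ball 0 R)) (measurableSet_ball.diff measurableSet_ball) (hint _)
    ((hint R).mono_set Set.sdiff_subset)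
  rw [Set.union_sdiff_cancel hsub] at h1
  have h2 : ∫ y in ball (0 : EuclideanSpace ℝ (Fin N)) R \ ball 0 1, u y ^ p ≤
      κ⁻¹ * R ^ M * (kernelConv α β p u 0).toReal := by
    rw [← ENNReal.ofReal_le_ofReal_iff (by positivity), ENNReal.ofReal_mul (by positivity),
      ENNReal.ofReal_toReal hfin.ne, ofReal_integral_eq_lintegral_ofReal
        ((hint R).mono_set Set.sdiff_subset) (Filter.Eventually.of_forall hup0)]
    calc ∫⁻ y in ball (0 : EuclideanSpace ℝ (Fin N)) R \ ball 0 1, ENNReal.ofReal (u y ^ p)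
        ≤ ∫⁻ y in ball (0 : EuclideanSpace ℝ (Fin N)) R \ ball 0 1, ENNReal.ofReal (κ⁻¹ * R ^ M) *
            ENNReal.ofReal (logKernel α β (0 - y) * u y ^ p) := by
          refine setLIntegral_mono' (measurableSet_ball.diff measurableSet_ball) fun y hy => ?_
          rw [← ENNReal.ofReal_mul (by positivity)]
          refine ENNReal.ofReal_le_ofReal ?_
          have hy1 : ‖y‖ < R ∧ 1 ≤ ‖y‖ := by simpa using hy
          have h3 := hM (0 - y) (by simpa using hy1.2)
          have h4 : κ ≤ logKernel α β (0 - y) * R ^ M := by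
            refine h3.trans ?_
            have : ‖0 - y‖ ≤ R := by simpa using hy1.1.le
            gcongr
            exact logKernel_nonneg _ _ _
          calc u y ^ p = κ⁻¹ * κ * u y ^ p := by field_simp
            _ ≤ κ⁻¹ * (logKernel α β (0 - y) * R ^ M) * u y ^ p := by
              have := hup0 y
              gcongr
            _ = _ := by ring
      _ = ENNReal.ofReal (κ⁻¹ * R ^ M) * ∫⁻ y in ball (0 : EuclideanSpace ℝ (Fin N)) R \ ball 0 1,
            ENNReal.ofReal (logKernel α β (0 - y) * u y ^ p) :=
          lintegral_const_mul' _ _ ENNReal.ofReal_ne_top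
      _ ≤ _ := by
          gcongr
          exact setLIntegral_le_lintegral _ _
  have h3 : A ≤ A * R ^ M := le_mul_of_one_le_right hA0 (one_le_pow₀ hR)
  rw [h1]
  nlinarith

lemma polyGrowth_of_setIntegral {u : EuclideanSpace ℝ (Fin N) → ℝ} (hu : Continuous u)
    (hu0 : ∀ x, 0 ≤ u x) {C : ℝ} {m : ℕ}
    (h : ∀ R : ℝ, 1 ≤ R → ∫ y in ball (0 : EuclideanSpace ℝ (Fin N)) R, u y ≤ C * R ^ m) :
    PolyGrowth u := by
  refine ⟨C, m, fun R hR => ?_⟩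
  refine le_trans ?_ (h R hR)
  refine le_trans ?_ (bumpMean_le_setIntegral_ball hu hu0 0 (by linarith))
  exact le_mul_of_one_le_left (bumpMean_nonneg hu0 1 0 R) (one_le_pow₀ hR)

/-- Polynomial growth when `p ≥ 1`. -/
lemma polyGrowth_of_one_le_p {α β p : ℝ} (hp : 1 ≤ p) {u : EuclideanSpace ℝ (Fin N) → ℝ}
    (hu : Continuous u) (hu0 : ∀ x, 0 ≤ u x) (hfin : kernelConv α β p u 0 < ∞) :
    PolyGrowth u := by
  obtain ⟨C, M, hC0, hC⟩ := exists_setIntegral_rpow_le (by linarith) hu hu0 hfin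
  have hup : Continuous fun y => u y ^ p := hu.rpow_const fun _ => Or.inr (by linarith)
  have hint {f : EuclideanSpace ℝ (Fin N) → ℝ} (hf : Continuous f) (r : ℝ) :
      IntegrableOn f (ball (0 : EuclideanSpace ℝ (Fin N)) r) :=
    (hf.continuousOn.integrableOn_compact (isCompact_closedBall 0 r)).mono_set
      ball_subset_closedBall
  set ω := volume.real (ball (0 : EuclideanSpace ℝ (Fin N)) 1) with hω
  have hω0 : 0 < ω := volume_real_ball_pos N
  refine polyGrowth_of_setIntegral hu hu0 (C := ω + C) (m := N + M) fun R hR => ?_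
  have h1 : ∫ y in ball (0 : EuclideanSpace ℝ (Fin N)) R, u y ≤
      ∫ y in ball (0 : EuclideanSpace ℝ (Fin N)) R, (1 + u y ^ p) := by
    refine setIntegral_mono (hint hu R) (hint (continuous_const.add hup) R) fun y => ?_
    dsimp only
    rcases le_total (u y) 1 with h | h
    · linarith [Real.rpow_nonneg (hu0 y) p]
    · linarith [Real.self_le_rpow_of_one_le h hp]
  rw [integral_add (hint continuous_const R) (hint hup R), setIntegral_const, smul_eq_mul, mul_one,
    volume_real_ball_eq _ (by linarith)] at h1
  have h2 := hC R hR
  have h3 : R ^ N ≤ R ^ (N + M) := pow_le_pow_right₀ hR (by omega)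
  have h4 : R ^ M ≤ R ^ (N + M) := pow_le_pow_right₀ hR (by omega)
  nlinarith

end Kernel

/-! ### Polynomial growth of the averages of u when q > 1 or N ≤ 2. -/

section Growth

open Laplacian Metric

variable {N : ℕ}

/-- Both terms of Green's formula are averages of the non-negative f, and the one with the larger
exponent is the smaller. No sign of Δf is needed. -/
lemma abs_sq_mul_bumpMean_laplacian_le {f : EuclideanSpace ℝ (Fin N) → ℝ} (hf : ContDiff ℝ 2 f)
    (h0 : ∀ x, 0 ≤ f x) (k : ℕ) (x₀ : EuclideanSpace ℝ (Fin N)) (t : ℝ) :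
    |t ^ 2 * bumpMean (k + 3) (Δ f) x₀ t| ≤
      2 * (k + 3) * (N + 4 * (k + 2)) * bumpMean (k + 1) f x₀ t := by
  rw [sq_mul_bumpMean_laplacian hf]
  have h1 : bumpMean (k + 2) f x₀ t ≤ bumpMean (k + 1) f x₀ t :=
    bumpMean_anti hf.continuous h0 (Nat.le_succ k) x₀ t
  have h2 : 0 ≤ bumpMean (k + 2) f x₀ t := bumpMean_nonneg h0 _ _ _
  have h3 : 0 ≤ bumpMean (k + 1) f x₀ t := bumpMean_nonneg h0 _ _ _
  have hk : (0 : ℝ) < 2 * (k + 3) := by positivity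
  rw [abs_mul, abs_of_pos hk, mul_assoc (2 * ((k : ℝ) + 3))]
  refine mul_le_mul_of_nonneg_left ?_ hk.le
  have h4 : 0 ≤ (2 : ℝ) * (k + 2) * bumpMean (k + 1) f x₀ t := by positivity
  have h5 : 0 ≤ ((N : ℝ) + 2 * (k + 2)) * bumpMean (k + 2) f x₀ t := by positivity
  have h6 : ((N : ℝ) + 2 * (k + 2)) * bumpMean (k + 2) f x₀ t ≤
      ((N : ℝ) + 2 * (k + 2)) * bumpMean (k + 1) f x₀ t := by gcongr
  rw [abs_le]
  have h7 : 0 ≤ (N : ℝ) * bumpMean (k + 1) f x₀ t := by positivity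
  constructor <;> linarith

/-- The mass of `Δ² u - λ Δ u` on a ball is controlled by the mass of `u`. -/
lemma exists_bumpMean_energy_le {u : EuclideanSpace ℝ (Fin N) → ℝ} (hu : ContDiff ℝ 4 u)
    (hu0 : ∀ x, 0 ≤ u x) {lam : ℝ} (hlam : 0 < lam) (k : ℕ) :
    ∃ C > 0, ∀ (x₀ : EuclideanSpace ℝ (Fin N)) (t : ℝ),
      t ^ 4 * bumpMean (k + 5) (fun x => (Δ (Δ u)) x - lam * (Δ u) x) x₀ t ≤
        C * (1 + t ^ 2) * bumpMean (k + 1) u x₀ t := by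
  have hu2 : ContDiff ℝ 2 u := hu.of_le (by norm_num)
  have hΔ := contDiff_laplacian_two hu
  have hΔΔ : Continuous (Δ (Δ u)) := (contDiff_laplacian (n := 0) (by exact_mod_cast hΔ)).continuous
  set L : ℕ → ℝ := fun k => 2 * (k + 3) * (N + 4 * (k + 2)) with hL
  have hL0 (k : ℕ) : 0 < L k := by positivity
  -- Green's formula is applied to Δu, and then to u for each of the two resulting averages of Δu.
  -- Their sign is unknown, so absolute values are used.
  set C₁ : ℝ := 2 * (k + 5) * (2 * (k + 4) * L k + (N + 2 * (k + 4)) * L (k + 1)) with hC₁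
  have hC₁0 : 0 < C₁ := by
    have := hL0 k
    have := hL0 (k + 1)
    positivity
  refine ⟨C₁ + lam * L (k + 2), add_pos hC₁0 (mul_pos hlam (hL0 _)), fun x₀ t => ?_⟩
  set I := bumpMean (k + 1) u x₀ t with hI
  have hI0 : 0 ≤ I := bumpMean_nonneg hu0 _ _ _
  have hle (j : ℕ) : |t ^ 2 * bumpMean (k + j + 3) (Δ u) x₀ t| ≤ L (k + j) * I := by
    refine (abs_sq_mul_bumpMean_laplacian_le hu2 hu0 (k + j) x₀ t).trans ?_
    refine mul_le_mul_of_nonneg_left ?_ (hL0 _).le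
    exact bumpMean_anti hu.continuous hu0 (by omega) x₀ t
  have h1 := sq_mul_bumpMean_laplacian hΔ (k + 2) x₀ t
  have h2 : t ^ 4 * bumpMean (k + 5) (Δ (Δ u)) x₀ t ≤ C₁ * I := by
    have h3 := (abs_le.1 (hle 0)).2
    have h4 := (abs_le.1 (hle 1)).1
    simp only [add_zero] at h3
    have h5 : t ^ 4 * bumpMean (k + 5) (Δ (Δ u)) x₀ t =
        2 * (k + 5) * (2 * (k + 4) * (t ^ 2 * bumpMean (k + 0 + 3) (Δ u) x₀ t) +
          (N + 2 * (k + 4)) * -(t ^ 2 * bumpMean (k + 1 + 3) (Δ u) x₀ t)) := by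
      have : bumpMean (k + 5) (Δ (Δ u)) x₀ t = bumpMean (k + 2 + 3) (Δ (Δ u)) x₀ t := rfl
      rw [this, show t ^ 4 = t ^ 2 * t ^ 2 by ring, mul_assoc, h1]
      push_cast
      simp only [add_zero, show k + 2 + 1 = k + 3 from rfl, show k + 2 + 2 = k + 4 from rfl]
      ring
    have h6 : -(t ^ 2 * bumpMean (k + 1 + 3) (Δ u) x₀ t) ≤ L (k + 1) * I := by linarith
    rw [h5, hC₁]
    have : 2 * ((k : ℝ) + 5) * (2 * (k + 4) * L k + (N + 2 * (k + 4)) * L (k + 1)) * I =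
      2 * (k + 5) * (2 * (k + 4) * (L k * I) + (N + 2 * (k + 4)) * (L (k + 1) * I)) := by ring
    rw [this]
    gcongr
  have h3 := (abs_le.1 (hle 2)).1
  have h4 : bumpMean (k + 5) (fun x => (Δ (Δ u)) x - lam * (Δ u) x) x₀ t =
      bumpMean (k + 5) (Δ (Δ u)) x₀ t - lam * bumpMean (k + 5) (Δ u) x₀ t := by
    have hc : Continuous fun x => lam * (Δ u) x := continuous_const.mul hΔ.continuous
    have h5 := bumpMean_mul_sub hc hΔΔ 1 (k + 4) x₀ t
    have h6 : bumpMean (k + 5) (fun x => lam * (Δ u) x) x₀ t =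
        lam * bumpMean (k + 5) (Δ u) x₀ t := by
      unfold bumpMean; rw [← integral_const_mul]; congr 1; ext x; ring
    have h7 : bumpMean (k + 5) (fun x => (Δ (Δ u)) x - lam * (Δ u) x) x₀ t =
        -bumpMean (k + 5) (fun x => 1 * (lam * (Δ u) x) - (Δ (Δ u)) x) x₀ t := by
      unfold bumpMean; rw [← integral_neg]; congr 1; ext x; ring
    rw [h7]
    change -(bumpMean (k + 4 + 1) _ x₀ t) = _
    rw [h5]
    change -(1 * bumpMean (k + 5) (fun x => lam * (Δ u) x) x₀ t - _) = _
    rw [h6]; ring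
  rw [h4]
  have h5 : -(L (k + 2) * I) ≤ t ^ 2 * bumpMean (k + 5) (Δ u) x₀ t := h3
  have h6 : lam * t ^ 2 * -(t ^ 2 * bumpMean (k + 5) (Δ u) x₀ t) ≤
      lam * t ^ 2 * (L (k + 2) * I) :=
    mul_le_mul_of_nonneg_left (by linarith) (by positivity)
  have h7 : 0 ≤ C₁ * t ^ 2 * I := by positivity
  have h8 : 0 ≤ lam * L (k + 2) * I := mul_nonneg (mul_pos hlam (hL0 _)).le hI0
  nlinarith

/-- Young's inequality in crude form: above the threshold a^(q−1) = 1/η the power term dominates,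
and below it the constant does. -/
lemma le_mul_rpow_add {q : ℝ} (hq : 1 < q) {η a : ℝ} (hη : 0 < η) (ha : 0 ≤ a) :
    a ≤ η * a ^ q + η⁻¹ ^ (1 / (q - 1)) := by
  have hq1 : 0 < q - 1 := by linarith
  rcases le_or_gt a (η⁻¹ ^ (1 / (q - 1))) with h | h
  · have : 0 ≤ η * a ^ q := by positivity
    linarith
  · have hpos : 0 < η⁻¹ ^ (1 / (q - 1)) := by positivity
    have ha0 : 0 < a := hpos.trans h
    have h1 : η⁻¹ ≤ a ^ (q - 1) := by
      have h2 := Real.rpow_le_rpow hpos.le h.le hq1.le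
      rwa [← Real.rpow_mul (by positivity), one_div_mul_cancel hq1.ne', Real.rpow_one] at h2
    have h3 : a ^ q = a ^ (q - 1) * a := by
      rw [← Real.rpow_add_one ha0.ne']; congr 1; ring
    have h4 : 1 ≤ η * a ^ (q - 1) := by
      calc (1 : ℝ) = η * η⁻¹ := by field_simp
        _ ≤ _ := by gcongr
    rw [h3]
    nlinarith

/-- Polynomial growth when `q > 1`. -/
lemma polyGrowth_of_one_lt_q {u : EuclideanSpace ℝ (Fin N) → ℝ} (hu : ContDiff ℝ 4 u)
    (hu0 : ∀ x, 0 ≤ u x) {lam q : ℝ} (hlam : 0 < lam) (hq : 1 < q)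
    (hE0 : ∀ x, 0 ≤ (Δ (Δ u)) x - lam * (Δ u) x) {c R₀ : ℝ} {M : ℕ} (hc : 0 < c)
    (hE : ∀ x : EuclideanSpace ℝ (Fin N), R₀ ≤ ‖x‖ →
      c * u x ^ q ≤ ‖x‖ ^ M * ((Δ (Δ u)) x - lam * (Δ u) x)) : PolyGrowth u := by
  have hEc := continuous_bilaplacian_sub hu lam
  set E := fun x => (Δ (Δ u)) x - lam * (Δ u) x with hEdef
  have hq1 : 0 < q - 1 := by linarith
  -- This choice gives (k+1)q ≥ k+5, so (u b^(k+1))^q ≤ u^q b^(k+5). The four powers of the weight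
  -- lost in two applications of Green's formula are thereby recovered.
  obtain ⟨k, hk⟩ := exists_nat_ge (4 / (q - 1))
  rw [div_le_iff₀ hq1] at hk
  obtain ⟨C, hC0, hC⟩ := exists_bumpMean_energy_le hu hu0 hlam k
  obtain ⟨S, hS⟩ := (isCompact_closedBall (0 : EuclideanSpace ℝ (Fin N)) R₀).exists_bound_of_continuousOn
    hu.continuous.continuousOn
  have hS' (x : EuclideanSpace ℝ (Fin N)) (hx : ‖x‖ ≤ R₀) : u x ≤ |S| :=
    (le_abs_self _).trans ((hS x (by simpa using hx)).trans (le_abs_self _))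
  obtain ⟨m, hm⟩ := exists_nat_ge ((M : ℝ) * (1 / (q - 1)))
  set ω := volume.real (ball (0 : EuclideanSpace ℝ (Fin N)) 1) with hω
  set D : ℝ := (c / (4 * C))⁻¹ ^ (1 / (q - 1)) with hD
  have hD0 : 0 < D := by positivity
  have main (R : ℝ) (hR : 1 ≤ R) :
      bumpMean (k + 1) u 0 R ≤ 2 * ω * (|S| + D) * R ^ m := by
    have hR0 : 0 < R := by linarith
    -- Chosen so that 4Cη u^q ≤ E on the part of the ball of radius R where |y| ≥ R₀. The factor 4C
    -- is twice the 2C of the energy bound below, so that half of it survives absorption.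
    set η : ℝ := c / (4 * C) / R ^ M with hη
    have hη0 : 0 < η := by positivity
    have hηD : η⁻¹ ^ (1 / (q - 1)) ≤ D * R ^ m := by
      have h1 : η⁻¹ = (c / (4 * C))⁻¹ * R ^ M := by rw [hη]; field_simp
      rw [h1, Real.mul_rpow (by positivity) (by positivity), ← Real.rpow_natCast R M,
        ← Real.rpow_mul hR0.le]
      refine mul_le_mul_of_nonneg_left ?_ hD0.le
      rw [← Real.rpow_natCast R m]
      exact Real.rpow_le_rpow_of_exponent_le hR hm
    have hRm : 1 ≤ R ^ m := one_le_pow₀ hR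
    set T : ℝ := (|S| + D) * R ^ m with hT
    have hT0 : 0 ≤ T := by positivity
    have hpt (x : EuclideanSpace ℝ (Fin N)) : 4 * C * (u (0 + R • x) * bump (k + 1) x) ≤
        E (0 + R • x) * bump (k + 5) x + (ball (0 : EuclideanSpace ℝ (Fin N)) 1).indicator
          (fun _ => 4 * C * T) x := by
      rcases le_or_gt 1 ‖x‖ with hx | hx
      · rw [bump_eq_zero hx, show k + 5 = k + 4 + 1 from rfl, bump_eq_zero hx,
          Set.indicator_of_notMem (by simpa using hx)]
        simp
      · rw [Set.indicator_of_mem (by simpa using hx)]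
        set y := (0 : EuclideanSpace ℝ (Fin N)) + R • x with hy
        have hyR : ‖y‖ ≤ R := by
          rw [hy, zero_add, norm_smul, Real.norm_of_nonneg hR0.le]
          nlinarith
        have hEy : 0 ≤ E y * bump (k + 5) x := mul_nonneg (hE0 y) (bump_nonneg _ _)
        rcases le_total ‖y‖ R₀ with h | h
        · have h1 : u y * bump (k + 1) x ≤ T := by
            calc u y * bump (k + 1) x ≤ u y * 1 :=
                  mul_le_mul_of_nonneg_left (bump_le_one _ _) (hu0 y)
              _ ≤ |S| * R ^ m := by
                  rw [mul_one]
                  exact (hS' y h).trans (le_mul_of_one_le_right (abs_nonneg _) hRm)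
              _ ≤ T := by rw [hT]; gcongr; linarith
          have h2 : 4 * C * (u y * bump (k + 1) x) ≤ 4 * C * T := by gcongr
          linarith
        · set b := bump 1 x with hb
          have hb0 : 0 ≤ b := bump_nonneg _ _
          have hb1 : b ≤ 1 := bump_le_one _ _
          have hbk (j : ℕ) : bump j x = b ^ j := by simp [hb, bump]
          have huy := hu0 y
          have h1 := le_mul_rpow_add hq hη0 (a := u y * b ^ (k + 1)) (by positivity)
          have h2 : (u y * b ^ (k + 1)) ^ q ≤ u y ^ q * b ^ (k + 5) := by
            rw [Real.mul_rpow huy (by positivity), ← Real.rpow_natCast b (k + 1),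
              ← Real.rpow_mul hb0, ← Real.rpow_natCast b (k + 5)]
            refine mul_le_mul_of_nonneg_left ?_ (by positivity)
            refine Real.rpow_le_rpow_of_exponent_ge_of_imp hb0 hb1 ?_ ?_
            · push_cast; nlinarith
            · intro _ h; exfalso; revert h; push_cast; positivity
          have h3 : 4 * C * (η * (u y ^ q * b ^ (k + 5))) ≤ E y * b ^ (k + 5) := by
            have h4 : 4 * C * (η * (u y ^ q * b ^ (k + 5))) =
                (c * u y ^ q) / R ^ M * b ^ (k + 5) := by
              rw [hη]; field_simp
            rw [h4]
            refine mul_le_mul_of_nonneg_right ?_ (by positivity)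
            rw [div_le_iff₀ (by positivity), mul_comm (E y)]
            refine (hE y h).trans (mul_le_mul_of_nonneg_right ?_ (hE0 y))
            gcongr
          rw [hbk, hbk]
          have h5 : η⁻¹ ^ (1 / (q - 1)) ≤ T := hηD.trans (by
            rw [hT]; gcongr; linarith [abs_nonneg S])
          have h6 : 4 * C * (u y * b ^ (k + 1)) ≤
              4 * C * (η * (u y ^ q * b ^ (k + 5)) + T) := by
            gcongr
            refine h1.trans ?_
            gcongr
          linarith
    have ha : Continuous fun x : EuclideanSpace ℝ (Fin N) => 0 + R • x := by fun_prop
    have hi1 := integrable_mul_bump (hu.continuous.comp ha) k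
    have hi2 := integrable_mul_bump (hEc.comp ha) (k + 4)
    have hi3 : Integrable ((ball (0 : EuclideanSpace ℝ (Fin N)) 1).indicator
        (fun _ => 4 * C * T)) :=
      (integrable_indicator_iff measurableSet_ball).2
        (integrableOn_const measure_ball_lt_top.ne)
    have h1 := integral_mono (hi1.const_mul (4 * C)) (hi2.add hi3) hpt
    rw [integral_add' hi2 hi3, integral_const_mul, integral_indicator measurableSet_ball,
      setIntegral_const, smul_eq_mul] at h1
    change 4 * C * bumpMean (k + 1) u 0 R ≤ bumpMean (k + 5) E 0 R + ω * (4 * C * T) at h1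
    have h2 := hC 0 R
    have hI0 : 0 ≤ bumpMean (k + 1) u 0 R := bumpMean_nonneg hu0 _ _ _
    have h3 : bumpMean (k + 5) E 0 R ≤ 2 * C * bumpMean (k + 1) u 0 R := by
      have h4 : C * (1 + R ^ 2) * bumpMean (k + 1) u 0 R ≤
          R ^ 4 * (2 * C * bumpMean (k + 1) u 0 R) := by
        have : 1 + R ^ 2 ≤ R ^ 4 * 2 := by nlinarith [one_le_pow₀ hR (n := 2)]
        calc C * (1 + R ^ 2) * bumpMean (k + 1) u 0 R
            = (1 + R ^ 2) * (C * bumpMean (k + 1) u 0 R) := by ring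
          _ ≤ (R ^ 4 * 2) * (C * bumpMean (k + 1) u 0 R) := by gcongr
          _ = _ := by ring
      exact le_of_mul_le_mul_left (h2.trans h4) (by positivity)
    have h4 : 2 * C * bumpMean (k + 1) u 0 R ≤ 2 * C * (2 * ω * T) := by linarith
    have h5 := le_of_mul_le_mul_left h4 (by positivity)
    rw [hT] at h5
    linarith
  -- The exponent k+1 is traded for 1 by doubling the radius: on the half ball the weight is at
  -- least (3/4)^(k+1).
  refine ⟨(4 / 3) ^ (k + 1) * (2 ^ N * (2 * ω * (|S| + D) * 2 ^ m)), m, fun R hR => ?_⟩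
  have hR0 : 0 < R := by linarith
  have h1 := bumpMean_le_bumpMean hu.continuous hu0 0 k (x₀ := 0) (x₁ := 0) (s := R)
    (t := 2 * R) (θ := 1 / 2) hR0 (by positivity) (by norm_num) (by norm_num)
    (by simp)
  rw [mul_pow, mul_left_comm, mul_comm (2 ^ N) (R ^ N), mul_assoc (R ^ N)] at h1
  have h2 := le_of_mul_le_mul_left h1 (by positivity)
  have h3 := main (2 * R) (by linarith)
  have h4 : bumpMean 1 u 0 R = (4 / 3) ^ (k + 1) * ((1 - (1 / 2) ^ 2) ^ (k + 1) *
      bumpMean (0 + 1) u 0 R) := by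
    rw [← mul_assoc, ← mul_pow]; norm_num
  rw [h4]
  calc (4 / 3) ^ (k + 1) * ((1 - (1 / 2) ^ 2) ^ (k + 1) * bumpMean (0 + 1) u 0 R)
      ≤ (4 / 3) ^ (k + 1) * (2 ^ N * bumpMean (k + 1) u 0 (2 * R)) := by gcongr
    _ ≤ (4 / 3) ^ (k + 1) * (2 ^ N * (2 * ω * (|S| + D) * (2 * R) ^ m)) := by gcongr
    _ = _ := by rw [mul_pow]; ring

/-- In dimension at most two, point values are controlled by averages. -/
lemma exists_pow_mul_le_bumpMean (hN : N ≤ 2) {u : EuclideanSpace ℝ (Fin N) → ℝ}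
    (hu : ContDiff ℝ 4 u) (hu0 : ∀ x, 0 ≤ u x) {lam : ℝ} (hlam : 0 < lam)
    (hE0 : ∀ x, 0 ≤ (Δ (Δ u)) x - lam * (Δ u) x) :
    ∃ C > 0, ∀ (x₀ : EuclideanSpace ℝ (Fin N)) (s : ℝ), 0 < s → s ≤ 1 →
      s ^ 4 * u x₀ ≤ C * bumpMean 1 u x₀ s := by
  have hu2 : ContDiff ℝ 2 u := hu.of_le (by norm_num)
  have hΔ := contDiff_laplacian_two hu
  have hΔΔ : Continuous (Δ (Δ u)) := (contDiff_laplacian (n := 0) (by exact_mod_cast hΔ)).continuous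
  have hEc := continuous_bilaplacian_sub hu lam
  set E := fun x => (Δ (Δ u)) x - lam * (Δ u) x with hEdef
  obtain ⟨C, hC0, hC⟩ := exists_bumpMean_energy_le hu hu0 hlam 0
  set c := ∫ x : EuclideanSpace ℝ (Fin N), bump 2 x with hc
  have hc0 : 0 < c := integral_bump_pos N _
  set L : ℝ := 2 * 3 * (N + 4 * 2) with hL
  set K : ℝ := (1 + L / 12 + lam / 12) * (4 / 3 * 2 ^ N) + (4 / 3) ^ 5 * (C * 2) with hK
  refine ⟨K / c, by positivity, fun x₀ s hs hs1 => ?_⟩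
  set r := s / 2 with hr
  have hr0 : 0 < r := by positivity
  have hI (j : ℕ) (t : ℝ) : 0 ≤ bumpMean j u x₀ t := bumpMean_nonneg hu0 _ _ _
  set A : ℝ := (4 / 3) ^ 5 * (s ^ N * bumpMean 5 E x₀ s) with hA
  have hA0 : 0 ≤ A := by have := bumpMean_nonneg hE0 5 x₀ s; positivity
  -- The low dimension enters through t³ ≤ t^N for t ≤ 1, which makes the contribution of E
  -- uniformly bounded down to t = 0.
  have hmass (t : ℝ) (ht : 0 < t) (htr : t ≤ r) : t ^ 3 * bumpMean 4 E x₀ t ≤ A := by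
    have h1 := bumpMean_le_bumpMean hEc hE0 3 4 (x₀ := x₀) (x₁ := x₀) (s := t)
      (t := s) (θ := 1 / 2) ht hs (by norm_num) (by norm_num) (by simp; linarith)
    have h2 : t ^ N * bumpMean 4 E x₀ t ≤ A := by
      rw [hA]
      have h3 : (4 / 3 : ℝ) ^ 5 * ((1 - (1 / 2) ^ 2) ^ (4 + 1) * (t ^ N * bumpMean (3 + 1) E x₀ t)) =
        t ^ N * bumpMean 4 E x₀ t := by norm_num; ring
      rw [← h3]
      gcongr
    refine le_trans ?_ h2
    refine mul_le_mul_of_nonneg_right ?_ (bumpMean_nonneg hE0 4 x₀ t)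
    exact pow_le_pow_of_le_one ht.le (by linarith) (by omega)
  -- The corrections cancel the averages of Δu in the derivative, leaving −(t³/96) times an average
  -- of E plus terms that compensate it. So Z increases from a multiple of u(x₀).
  set Z : ℝ → ℝ := fun t => bumpMean 2 u x₀ t - t ^ 2 / 12 * bumpMean 3 (Δ u) x₀ t +
    lam / 12 * t ^ 2 * bumpMean 3 u x₀ t + A / 96 * t with hZ
  have hderiv (t : ℝ) : HasDerivAt Z
      (-(t ^ 3 / 96) * bumpMean 4 E x₀ t + lam / 6 * t * bumpMean 3 u x₀ t + A / 96) t := by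
    have d1 := hasDerivAt_bumpMean hu2 1 x₀ t
    have d2 := hasDerivAt_bumpMean hΔ 2 x₀ t
    have d3 := hasDerivAt_bumpMean hu2 2 x₀ t
    have d4 := ((hasDerivAt_pow 2 t).div_const 12).mul d2
    have d5 := ((hasDerivAt_pow 2 t).const_mul (lam / 12)).mul d3
    have d6 := (hasDerivAt_id t).const_mul (A / 96)
    have d7 := ((d1.sub d4).add d5).add d6
    have hEI : bumpMean 4 E x₀ t = bumpMean 4 (Δ (Δ u)) x₀ t - lam * bumpMean 4 (Δ u) x₀ t := by
      have ha : Continuous fun x : EuclideanSpace ℝ (Fin N) => x₀ + t • x := by fun_prop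
      have := integral_sub (integrable_mul_bump (hΔΔ.comp ha) 3)
        ((integrable_mul_bump (hΔ.continuous.comp ha) 3).const_mul lam)
      rw [integral_const_mul] at this
      unfold bumpMean
      refine Eq.trans ?_ this
      congr 1; ext x; simp only [hEdef, Function.comp]; ring
    refine d7.congr_deriv ?_
    rw [hEI]
    push_cast
    norm_num only [Pi.mul_apply]
    simp only [pow_one]
    ring
  have hmono : MonotoneOn Z (Set.Icc 0 r) := by
    refine monotoneOn_of_deriv_nonneg (convex_Icc 0 r)
      (fun t _ => (hderiv t).continuousAt.continuousWithinAt)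
      (fun t _ => (hderiv t).differentiableAt.differentiableWithinAt) fun t ht => ?_
    rw [interior_Icc] at ht
    rw [(hderiv t).deriv]
    have h1 := hmass t ht.1 ht.2.le
    have h2 : 0 ≤ lam / 6 * t * bumpMean 3 u x₀ t := by
      have := hI 3 t
      have := ht.1
      positivity
    linarith
  have h0r := hmono (Set.left_mem_Icc.2 hr0.le) (Set.right_mem_Icc.2 hr0.le) hr0.le
  have hZ0 : Z 0 = u x₀ * c := by simp [hZ, bumpMean_zero_right, hc]
  rw [hZ0] at h0r
  have hIr : bumpMean 1 u x₀ r ≤ 4 / 3 * 2 ^ N * bumpMean 1 u x₀ s := by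
    have h1 := bumpMean_le_bumpMean hu.continuous hu0 0 0 (x₀ := x₀) (x₁ := x₀) (s := r)
      (t := s) (θ := 1 / 2) hr0 hs (by norm_num) (by norm_num) (by simp; linarith)
    rw [show s = 2 * r by rw [hr]; ring, mul_pow, mul_left_comm, mul_comm (2 ^ N) (r ^ N),
      mul_assoc (r ^ N)] at h1
    have h2 := le_of_mul_le_mul_left h1 (by positivity)
    rw [show s = 2 * r by rw [hr]; ring]
    simp only [zero_add] at h2
    linarith
  have hZr : Z r ≤ (1 + L / 12 + lam / 12) * bumpMean 1 u x₀ r + A := by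
    have h1 := (abs_le.1 (abs_sq_mul_bumpMean_laplacian_le hu2 hu0 0 x₀ r)).1
    simp only [Nat.cast_zero, zero_add] at h1
    have h2 : bumpMean 2 u x₀ r ≤ bumpMean 1 u x₀ r :=
      bumpMean_anti hu.continuous hu0 (Nat.zero_le 1) x₀ r
    have h3 : bumpMean 3 u x₀ r ≤ bumpMean 1 u x₀ r :=
      bumpMean_anti hu.continuous hu0 (Nat.zero_le 2) x₀ r
    have h4 : lam / 12 * r ^ 2 * bumpMean 3 u x₀ r ≤ lam / 12 * 1 * bumpMean 1 u x₀ r := by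
      have := hI 3 r
      gcongr
      exact pow_le_one₀ hr0.le (by linarith)
    have h5 : A / 96 * r ≤ A := by nlinarith
    have h6 : -(r ^ 2 / 12 * bumpMean 3 (Δ u) x₀ r) ≤ L / 12 * bumpMean 1 u x₀ r := by
      rw [hL]; linarith
    simp only [hZ]
    linarith
  have hAs : s ^ 4 * A ≤ (4 / 3) ^ 5 * (C * 2) * bumpMean 1 u x₀ s := by
    have h1 := hC x₀ s
    simp only [zero_add] at h1
    have h2 : s ^ N ≤ 1 := pow_le_one₀ hs.le hs1
    have h3 : 0 ≤ s ^ 4 * bumpMean 5 E x₀ s := by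
      have := bumpMean_nonneg hE0 5 x₀ s; positivity
    have hI1 := hI 1 s
    calc s ^ 4 * A = (4 / 3) ^ 5 * (s ^ N * (s ^ 4 * bumpMean 5 E x₀ s)) := by rw [hA]; ring
      _ ≤ (4 / 3) ^ 5 * (1 * (C * (1 + s ^ 2) * bumpMean 1 u x₀ s)) := by gcongr
      _ ≤ (4 / 3) ^ 5 * (1 * (C * (1 + 1) * bumpMean 1 u x₀ s)) := by
          gcongr
          exact pow_le_one₀ hs.le hs1
      _ = _ := by ring
  have hs4 : s ^ 4 ≤ 1 := pow_le_one₀ hs.le hs1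
  have hL0 : 0 < L := by positivity
  have hfin : s ^ 4 * (u x₀ * c) ≤ K * bumpMean 1 u x₀ s := by
    have hI1r := hI 1 r
    calc s ^ 4 * (u x₀ * c) ≤ s ^ 4 * ((1 + L / 12 + lam / 12) * bumpMean 1 u x₀ r + A) := by
          gcongr
          exact h0r.trans hZr
      _ = s ^ 4 * ((1 + L / 12 + lam / 12) * bumpMean 1 u x₀ r) + s ^ 4 * A := by ring
      _ ≤ 1 * ((1 + L / 12 + lam / 12) * (4 / 3 * 2 ^ N * bumpMean 1 u x₀ s)) +
          (4 / 3) ^ 5 * (C * 2) * bumpMean 1 u x₀ s := by gcongr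
      _ = _ := by rw [hK]; ring
  rw [div_mul_eq_mul_div, le_div_iff₀ hc0]
  linarith

/-- Polynomial growth in dimension at most two. -/
lemma polyGrowth_of_dim_le_two (hN : N ≤ 2) {α β p : ℝ} (hp : 0 < p) (hp1 : p ≤ 1)
    {u : EuclideanSpace ℝ (Fin N) → ℝ} (hu : ContDiff ℝ 4 u) (hu0 : ∀ x, 0 ≤ u x) {lam : ℝ}
    (hlam : 0 < lam) (hE0 : ∀ x, 0 ≤ (Δ (Δ u)) x - lam * (Δ u) x)
    (hfin : kernelConv α β p u 0 < ∞) : PolyGrowth u := by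
  obtain ⟨C, hC0, hC⟩ := exists_pow_mul_le_bumpMean hN hu hu0 hlam hE0
  obtain ⟨C', M, hC'0, hC'⟩ := exists_setIntegral_rpow_le hp hu.continuous hu0 hfin
  -- In mp ≥ 6, four powers of the radius come from the pointwise bound and two from the volume. The
  -- integer n ≥ 1/p below removes the power p while keeping the bound polynomial.
  obtain ⟨m, hm⟩ := exists_nat_ge (6 / p)
  rw [div_le_iff₀ hp] at hm
  obtain ⟨n, hn⟩ := exists_nat_ge (1 / p)
  rw [div_le_iff₀ hp] at hn
  have hup : Continuous fun y => u y ^ p := hu.continuous.rpow_const fun _ => Or.inr hp.le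
  have hint {f : EuclideanSpace ℝ (Fin N) → ℝ} (hf : Continuous f) (x) (r : ℝ) :
      IntegrableOn f (ball (x : EuclideanSpace ℝ (Fin N)) r) :=
    (hf.continuousOn.integrableOn_compact (isCompact_closedBall x r)).mono_set
      ball_subset_closedBall
  set B : ℝ := 1 + 64 * (C * 2 ^ m) * C' with hB
  have hB1 : 1 ≤ B := by have : 0 ≤ 64 * (C * 2 ^ m) * C' := by positivity
                         linarith
  have main (R : ℝ) (hR : 1 ≤ R) (x : EuclideanSpace ℝ (Fin N)) (hx : ‖x‖ ≤ R / 2) :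
      u x ≤ 2 ^ m * (B * R ^ M) ^ n := by
    have hR0 : 0 < R := by linarith
    set J := ∫ y in ball (0 : EuclideanSpace ℝ (Fin N)) R, u y ^ p with hJ
    have hJ0 : 0 ≤ J := setIntegral_nonneg measurableSet_ball fun y _ => Real.rpow_nonneg (hu0 y) p
    -- The weight d^m vanishes on the boundary. Near a maximum point x₀ of u d^m, on the ball of
    -- radius d(x₀)/2, the weight loses at most a factor 2^m, so u is bounded there by 2^m u(x₀).
    set d : EuclideanSpace ℝ (Fin N) → ℝ := fun y => (R - ‖y‖) / R with hd
    have hφ : Continuous fun y => u y * d y ^ m := by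
      have := hu.continuous
      simp only [hd]
      fun_prop
    obtain ⟨x₀, hx₀, hmax⟩ := (isCompact_closedBall (0 : EuclideanSpace ℝ (Fin N)) R).exists_isMaxOn
      ⟨0, by simp [hR0.le]⟩ hφ.continuousOn
    have hmax' (y : EuclideanSpace ℝ (Fin N)) (hy : ‖y‖ ≤ R) :
        u y * d y ^ m ≤ u x₀ * d x₀ ^ m := hmax (by simpa using hy)
    have hx₀R : ‖x₀‖ ≤ R := by simpa using hx₀
    set d₀ := d x₀ with hd₀
    have hd₀0 : 0 ≤ d₀ := div_nonneg (by linarith) hR0.le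
    have hd₀1 : d₀ ≤ 1 := (div_le_one hR0).2 (by linarith [norm_nonneg x₀])
    have hRd : R * d₀ = R - ‖x₀‖ := by rw [hd₀, hd]; field_simp
    have hux₀ := hu0 x₀
    have hkey : d₀ ^ 6 * u x₀ ^ p ≤ 64 * (C * 2 ^ m) * J := by
      rcases hd₀0.eq_or_lt with h | h
      · rw [← h]; simp; positivity
      rcases hux₀.eq_or_lt with h' | h'
      · rw [← h', Real.zero_rpow hp.ne']; simp; positivity
      set s := d₀ / 2 with hs
      have hs0 : 0 < s := by positivity
      have hs1 : s ≤ 1 := by linarith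
      have hball (y) (hy : y ∈ ball x₀ s) : ‖y‖ ≤ R ∧ d₀ / 2 ≤ d y := by
        have h1 : ‖y - x₀‖ < s := by rw [← dist_eq_norm]; exact hy
        have h2 : ‖y‖ ≤ ‖x₀‖ + s := by
          have := norm_le_norm_add_norm_sub x₀ y
          rw [norm_sub_rev] at this; linarith
        have h3 : s ≤ R * s := le_mul_of_one_le_left hs0.le hR
        have h4 : R * s = R * d₀ / 2 := by rw [hs]; ring
        refine ⟨by nlinarith, ?_⟩
        rw [hd, le_div_iff₀ hR0]
        nlinarith
      have hsub : ball x₀ s ⊆ ball 0 R := fun y hy => by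
        have h1 : ‖y - x₀‖ < s := by rw [← dist_eq_norm]; exact hy
        have h2 : ‖y‖ ≤ ‖x₀‖ + ‖y - x₀‖ := by
          have := norm_le_norm_add_norm_sub x₀ y
          rwa [norm_sub_rev] at this
        have h3 : s ≤ R * s := le_mul_of_one_le_left hs0.le hR
        have h4 : R * s = R * d₀ / 2 := by rw [hs]; ring
        have h5 : 0 ≤ R * d₀ := by positivity
        simp only [mem_ball_zero_iff]
        nlinarith
      set U := 2 ^ m * u x₀ with hU
      have hU0 : 0 < U := by positivity
      -- Splitting u = u^p u^(1−p) and bounding the second factor by the local maximum turns the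
      -- p-th moment into a bound for ∫ u. The factor u(x₀)^(1−p) cancels afterwards.
      have hbd (y) (hy : y ∈ ball x₀ s) : u y ≤ u y ^ p * U ^ (1 - p) := by
        obtain ⟨h1, h2⟩ := hball y hy
        have h3 : u y ≤ U := by
          have h4 := hmax' y h1
          have h5 : u y * (d₀ / 2) ^ m ≤ u x₀ * d₀ ^ m :=
            (mul_le_mul_of_nonneg_left (pow_le_pow_left₀ (by positivity) h2 m) (hu0 y)).trans h4
          rw [div_pow, mul_div_assoc', div_le_iff₀ (by positivity)] at h5
          have h6 : d₀ ^ m * u y ≤ d₀ ^ m * U := by rw [hU]; linarith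
          exact le_of_mul_le_mul_left h6 (by positivity)
        rcases (hu0 y).eq_or_lt with h | h
        · rw [← h, Real.zero_rpow hp.ne']; simp
        calc u y = u y ^ p * u y ^ (1 - p) := by rw [← Real.rpow_add h]; simp
          _ ≤ u y ^ p * U ^ (1 - p) := by
              gcongr
      have h1 : ∫ y in ball x₀ s, u y ≤ U ^ (1 - p) * J := by
        calc ∫ y in ball x₀ s, u y ≤ ∫ y in ball x₀ s, u y ^ p * U ^ (1 - p) :=
              setIntegral_mono_on (hint hu.continuous _ _)
                (hint (hup.mul continuous_const) _ _) measurableSet_ball hbd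
          _ = U ^ (1 - p) * ∫ y in ball x₀ s, u y ^ p := by
              rw [integral_mul_const, mul_comm]
          _ ≤ U ^ (1 - p) * J := by
              gcongr
              exact setIntegral_mono_set (hint hup _ _)
                (Filter.Eventually.of_forall fun y => Real.rpow_nonneg (hu0 y) p)
                hsub.eventuallyLE
      have h2 := bumpMean_le_setIntegral_ball hu.continuous hu0 0 (x₀ := x₀) hs0
      have h3 := hC x₀ s hs0 hs1
      have h4 : s ^ 6 * u x₀ ≤ C * (U ^ (1 - p) * J) := by
        have h5 : s ^ 2 * bumpMean 1 u x₀ s ≤ U ^ (1 - p) * J := by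
          refine le_trans ?_ (h2.trans h1)
          refine mul_le_mul_of_nonneg_right ?_ (bumpMean_nonneg hu0 _ _ _)
          exact pow_le_pow_of_le_one hs0.le hs1 hN
        calc s ^ 6 * u x₀ = s ^ 2 * (s ^ 4 * u x₀) := by ring
          _ ≤ s ^ 2 * (C * bumpMean 1 u x₀ s) := by gcongr
          _ = C * (s ^ 2 * bumpMean 1 u x₀ s) := by ring
          _ ≤ _ := by gcongr
      have h5 : U ^ (1 - p) ≤ 2 ^ m * u x₀ ^ (1 - p) := by
        rw [hU, Real.mul_rpow (by positivity) hux₀]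
        refine mul_le_mul_of_nonneg_right ?_ (by positivity)
        calc ((2 : ℝ) ^ m) ^ (1 - p) ≤ ((2 : ℝ) ^ m) ^ (1 : ℝ) :=
              Real.rpow_le_rpow_of_exponent_le (one_le_pow₀ (by norm_num)) (by linarith)
          _ = 2 ^ m := Real.rpow_one _
      have h6 : u x₀ = u x₀ ^ p * u x₀ ^ (1 - p) := by rw [← Real.rpow_add h']; simp
      have h7 : u x₀ ^ (1 - p) * (s ^ 6 * u x₀ ^ p) ≤ u x₀ ^ (1 - p) * (C * 2 ^ m * J) := by
        calc u x₀ ^ (1 - p) * (s ^ 6 * u x₀ ^ p) = s ^ 6 * (u x₀ ^ p * u x₀ ^ (1 - p)) := by ring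
          _ = s ^ 6 * u x₀ := by rw [← h6]
          _ ≤ C * (U ^ (1 - p) * J) := h4
          _ ≤ C * ((2 ^ m * u x₀ ^ (1 - p)) * J) := by gcongr
          _ = _ := by ring
      have h8 := le_of_mul_le_mul_left h7 (by positivity)
      have h9 : d₀ ^ 6 = 64 * s ^ 6 := by rw [hs]; ring
      rw [h9]
      linarith
    have hφp : (u x₀ * d₀ ^ m) ^ p ≤ B * R ^ M := by
      rw [Real.mul_rpow hux₀ (by positivity), ← Real.rpow_natCast d₀ m, ← Real.rpow_mul hd₀0]
      have h1 : d₀ ^ ((m : ℝ) * p) ≤ d₀ ^ 6 := by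
        rw [← Real.rpow_natCast d₀ 6]
        refine Real.rpow_le_rpow_of_exponent_ge_of_imp hd₀0 hd₀1 (by exact_mod_cast hm) ?_
        intro _ h; exfalso; have : (0 : ℝ) < m * p := by linarith
        linarith
      have h2 : J ≤ C' * R ^ M := hC' R hR
      calc u x₀ ^ p * d₀ ^ ((m : ℝ) * p) ≤ u x₀ ^ p * d₀ ^ 6 := by gcongr
        _ = d₀ ^ 6 * u x₀ ^ p := by ring
        _ ≤ 64 * (C * 2 ^ m) * J := hkey
        _ ≤ 64 * (C * 2 ^ m) * (C' * R ^ M) := by gcongr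
        _ ≤ B * R ^ M := by
            have : 0 ≤ R ^ M := by positivity
            rw [hB]; linarith
    have hBR : 1 ≤ B * R ^ M := one_le_mul_of_one_le_of_one_le hB1 (one_le_pow₀ hR)
    have hφn : u x₀ * d₀ ^ m ≤ (B * R ^ M) ^ n := by
      set a := u x₀ * d₀ ^ m with ha
      have ha0 : 0 ≤ a := by positivity
      rcases le_total a 1 with h | h
      · exact h.trans (one_le_pow₀ hBR)
      · calc a = a ^ (1 : ℝ) := (Real.rpow_one a).symm
          _ ≤ a ^ (p * n) := Real.rpow_le_rpow_of_exponent_le h (by linarith)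
          _ = (a ^ p) ^ n := by rw [Real.rpow_mul ha0, Real.rpow_natCast]
          _ ≤ _ := pow_le_pow_left₀ (by positivity) hφp n
    have h1 := hmax' x (by linarith)
    have h2 : 1 / 2 ≤ d x := by rw [hd, le_div_iff₀ hR0]; linarith
    have h3 : u x * (1 / 2) ^ m ≤ (B * R ^ M) ^ n :=
      (mul_le_mul_of_nonneg_left (pow_le_pow_left₀ (by norm_num) h2 m) (hu0 x)).trans
        (h1.trans hφn)
    rw [one_div, inv_pow, ← div_eq_mul_inv, div_le_iff₀ (by positivity)] at h3
    linarith
  set ω := volume.real (ball (0 : EuclideanSpace ℝ (Fin N)) 1) with hω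
  refine polyGrowth_of_setIntegral hu.continuous hu0
    (C := ω * (2 ^ m * (B * 2 ^ M) ^ n)) (m := N + M * n) fun R hR => ?_
  have h1 : ∫ y in ball (0 : EuclideanSpace ℝ (Fin N)) R, u y ≤
      ∫ _ in ball (0 : EuclideanSpace ℝ (Fin N)) R, 2 ^ m * (B * (2 * R) ^ M) ^ n := by
    refine setIntegral_mono_on (hint hu.continuous _ _) (hint continuous_const _ _)
      measurableSet_ball fun y hy => main (2 * R) (by linarith) y ?_
    have : ‖y‖ < R := by simpa using hy
    linarith
  rw [setIntegral_const, smul_eq_mul, volume_real_ball_eq _ (by linarith)] at h1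
  refine h1.trans (le_of_eq ?_)
  rw [mul_pow 2 R M, ← mul_assoc B, mul_pow _ (R ^ M), ← pow_mul, pow_add]
  ring

end Growth

/-! ### Incompatible growth conditions on dyadic sequences. -/

section Sequences

open Filter

lemma eventually_le_exp_mul_rpow {θ : ℝ} (hθ : 0 < θ) (γ : ℝ) :
    ∀ᶠ n : ℕ in atTop, 1 ≤ ((2 : ℝ) ^ n) ^ θ * (n : ℝ) ^ γ := by
  obtain ⟨k, hk⟩ := exists_nat_ge (-γ)
  have hr : 1 < (2 : ℝ) ^ θ := Real.one_lt_rpow (by norm_num) hθ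
  have h := tendsto_pow_const_div_const_pow_of_one_lt k hr
  filter_upwards [h.eventually (gt_mem_nhds one_pos), eventually_ge_atTop 1] with n hn hn1
  have hn1' : (1 : ℝ) ≤ n := by exact_mod_cast hn1
  have hn0 : (0 : ℝ) < n := by linarith
  have h1 : ((2 : ℝ) ^ n) ^ θ = ((2 : ℝ) ^ θ) ^ n := by
    rw [← Real.rpow_natCast, ← Real.rpow_mul (by norm_num), mul_comm, Real.rpow_mul (by norm_num),
      Real.rpow_natCast]
  rw [div_lt_one (by positivity)] at hn
  have h2 : ((n : ℝ) ^ k)⁻¹ ≤ (n : ℝ) ^ γ := by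
    rw [← Real.rpow_natCast, ← Real.rpow_neg hn0.le]
    exact Real.rpow_le_rpow_of_exponent_le hn1' (by linarith)
  rw [h1]
  calc (1 : ℝ) = (n : ℝ) ^ k * ((n : ℝ) ^ k)⁻¹ := by field_simp
    _ ≤ _ := by gcongr

/-- There is no pair of sequences with `G_{n+1} - G_n ≥ c n^γ g_n^Q` and `G_{n+1} ≤ C g_n`
when `Q > 1` and `γ > 1/Q - 1`. -/
lemma false_of_increment_le {G g : ℕ → ℝ} {c γ Q : ℝ} {n₀ : ℕ} (hc : 0 < c) (hQ : 1 < Q)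
    (hγ : 1 / Q - 1 < γ) (hG : ∀ n, 0 ≤ G n)
    (h1 : ∀ n, n₀ ≤ n → G n + c * ((n : ℝ) ^ γ * g n ^ Q) ≤ G (n + 1))
    (h2 : ∀ n, n₀ ≤ n → c * G (n + 1) ≤ g n) (h3 : ∀ n, n₀ ≤ n → c ≤ g n) : False := by
  set μ := min ((1 : ℝ) ^ γ) ((2 : ℝ) ^ γ) with hμ
  have hμ0 : 0 < μ := lt_min (by positivity) (by positivity)
  -- Equal to γQ + Q − 1, which is positive exactly when γ > 1/Q − 1.
  set e := (γ + 1) * (Q - 1) + γ with he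
  have hQ0 : 0 < Q := by linarith
  have he0 : 0 < e := by
    have h : 1 - Q < γ * Q := by
      have h4 := mul_lt_mul_of_pos_right hγ hQ0
      have h5 : (1 / Q - 1) * Q = 1 - Q := by field_simp
      linarith
    rw [he]; nlinarith
  set κ : ℝ := c * (c * (μ * c ^ Q)) with hκ
  have hκ0 : 0 < κ := by positivity
  -- Using only g ≥ c, the m increments between m and 2m, each of order m^γ, force growth of order
  -- m^(γ+1).
  have hlow (m : ℕ) (hm : max n₀ 1 ≤ m) : κ * (m : ℝ) ^ (γ + 1) ≤ g (2 * m) := by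
    have hm1 : (1 : ℝ) ≤ m := by exact_mod_cast (le_max_right n₀ 1).trans hm
    have hmn : n₀ ≤ m := (le_max_left n₀ 1).trans hm
    have hstep : ∀ i : ℕ, i ≤ m → (i : ℝ) * (c * (μ * (m : ℝ) ^ γ * c ^ Q)) ≤ G (m + i) := by
      intro i
      induction i with
      | zero => intro _; simpa using hG m
      | succ i ih =>
        intro hi
        have h4 := ih (by omega)
        have h5 := h1 (m + i) (by omega)
        have h6 : μ * (m : ℝ) ^ γ ≤ ((m + i : ℕ) : ℝ) ^ γ := by
          refine min_rpow_mul_le_rpow γ one_pos two_pos (by linarith) ?_ ?_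
          · push_cast
            have : (0 : ℝ) ≤ i := Nat.cast_nonneg i
            linarith
          · have : (i : ℝ) ≤ m := by exact_mod_cast (by omega : i ≤ m)
            push_cast; linarith
        have h7 : c ^ Q ≤ g (m + i) ^ Q := Real.rpow_le_rpow hc.le (h3 _ (by omega)) hQ0.le
        have h8 : c * (μ * (m : ℝ) ^ γ * c ^ Q) ≤ c * (((m + i : ℕ) : ℝ) ^ γ * g (m + i) ^ Q) := by
          gcongr
        rw [← add_assoc]
        push_cast
        rw [add_mul, one_mul]
        linarith
    have h4 := hstep m le_rfl
    rw [← two_mul] at h4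
    have h5 := h1 (2 * m) (by omega)
    have hg0 : 0 ≤ g (2 * m) := hc.le.trans (h3 _ (by omega))
    have h6 : 0 ≤ c * (((2 * m : ℕ) : ℝ) ^ γ * g (2 * m) ^ Q) := by positivity
    have h7 := h2 (2 * m) (by omega)
    have h8 : (m : ℝ) ^ (γ + 1) = (m : ℝ) ^ γ * m := Real.rpow_add_one (by linarith) γ
    calc κ * (m : ℝ) ^ (γ + 1) = c * ((m : ℝ) * (c * (μ * (m : ℝ) ^ γ * c ^ Q))) := by
          rw [hκ, h8]; ring
      _ ≤ c * G (2 * m + 1) := by gcongr; linarith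
      _ ≤ _ := h7
  -- A single increment gives c² n^γ g_n^Q ≤ c G_(n+1) ≤ g_n, and one factor g_n cancels.
  have hup (n : ℕ) (hn : max n₀ 1 ≤ n) : c ^ 2 * ((n : ℝ) ^ γ * g n ^ (Q - 1)) ≤ 1 := by
    have hn' : n₀ ≤ n := (le_max_left n₀ 1).trans hn
    have h4 := h1 n hn'
    have h5 := h2 n hn'
    have h6 := hG n
    have hg0 : 0 < g n := hc.trans_le (h3 n hn')
    have h7 : g n ^ Q = g n ^ (Q - 1) * g n := by
      rw [← Real.rpow_add_one hg0.ne']; congr 1; ring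
    have h8 : c * (c * ((n : ℝ) ^ γ * g n ^ Q)) ≤ c * G (n + 1) := by gcongr; linarith
    rw [h7] at h8
    have h9 : g n * (c ^ 2 * ((n : ℝ) ^ γ * g n ^ (Q - 1))) ≤ g n * 1 := by
      calc _ = c * (c * ((n : ℝ) ^ γ * (g n ^ (Q - 1) * g n))) := by ring
        _ ≤ _ := by linarith
    exact le_of_mul_le_mul_left h9 hg0
  set D : ℝ := c ^ 2 * ((2 : ℝ) ^ γ * κ ^ (Q - 1)) with hD
  have hD0 : 0 < D := by positivity
  have htend : Tendsto (fun m : ℕ => (m : ℝ) ^ e) atTop atTop :=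
    (tendsto_rpow_atTop he0).comp tendsto_natCast_atTop_atTop
  obtain ⟨m, hm1, hm2⟩ := ((htend.eventually (eventually_gt_atTop (1 / D))).and
    (eventually_ge_atTop (max n₀ 1))).exists
  have hm1' : (1 : ℝ) ≤ m := by exact_mod_cast (le_max_right n₀ 1).trans hm2
  have hm0 : (0 : ℝ) < m := by linarith
  have h4 := hup (2 * m) (by omega)
  have h5 : κ ^ (Q - 1) * (m : ℝ) ^ ((γ + 1) * (Q - 1)) ≤ g (2 * m) ^ (Q - 1) := by
    rw [Real.rpow_mul hm0.le, ← Real.mul_rpow (by positivity) (by positivity)]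
    exact Real.rpow_le_rpow (by positivity) (hlow m hm2) (by linarith)
  have h6 : ((2 * m : ℕ) : ℝ) ^ γ = (2 : ℝ) ^ γ * (m : ℝ) ^ γ := by
    push_cast; exact Real.mul_rpow (by norm_num) hm0.le
  have h7 : D * (m : ℝ) ^ e ≤ 1 := by
    calc D * (m : ℝ) ^ e = c ^ 2 * ((2 : ℝ) ^ γ * (m : ℝ) ^ γ *
          (κ ^ (Q - 1) * (m : ℝ) ^ ((γ + 1) * (Q - 1)))) := by
          rw [hD, he, Real.rpow_add hm0]; ring
      _ ≤ c ^ 2 * ((2 : ℝ) ^ γ * (m : ℝ) ^ γ * g (2 * m) ^ (Q - 1)) := by gcongr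
      _ ≤ 1 := by rw [← h6]; exact h4
  rw [div_lt_iff₀ hD0] at hm1
  linarith

/-- A version of `false_of_increment_le` with an additional exponential factor. -/
lemma false_of_exp_increment_le {G g : ℕ → ℝ} {c θ γ Q : ℝ} {n₀ : ℕ} (hc : 0 < c) (hQ : 1 < Q)
    (hθ : 0 < θ ∨ θ = 0 ∧ 1 / Q - 1 < γ) (hG : ∀ n, 0 ≤ G n)
    (h1 : ∀ n, n₀ ≤ n → G n + c * (((2 : ℝ) ^ n) ^ θ * (n : ℝ) ^ γ * g n ^ Q) ≤ G (n + 1))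
    (h2 : ∀ n, n₀ ≤ n → c * G (n + 1) ≤ g n) (h3 : ∀ n, n₀ ≤ n → c ≤ g n) : False := by
  rcases hθ with hθ | ⟨rfl, hγ⟩
  -- The exponential absorbs n^γ, so γ may be replaced by 0, which exceeds 1/Q − 1.
  · obtain ⟨n₁, hn₁⟩ := eventually_atTop.1 (eventually_le_exp_mul_rpow hθ γ)
    have hγ : 1 / Q - 1 < 0 := by
      rw [sub_neg, div_lt_one (by linarith)]; exact hQ
    refine false_of_increment_le (n₀ := max n₀ n₁) hc hQ hγ hG (fun n hn => ?_)
      (fun n hn => h2 n (le_of_max_le_left hn)) (fun n hn => h3 n (le_of_max_le_left hn))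
    have h4 := h1 n (le_of_max_le_left hn)
    have h5 := hn₁ n (le_of_max_le_right hn)
    have hg : 0 ≤ g n ^ Q := Real.rpow_nonneg (hc.le.trans (h3 n (le_of_max_le_left hn))) _
    refine le_trans ?_ h4
    rw [Real.rpow_zero]
    gcongr
  · refine false_of_increment_le hc hQ hγ hG (fun n hn => ?_) h2 h3
    simpa using h1 n hn

end Sequences

/-! ### The profile of a nontrivial solution and the feedback through the inequality. -/

section Solutions

open Laplacian Metric

variable {N : ℕ}

lemma measurable_logKernel (α β : ℝ) :
    Measurable (logKernel α β : EuclideanSpace ℝ (Fin N) → ℝ) := by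
  unfold logKernel; fun_prop

lemma exists_ball_half_le {u : EuclideanSpace ℝ (Fin N) → ℝ} (hu : Continuous u)
    {x₁ : EuclideanSpace ℝ (Fin N)} (hx₁ : 0 < u x₁) :
    ∃ ρ > 0, ∀ y ∈ ball x₁ ρ, u x₁ / 2 ≤ u y := by
  obtain ⟨ρ, hρ, h⟩ := Metric.mem_nhds_iff.1 (hu.continuousAt.eventually
    (lt_mem_nhds (half_lt_self hx₁)))
  exact ⟨ρ, hρ, fun y hy => (h hy).le⟩

/-- Polynomial lower bound for the convolution at infinity. -/
lemma exists_le_pow_mul_kernelConv (α β : ℝ) {p : ℝ} (hp : 0 < p)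
    {u : EuclideanSpace ℝ (Fin N) → ℝ} (hu : Continuous u) {x₁ : EuclideanSpace ℝ (Fin N)}
    (hx₁ : 0 < u x₁) (hfin : ∀ x, kernelConv α β p u x < ∞) :
    ∃ c > 0, ∃ (R₀ : ℝ) (M : ℕ), ∀ x : EuclideanSpace ℝ (Fin N), R₀ ≤ ‖x‖ →
      c ≤ ‖x‖ ^ M * (kernelConv α β p u x).toReal := by
  obtain ⟨ρ, hρ, hball⟩ := exists_ball_half_le hu hx₁
  obtain ⟨κ, hκ, M, hM⟩ := exists_le_logKernel_mul_pow N α β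
  set v := volume.real (ball x₁ ρ) with hv
  have hv0 : 0 < v := ENNReal.toReal_pos (measure_ball_pos _ _ hρ).ne' measure_ball_lt_top.ne
  have hδ : 0 < u x₁ / 2 := by positivity
  -- Beyond this radius 1 ≤ |x − y| ≤ 2|x| for all y in the small ball about x₁ where u ≥ u(x₁)/2.
  refine ⟨κ * (u x₁ / 2) ^ p * v / 2 ^ M, by positivity, ‖x₁‖ + ρ + 1, M, fun x hx => ?_⟩
  have hx0 : 0 < ‖x‖ := by linarith [norm_nonneg x₁]
  have h := mul_le_toReal_kernelConv (hfin x) (S := ball x₁ ρ) measurableSet_ball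
    (a := κ * (u x₁ / 2) ^ p / (2 * ‖x‖) ^ M) (v := v) (by positivity) hv0.le
    (by rw [hv, Measure.real, ENNReal.ofReal_toReal measure_ball_lt_top.ne]) (fun y hy => by
      have hyρ : ‖y - x₁‖ < ρ := by rw [← dist_eq_norm]; exact hy
      have h1 : ‖y‖ ≤ ‖x₁‖ + ‖y - x₁‖ := by
        have := norm_le_norm_add_norm_sub x₁ y
        rwa [norm_sub_rev] at this
      have h2 : ‖x‖ - ‖y‖ ≤ ‖x - y‖ := norm_sub_norm_le x y
      have h3 : ‖x - y‖ ≤ ‖x‖ + ‖y‖ := norm_sub_le x y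
      have h4 := hM (x - y) (by linarith)
      have h5 : κ ≤ logKernel α β (x - y) * (2 * ‖x‖) ^ M := by
        refine h4.trans ?_
        have := logKernel_nonneg α β (x - y)
        gcongr
        linarith
      have h6 : (u x₁ / 2) ^ p ≤ u y ^ p := Real.rpow_le_rpow hδ.le (hball y hy) hp.le
      rw [div_le_iff₀ (by positivity)]
      have h7 : 0 ≤ logKernel α β (x - y) * (2 * ‖x‖) ^ M := hκ.le.trans h5
      calc κ * (u x₁ / 2) ^ p ≤ logKernel α β (x - y) * (2 * ‖x‖) ^ M * u y ^ p := by gcongr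
        _ = _ := by ring)
  rw [div_mul_eq_mul_div, div_le_iff₀ (by positivity), mul_pow] at h
  rw [div_le_iff₀ (by positivity)]
  linarith

/-- The kernel is positive off the origin and u is positive near x₁. The single point y = x₁ is
removed; it is null because N ≥ 1. -/
lemma toReal_kernelConv_pos (hN : 1 ≤ N) (α β p : ℝ)
    {u : EuclideanSpace ℝ (Fin N) → ℝ} (hu : Continuous u) {x₁ : EuclideanSpace ℝ (Fin N)}
    (hx₁ : 0 < u x₁) (hfin : kernelConv α β p u x₁ < ∞) :
    0 < (kernelConv α β p u x₁).toReal := by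
  refine ENNReal.toReal_pos (fun h0 => ?_) hfin.ne
  obtain ⟨ρ, hρ, hball⟩ := exists_ball_half_le hu hx₁
  have hm : Measurable fun y => ENNReal.ofReal (logKernel α β (x₁ - y) * u y ^ p) :=
    (((measurable_logKernel α β).comp (measurable_const.sub measurable_id)).mul
      (hu.measurable.pow_const p)).ennreal_ofReal
  rw [kernelConv, lintegral_eq_zero_iff hm] at h0
  have hsub : ball x₁ ρ \ {x₁} ⊆
      {y | ¬ENNReal.ofReal (logKernel α β (x₁ - y) * u y ^ p) = (0 : EuclideanSpace ℝ (Fin N) → ℝ≥0∞) y} := by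
    rintro y ⟨hy, hyx⟩
    have hz : 0 < ‖x₁ - y‖ := norm_pos_iff.2 (sub_ne_zero.2 (Ne.symm hyx))
    have h1 : 0 < logKernel α β (x₁ - y) :=
      mul_pos (Real.rpow_pos_of_pos hz _)
        (Real.rpow_pos_of_pos (Real.log_pos (by linarith)) _)
    have h2 : 0 < u y := lt_of_lt_of_le (by positivity) (hball y hy)
    have h3 : 0 < logKernel α β (x₁ - y) * u y ^ p := by positivity
    simpa using h3
  have hz := measure_mono_null hsub (ae_iff.1 h0)
  have : Nonempty (Fin N) := ⟨⟨0, hN⟩⟩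
  have : Nontrivial (EuclideanSpace ℝ (Fin N)) := inferInstance
  rw [measure_sdiff_null (measure_singleton _)] at hz
  exact (measure_ball_pos volume x₁ hρ).ne' hz

lemma IsNonnegSolution.energy_ge {lam p q α β : ℝ} {u : EuclideanSpace ℝ (Fin N) → ℝ}
    (h : IsNonnegSolution lam p q α β u) (x : EuclideanSpace ℝ (Fin N)) :
    (kernelConv α β p u x).toReal * u x ^ q ≤ (Δ (Δ u)) x - lam * (Δ u) x := h.inequality x

lemma IsNonnegSolution.energy_nonneg {lam p q α β : ℝ} {u : EuclideanSpace ℝ (Fin N) → ℝ}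
    (h : IsNonnegSolution lam p q α β u) (x : EuclideanSpace ℝ (Fin N)) :
    0 ≤ (Δ (Δ u)) x - lam * (Δ u) x :=
  (mul_nonneg ENNReal.toReal_nonneg (Real.rpow_nonneg (h.nonneg x) _)).trans (h.energy_ge x)

lemma IsNonnegSolution.polyGrowth {lam p q α β : ℝ} {u : EuclideanSpace ℝ (Fin N) → ℝ}
    (h : IsNonnegSolution lam p q α β u) (hlam : 0 < lam) (hp : 0 < p)
    (hpq : N ≤ 2 ∨ 1 ≤ p ∨ 1 < q) {x₁ : EuclideanSpace ℝ (Fin N)} (hx₁ : 0 < u x₁) :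
    PolyGrowth u := by
  have huc := h.contDiff.continuous
  rcases le_total 1 p with hp1 | hp1
  · exact polyGrowth_of_one_le_p hp1 huc h.nonneg (h.conv_lt_top 0)
  by_cases hN : N ≤ 2
  · exact polyGrowth_of_dim_le_two hN hp hp1 h.contDiff h.nonneg hlam h.energy_nonneg
      (h.conv_lt_top 0)
  by_cases hq : 1 < q
  · obtain ⟨c, hc, R₀, M, hM⟩ := exists_le_pow_mul_kernelConv α β hp huc hx₁ h.conv_lt_top
    refine polyGrowth_of_one_lt_q h.contDiff h.nonneg hlam hq h.energy_nonneg (R₀ := R₀) (M := M)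
      hc fun x hx => ?_
    have h1 : 0 ≤ u x ^ q := Real.rpow_nonneg (h.nonneg x) _
    calc c * u x ^ q ≤ ‖x‖ ^ M * (kernelConv α β p u x).toReal * u x ^ q := by
          gcongr
          exact hM x hx
      _ = ‖x‖ ^ M * ((kernelConv α β p u x).toReal * u x ^ q) := by ring
      _ ≤ _ := by gcongr; exact h.energy_ge x
  · exact polyGrowth_of_one_le_p (by tauto) huc h.nonneg (h.conv_lt_top 0)

/-- The mass of `Δ² u - λ Δ u` on dyadic balls. -/
noncomputable def dyadicMass (lam : ℝ) (u : EuclideanSpace ℝ (Fin N) → ℝ) (n : ℕ) : ℝ :=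
  ∫ y in ball (0 : EuclideanSpace ℝ (Fin N)) (2 ^ n), ((Δ (Δ u)) y - lam * (Δ u) y)

/-- Lower bounds for a nontrivial solution on dyadic balls. -/
lemma IsNonnegSolution.exists_dyadic_profile {lam p q α β : ℝ}
    {u : EuclideanSpace ℝ (Fin N) → ℝ} (h : IsNonnegSolution lam p q α β u) (hN : 1 ≤ N)
    (hlam : 0 < lam) (hp : 0 < p) (hpq : N ≤ 2 ∨ 1 ≤ p ∨ 1 < q)
    {x₁ : EuclideanSpace ℝ (Fin N)} (hx₁ : 0 < u x₁) :
    ∃ c > 0, ∃ (g : ℕ → ℝ) (n₀ : ℕ), ∀ n, n₀ ≤ n → c ≤ g n ∧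
      c * dyadicMass lam u (n + 1) ≤ g n ∧ ∀ x : EuclideanSpace ℝ (Fin N),
      ‖x‖ ≤ 2 ^ (n + 3) → c * (((2 : ℝ) ^ n) ^ (2 - N : ℝ) * g n) ≤ u x := by
  have hE0 := h.energy_nonneg
  have hEc := continuous_bilaplacian_sub h.contDiff lam
  have hw0 := helmholtz_nonneg h.contDiff h.nonneg hlam hE0 (h.polyGrowth hlam hp hpq hx₁)
  obtain ⟨c, hc, g, hg⟩ := exists_profile h.contDiff h.nonneg hlam hE0 hw0
  have hint (r : ℝ) : IntegrableOn (fun y => (Δ (Δ u)) y - lam * (Δ u) y)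
      (ball (0 : EuclideanSpace ℝ (Fin N)) r) :=
    (hEc.continuousOn.integrableOn_compact (isCompact_closedBall 0 r)).mono_set
      ball_subset_closedBall
  have hmono : Monotone (dyadicMass lam u) := fun i j hij =>
    setIntegral_mono_set (hint _) (Filter.Eventually.of_forall hE0)
      (ball_subset_ball (pow_le_pow_right₀ (by norm_num) hij)).eventuallyLE
  have hEx : 0 < (Δ (Δ u)) x₁ - lam * (Δ u) x₁ :=
    (mul_pos (toReal_kernelConv_pos hN α β p h.contDiff.continuous hx₁ (h.conv_lt_top x₁))
      (Real.rpow_pos_of_pos hx₁ q)).trans_le (h.energy_ge x₁)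
  obtain ⟨n₀, hn₀⟩ := pow_unbounded_of_one_lt ‖x₁‖ (one_lt_two : (1 : ℝ) < 2)
  have hmass : 0 < dyadicMass lam u n₀ := by
    rw [dyadicMass, setIntegral_pos_iff_support_of_nonneg_ae
      (Filter.Eventually.of_forall hE0) (hint _)]
    refine IsOpen.measure_pos volume (hEc.isOpen_support.inter isOpen_ball) ⟨x₁, hEx.ne', ?_⟩
    simpa using hn₀
  have h8 (n : ℕ) : (1 : ℝ) ≤ 2 ^ (n + 3) := one_le_pow₀ (by norm_num)
  have hlow (n : ℕ) : c * dyadicMass lam u (n + 2) ≤ g (2 ^ (n + 3)) := by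
    have := (hg (2 ^ (n + 3)) (h8 n)).2.2
    rwa [show (2 : ℝ) ^ (n + 3) / 2 = 2 ^ (n + 2) by ring] at this
  set d : ℝ := c * (8 : ℝ) ^ (2 - N : ℝ) with hd
  have hd0 : 0 < d := by positivity
  -- The profile is sampled at 2^(n+3), so the bound on u also covers the annulus n+2, which is used
  -- to estimate the convolution. Positive mass on the ball of radius 2^n₀ supplies the uniform
  -- lower bound for g.
  refine ⟨min (min c d) (c * dyadicMass lam u n₀), by positivity, fun n => g (2 ^ (n + 3)), n₀,
    fun n hn => ⟨?_, ?_, fun x hx => ?_⟩⟩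
  · refine (min_le_right _ _).trans (le_trans ?_ (hlow n))
    gcongr
    exact hmono (by omega)
  · refine le_trans ?_ (hlow n)
    have h1 : 0 < dyadicMass lam u (n + 1) := hmass.trans_le (hmono (by omega))
    have h2 : min (min c d) (c * dyadicMass lam u n₀) ≤ c :=
      (min_le_left _ _).trans (min_le_left _ _)
    have h3 : dyadicMass lam u (n + 1) ≤ dyadicMass lam u (n + 2) := hmono (by omega)
    gcongr
  · obtain ⟨hg0, hgu, -⟩ := hg (2 ^ (n + 3)) (h8 n)
    have h1 := hgu x hx
    have h2 : min (min c d) (c * dyadicMass lam u n₀) ≤ d :=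
      (min_le_left _ _).trans (min_le_right _ _)
    have h3 : ((2 : ℝ) ^ (n + 3)) ^ (2 - N : ℝ) = (8 : ℝ) ^ (2 - N : ℝ) * (2 ^ n) ^ (2 - N : ℝ) := by
      rw [← Real.mul_rpow (by norm_num) (by positivity)]; congr 1; ring
    have h4 : ((2 : ℝ) ^ (n + 3)) ^ (2 - N : ℝ) * (2 ^ (n + 3)) ^ N = (2 ^ (n + 3)) ^ 2 := by
      rw [← Real.rpow_natCast _ N, ← Real.rpow_add (by positivity), sub_add_cancel]
      norm_num
    calc _ ≤ d * (((2 : ℝ) ^ n) ^ (2 - N : ℝ) * g (2 ^ (n + 3))) := by gcongr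
      _ = c * (((2 : ℝ) ^ (n + 3)) ^ (2 - N : ℝ) * g (2 ^ (n + 3))) := by rw [hd, h3]; ring
      _ ≤ u x := by
        refine le_of_mul_le_mul_left (a := ((2 : ℝ) ^ (n + 3)) ^ N) ?_ (by positivity)
        refine le_trans (le_of_eq ?_) h1
        rw [← h4]; ring

/-- A lower bound for the convolution in terms of the profile leads to a contradiction. -/
lemma IsNonnegSolution.false_of_conv_bound {lam p q α β : ℝ}
    {u : EuclideanSpace ℝ (Fin N) → ℝ} (h : IsNonnegSolution lam p q α β u) (hN : 1 ≤ N)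
    (hq : 0 < q) {c : ℝ} (hc : 0 < c) {g : ℕ → ℝ} {n₀ : ℕ}
    (hg : ∀ n, n₀ ≤ n → c ≤ g n ∧
      c * dyadicMass lam u (n + 1) ≤ g n ∧ ∀ x : EuclideanSpace ℝ (Fin N),
      ‖x‖ ≤ 2 ^ (n + 3) → c * (((2 : ℝ) ^ n) ^ (2 - N : ℝ) * g n) ≤ u x)
    {a γ p' c' : ℝ} {n₁ : ℕ} (hc' : 0 < c')
    (hQ : 1 < p' + q)
    (hθ : 0 < N - a - (N - 2) * q ∨ N - a - (N - 2) * q = 0 ∧ 1 / (p' + q) - 1 < γ)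
    (hconv : ∀ n, n₁ ≤ n → ∀ x ∈ dyadicAnnulus N n,
      c' * (((2 : ℝ) ^ n) ^ (-a) * (n : ℝ) ^ γ * g n ^ p') ≤ (kernelConv α β p u x).toReal) :
    False := by
  have hEc := continuous_bilaplacian_sub h.contDiff lam
  set ω := volume.real (ball (0 : EuclideanSpace ℝ (Fin N)) 1) with hω
  have hω0 : 0 < ω := volume_real_ball_pos N
  set κ : ℝ := ω * (c' * c ^ q) with hκ
  have hκ0 : 0 < κ := by positivity
  refine false_of_exp_increment_le (G := dyadicMass lam u) (g := g) (c := min c κ)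
    (n₀ := max n₀ n₁) (lt_min hc hκ0) hQ hθ
    (fun n => setIntegral_nonneg measurableSet_ball fun y _ => h.energy_nonneg y)
    (fun n hn => ?_) (fun n hn => ?_) (fun n hn => ?_)
  · obtain ⟨h1, -, h3⟩ := hg n (le_of_max_le_left hn)
    have hg0 : 0 < g n := hc.trans_le h1
    -- The pointwise lower bound for E on the n-th annulus. Multiplied by the volume factor 2^(nN)
    -- it has exponential rate N − a − (N−2)q and power p' + q of the profile.
    set A : ℝ := c' * (((2 : ℝ) ^ n) ^ (-a) * (n : ℝ) ^ γ * g n ^ p') *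
      (c * (((2 : ℝ) ^ n) ^ (2 - N : ℝ) * g n)) ^ q with hA
    have hA0 : 0 ≤ A := by positivity
    have h4 := add_le_setIntegral_ball hN hEc n hA0 fun x hx => by
      refine le_trans ?_ (h.energy_ge x)
      have h5 := hconv n (le_of_max_le_right hn) x hx
      have h6 : ‖x‖ ≤ 2 ^ (n + 3) :=
        (mem_dyadicAnnulus.1 hx).1.le.trans (pow_le_pow_right₀ (by norm_num) (by omega))
      rw [hA]
      have := h3 x h6
      gcongr
    refine le_trans ?_ h4
    rw [← hω]
    refine add_le_add le_rfl ?_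
    have h5 : ((2 : ℝ) ^ n) ^ (N - a - (N - 2) * q : ℝ) =
        ((2 : ℝ) ^ n) ^ N * ((2 : ℝ) ^ n) ^ (-a) * (((2 : ℝ) ^ n) ^ (2 - N : ℝ)) ^ q := by
      rw [← Real.rpow_mul (by positivity), ← Real.rpow_natCast _ N,
        ← Real.rpow_add (by positivity), ← Real.rpow_add (by positivity)]
      congr 1; ring
    have h6 : g n ^ (p' + q) = g n ^ p' * g n ^ q := Real.rpow_add hg0 _ _
    calc min c κ * (((2 : ℝ) ^ n) ^ (N - a - (N - 2) * q : ℝ) * (n : ℝ) ^ γ * g n ^ (p' + q))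
        ≤ κ * (((2 : ℝ) ^ n) ^ (N - a - (N - 2) * q : ℝ) * (n : ℝ) ^ γ * g n ^ (p' + q)) := by
          gcongr
          exact min_le_right _ _
      _ = _ := by
          rw [hA, Real.mul_rpow hc.le (by positivity), Real.mul_rpow (by positivity) hg0.le, h5,
            h6, hκ]
          ring
  · obtain ⟨-, h2, -⟩ := hg n (le_of_max_le_left hn)
    refine le_trans ?_ h2
    have : 0 ≤ dyadicMass lam u (n + 1) :=
      setIntegral_nonneg measurableSet_ball fun y _ => h.energy_nonneg y
    gcongr
    exact min_le_left _ _
  · exact (min_le_left _ _).trans (hg n (le_of_max_le_left hn)).1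

end Solutions

/-! ### Lower bounds for the convolution on dyadic annuli. -/

section Cases

open Laplacian Metric

variable {N : ℕ}

/-- With a gap of two indices, |x − y| is comparable to the larger norm. This keeps the argument of
the kernel away from the origin. -/
lemma norm_sub_bounds_of_inner {n i : ℕ} (h : i + 2 ≤ n) {x y : EuclideanSpace ℝ (Fin N)}
    (hx : x ∈ dyadicAnnulus N n) (hy : y ∈ dyadicAnnulus N i) :
    2 ^ n ≤ 2 * ‖x - y‖ ∧ ‖x - y‖ ≤ 2 ^ (n + 2) := by
  rw [mem_dyadicAnnulus] at hx hy
  have h1 : (2 : ℝ) * 2 ^ (i + 1) ≤ 2 ^ n := by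
    rw [← pow_succ']; exact pow_le_pow_right₀ (by norm_num) h
  have h2 := norm_sub_norm_le x y
  have h3 := norm_sub_le x y
  have h4 : (2 : ℝ) ^ (n + 1) = 2 * 2 ^ n := by ring
  have h5 : (2 : ℝ) ^ (n + 2) = 4 * 2 ^ n := by ring
  constructor <;> linarith

lemma norm_sub_bounds_of_outer {n i : ℕ} (h : n + 2 ≤ i) {x y : EuclideanSpace ℝ (Fin N)}
    (hx : x ∈ dyadicAnnulus N n) (hy : y ∈ dyadicAnnulus N i) :
    2 ^ i ≤ 2 * ‖x - y‖ ∧ ‖x - y‖ ≤ 2 ^ (i + 2) := by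
  rw [norm_sub_rev]; exact norm_sub_bounds_of_inner h hy hx

/-- A lower bound for the convolution by a sum over dyadic annuli. -/
lemma sum_dyadic_le_toReal_kernelConv (hN : 1 ≤ N) {α β p : ℝ} (hp : 0 < p)
    {u : EuclideanSpace ℝ (Fin N) → ℝ} {x : EuclideanSpace ℝ (Fin N)}
    (hfin : kernelConv α β p u x < ∞) (s : Finset ℕ) (k v : ℕ → ℝ)
    (hk0 : ∀ i ∈ s, 0 ≤ k i) (hv0 : ∀ i ∈ s, 0 ≤ v i)
    (hk : ∀ i ∈ s, ∀ y ∈ dyadicAnnulus N i, k i ≤ logKernel α β (x - y))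
    (hv : ∀ i ∈ s, ∀ y ∈ dyadicAnnulus N i, v i ≤ u y) :
    volume.real (ball (0 : EuclideanSpace ℝ (Fin N)) 1) *
      ∑ i ∈ s, k i * v i ^ p * ((2 : ℝ) ^ i) ^ N ≤ (kernelConv α β p u x).toReal := by
  set ω := volume.real (ball (0 : EuclideanSpace ℝ (Fin N)) 1) with hω
  have hω0 : 0 < ω := volume_real_ball_pos N
  refine le_trans (le_of_eq ?_) (sum_le_toReal_kernelConv hfin s (dyadicAnnulus N)
    (fun i _ => measurableSet_dyadicAnnulus i) (fun i _ j _ hij => disjoint_dyadicAnnulus hij)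
    (fun i => k i * v i ^ p) (fun i => ((2 : ℝ) ^ i) ^ N * ω)
    (fun i hi => mul_nonneg (hk0 i hi) (Real.rpow_nonneg (hv0 i hi) _))
    (fun i _ => by positivity) (fun i _ => ofReal_le_volume_dyadicAnnulus hN i) ?_)
  · rw [Finset.mul_sum]
    exact Finset.sum_congr rfl fun i _ => by ring
  · intro i hi y hy
    have h1 := Real.rpow_le_rpow (hv0 i hi) (hv i hi y hy) hp.le
    exact mul_le_mul (hk i hi y hy) h1 (Real.rpow_nonneg (hv0 i hi) _)
      (logKernel_nonneg _ _ _)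

/-- Nonexistence when the convolution diverges. -/
lemma false_of_divergent (hN : 1 ≤ N) {α β p : ℝ} (hα : 0 ≤ α) (hp : 0 < p)
    {u : EuclideanSpace ℝ (Fin N) → ℝ} (hfin : kernelConv α β p u 0 < ∞) {c : ℝ} (hc : 0 < c)
    {n₀ : ℕ} (hu : ∀ n, n₀ ≤ n → ∀ x : EuclideanSpace ℝ (Fin N), ‖x‖ ≤ 2 ^ (n + 1) →
      c * ((2 : ℝ) ^ n) ^ (2 - N : ℝ) ≤ u x)
    (hθ : 0 < N - α - (N - 2) * p ∨ N - α - (N - 2) * p = 0 ∧ -1 ≤ β) : False := by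
  obtain ⟨κ, hκ, hK⟩ := exists_le_logKernel_dyadic N hα β
  set ω := volume.real (ball (0 : EuclideanSpace ℝ (Fin N)) 1) with hω
  have hω0 : 0 < ω := volume_real_ball_pos N
  set θ : ℝ := N - α - (N - 2) * p with hθdef
  -- Up to constants, the i-th annulus contributes at least 2^(iθ) i^β to the convolution at 0, so
  -- the harmonic series is a minorant.
  obtain ⟨n₁, hn₁⟩ : ∃ n₁ : ℕ, ∀ i, n₁ ≤ i → ((i : ℝ))⁻¹ ≤ ((2 : ℝ) ^ i) ^ θ * (i : ℝ) ^ β := by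
    rcases hθ with h | ⟨h, hβ⟩
    · obtain ⟨n₁, hn₁⟩ := Filter.eventually_atTop.1 (eventually_le_exp_mul_rpow h β)
      refine ⟨max n₁ 1, fun i hi => le_trans ?_ (hn₁ i (le_of_max_le_left hi))⟩
      exact inv_le_one_of_one_le₀ (by exact_mod_cast le_of_max_le_right hi)
    · refine ⟨1, fun i hi => ?_⟩
      have hi' : (1 : ℝ) ≤ i := by exact_mod_cast hi
      rw [h, Real.rpow_zero, one_mul, ← Real.rpow_neg_one]
      exact Real.rpow_le_rpow_of_exponent_le hi' hβ
  set m := max (max n₀ n₁) 2 with hm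
  set T := (kernelConv α β p u 0).toReal with hT
  set d : ℝ := ω * (κ * c ^ p) with hd
  have hd0 : 0 < d := by positivity
  have key (n : ℕ) : ∑ i ∈ Finset.range n, ((i + m : ℕ) : ℝ)⁻¹ ≤ T / d := by
    have h1 := sum_dyadic_le_toReal_kernelConv hN hp hfin
      ((Finset.range n).map (addRightEmbedding m))
      (fun i => κ * (((2 : ℝ) ^ i) ^ (-α) * (i : ℝ) ^ β))
      (fun i => c * ((2 : ℝ) ^ i) ^ (2 - N : ℝ)) (fun i _ => by positivity)
      (fun i _ => by positivity)
      (fun i hi y hy => by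
        obtain ⟨j, -, rfl⟩ := Finset.mem_map.1 hi
        rw [mem_dyadicAnnulus] at hy
        have h2 : (2 : ℝ) ^ (j + m + 2) = 2 * 2 ^ (j + m + 1) := by ring
        have h3 : (0 : ℝ) < 2 ^ (j + m + 1) := by positivity
        refine hK _ (by simp [hm]; omega) _ ?_ ?_
        · rw [zero_sub, norm_neg]
          have := hy.2
          linarith [norm_nonneg y]
        · rw [zero_sub, norm_neg]
          have := hy.1
          simp only [addRightEmbedding_apply] at this ⊢
          linarith)
      (fun i hi y hy => by
        obtain ⟨j, -, rfl⟩ := Finset.mem_map.1 hi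
        exact hu _ (by simp [hm]; omega) y (mem_dyadicAnnulus.1 hy).1.le)
    rw [Finset.sum_map] at h1
    rw [le_div_iff₀ hd0, mul_comm]
    refine le_trans ?_ h1
    rw [hd, mul_assoc, Finset.mul_sum]
    refine mul_le_mul_of_nonneg_left (Finset.sum_le_sum fun j _ => ?_) hω0.le
    simp only [addRightEmbedding_apply]
    set i := j + m with hi
    have h2 := hn₁ i (by simp [hi, hm]; omega)
    have h3 : ((2 : ℝ) ^ i) ^ θ =
        ((2 : ℝ) ^ i) ^ (-α) * (((2 : ℝ) ^ i) ^ (2 - N : ℝ)) ^ p * ((2 : ℝ) ^ i) ^ N := by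
      rw [← Real.rpow_mul (by positivity), ← Real.rpow_natCast _ N,
        ← Real.rpow_add (by positivity), ← Real.rpow_add (by positivity), hθdef]
      congr 1; ring
    calc κ * c ^ p * (i : ℝ)⁻¹ ≤ κ * c ^ p * (((2 : ℝ) ^ i) ^ θ * (i : ℝ) ^ β) := by gcongr
      _ = _ := by
        rw [h3, Real.mul_rpow hc.le (by positivity)]; ring
  have hsum : Summable fun i : ℕ => ((i + m : ℕ) : ℝ)⁻¹ :=
    summable_of_sum_range_le (fun i => by positivity) key
  exact Real.not_summable_natCast_inv ((summable_nat_add_iff (f := fun i : ℕ => (i : ℝ)⁻¹) m).1 hsum)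

/-- The convolution decays at most like the kernel. -/
lemma exists_le_kernelConv_dyadic (hN : 1 ≤ N) {α β p : ℝ} (hα : 0 ≤ α) (hp : 0 < p)
    {u : EuclideanSpace ℝ (Fin N) → ℝ} (hfin : ∀ x, kernelConv α β p u x < ∞) {c : ℝ} (hc : 0 < c)
    {n₀ : ℕ} (hu : ∀ n, n₀ ≤ n → ∀ x : EuclideanSpace ℝ (Fin N), ‖x‖ ≤ 2 ^ (n + 1) →
      c * ((2 : ℝ) ^ n) ^ (2 - N : ℝ) ≤ u x) :
    ∃ c' > 0, ∃ n₁ : ℕ, ∀ n, n₁ ≤ n → ∀ x ∈ dyadicAnnulus N n,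
      c' * (((2 : ℝ) ^ n) ^ (-α) * (n : ℝ) ^ β) ≤ (kernelConv α β p u x).toReal := by
  obtain ⟨κ, hκ, hK⟩ := exists_le_logKernel_dyadic N hα β
  set ω := volume.real (ball (0 : EuclideanSpace ℝ (Fin N)) 1) with hω
  have hω0 : 0 < ω := volume_real_ball_pos N
  set v : ℝ := c * ((2 : ℝ) ^ n₀) ^ (2 - N : ℝ) with hv
  have hv0 : 0 < v := by positivity
  refine ⟨ω * (κ * v ^ p * ((2 : ℝ) ^ n₀) ^ N), by positivity, n₀ + 2, fun n hn x hx => ?_⟩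
  refine le_trans (le_of_eq ?_) (sum_dyadic_le_toReal_kernelConv hN hp (hfin x) {n₀}
    (fun _ => κ * (((2 : ℝ) ^ n) ^ (-α) * (n : ℝ) ^ β)) (fun _ => v)
    (fun i _ => by positivity) (fun i _ => hv0.le) (fun i hi y hy => ?_) fun i hi y hy => ?_)
  · rw [Finset.sum_singleton]; ring
  · rw [Finset.mem_singleton.1 hi] at hy
    obtain ⟨h1, h2⟩ := norm_sub_bounds_of_inner hn hx hy
    exact hK n (by omega) _ h1 h2
  · rw [Finset.mem_singleton.1 hi] at hy
    exact hu n₀ le_rfl y (mem_dyadicAnnulus.1 hy).1.le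

/-- A logarithmic gain from the inner region when `u^p` is critically non-integrable. -/
lemma exists_le_kernelConv_inner (hN : 1 ≤ N) {α β p : ℝ} (hα : 0 ≤ α) (hp : 0 < p)
    (hcrit : (N - 2) * p = N)
    {u : EuclideanSpace ℝ (Fin N) → ℝ} (hfin : ∀ x, kernelConv α β p u x < ∞) {c : ℝ} (hc : 0 < c)
    {n₀ : ℕ} (hu : ∀ n, n₀ ≤ n → ∀ x : EuclideanSpace ℝ (Fin N), ‖x‖ ≤ 2 ^ (n + 1) →
      c * ((2 : ℝ) ^ n) ^ (2 - N : ℝ) ≤ u x) :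
    ∃ c' > 0, ∃ n₁ : ℕ, ∀ n, n₁ ≤ n → ∀ x ∈ dyadicAnnulus N n,
      c' * (((2 : ℝ) ^ n) ^ (-α) * (n : ℝ) ^ (β + 1)) ≤ (kernelConv α β p u x).toReal := by
  obtain ⟨κ, hκ, hK⟩ := exists_le_logKernel_dyadic N hα β
  set ω := volume.real (ball (0 : EuclideanSpace ℝ (Fin N)) 1) with hω
  have hω0 : 0 < ω := volume_real_ball_pos N
  -- Every inner annulus contributes the same amount, as u^p times volume is scale invariant. For n
  -- ≥ 2n₀ + 2 there are at least n/2 of them.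
  refine ⟨ω * (κ * c ^ p / 2), by positivity, 2 * n₀ + 2, fun n hn x hx => ?_⟩
  refine le_trans ?_ (sum_dyadic_le_toReal_kernelConv hN hp (hfin x) (Finset.Ico n₀ (n - 1))
    (fun _ => κ * (((2 : ℝ) ^ n) ^ (-α) * (n : ℝ) ^ β))
    (fun i => c * ((2 : ℝ) ^ i) ^ (2 - N : ℝ))
    (fun i _ => by positivity) (fun i _ => by positivity) (fun i hi y hy => ?_) fun i hi y hy => ?_)
  · have h1 (i : ℕ) : κ * (((2 : ℝ) ^ n) ^ (-α) * (n : ℝ) ^ β) *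
        (c * ((2 : ℝ) ^ i) ^ (2 - N : ℝ)) ^ p * ((2 : ℝ) ^ i) ^ N =
        κ * c ^ p * (((2 : ℝ) ^ n) ^ (-α) * (n : ℝ) ^ β) := by
      have h2 : (((2 : ℝ) ^ i) ^ (2 - N : ℝ)) ^ p * ((2 : ℝ) ^ i) ^ N = 1 := by
        rw [← Real.rpow_mul (by positivity), ← Real.rpow_natCast _ N,
          ← Real.rpow_add (by positivity),
          show ((2 : ℝ) - N) * p + N = 0 by linarith, Real.rpow_zero]
      rw [Real.mul_rpow hc.le (by positivity)]
      calc _ = κ * c ^ p * (((2 : ℝ) ^ n) ^ (-α) * (n : ℝ) ^ β) *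
            ((((2 : ℝ) ^ i) ^ (2 - N : ℝ)) ^ p * ((2 : ℝ) ^ i) ^ N) := by ring
        _ = _ := by rw [h2, mul_one]
    rw [Finset.sum_congr rfl fun i _ => h1 i, Finset.sum_const, Nat.card_Ico, nsmul_eq_mul]
    have hn0 : (0 : ℝ) < n := by exact_mod_cast (by omega : 0 < n)
    have h3 : (n : ℝ) / 2 ≤ ((n - 1 - n₀ : ℕ) : ℝ) := by
      rw [div_le_iff₀ two_pos]
      exact_mod_cast (by omega : n ≤ (n - 1 - n₀) * 2)
    rw [Real.rpow_add_one hn0.ne']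
    calc _ = ω * ((n : ℝ) / 2 * (κ * c ^ p * (((2 : ℝ) ^ n) ^ (-α) * (n : ℝ) ^ β))) := by ring
      _ ≤ _ := by gcongr
  · rw [Finset.mem_Ico] at hi
    obtain ⟨h1, h2⟩ := norm_sub_bounds_of_inner (by omega) hx hy
    exact hK n (by omega) _ h1 h2
  · rw [Finset.mem_Ico] at hi
    exact hu i hi.1 y (mem_dyadicAnnulus.1 hy).1.le

/-- A logarithmic gain from the outer region when the kernel is critically non-integrable
against `u^p`. -/
lemma exists_le_kernelConv_outer (hN : 1 ≤ N) {α β p : ℝ} (hα : 0 ≤ α) (hp : 0 < p)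
    (hcrit : (N - 2) * p = N - α)
    {u : EuclideanSpace ℝ (Fin N) → ℝ} (hfin : ∀ x, kernelConv α β p u x < ∞) {c : ℝ} (hc : 0 < c)
    {n₀ : ℕ} (hu : ∀ n, n₀ ≤ n → ∀ x : EuclideanSpace ℝ (Fin N), ‖x‖ ≤ 2 ^ (n + 1) →
      c * ((2 : ℝ) ^ n) ^ (2 - N : ℝ) ≤ u x) :
    ∃ c' > 0, ∃ n₁ : ℕ, ∀ n, n₁ ≤ n → ∀ x ∈ dyadicAnnulus N n,
      c' * (n : ℝ) ^ (β + 1) ≤ (kernelConv α β p u x).toReal := by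
  obtain ⟨κ, hκ, hK⟩ := exists_le_logKernel_dyadic N hα β
  set ω := volume.real (ball (0 : EuclideanSpace ℝ (Fin N)) 1) with hω
  have hω0 : 0 < ω := volume_real_ball_pos N
  set μ := min ((1 : ℝ) ^ β) ((4 : ℝ) ^ β) with hμ
  have hμ0 : 0 < μ := lt_min (by positivity) (by positivity)
  refine ⟨ω * (κ * c ^ p * μ), by positivity, max n₀ 1, fun n hn x hx => ?_⟩
  have hn1 : (1 : ℝ) ≤ n := by exact_mod_cast le_of_max_le_right hn
  -- These n annuli have indices comparable to n. Criticality cancels the exponential factors, so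
  -- each contributes a multiple of n^β.
  refine le_trans ?_ (sum_dyadic_le_toReal_kernelConv hN hp (hfin x)
    (Finset.Ico (n + 2) (2 * n + 2))
    (fun i => κ * (((2 : ℝ) ^ i) ^ (-α) * (i : ℝ) ^ β))
    (fun i => c * ((2 : ℝ) ^ i) ^ (2 - N : ℝ))
    (fun i _ => by positivity) (fun i _ => by positivity) (fun i hi y hy => ?_) fun i hi y hy => ?_)
  · have h1 (i : ℕ) (hi : i ∈ Finset.Ico (n + 2) (2 * n + 2)) : κ * c ^ p * (μ * (n : ℝ) ^ β) ≤
        κ * (((2 : ℝ) ^ i) ^ (-α) * (i : ℝ) ^ β) *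
        (c * ((2 : ℝ) ^ i) ^ (2 - N : ℝ)) ^ p * ((2 : ℝ) ^ i) ^ N := by
      have h2 : ((2 : ℝ) ^ i) ^ (-α) * (((2 : ℝ) ^ i) ^ (2 - N : ℝ)) ^ p * ((2 : ℝ) ^ i) ^ N = 1 := by
        rw [← Real.rpow_mul (by positivity), ← Real.rpow_natCast _ N,
          ← Real.rpow_add (by positivity), ← Real.rpow_add (by positivity),
          show -α + ((2 : ℝ) - N) * p + N = 0 by linarith, Real.rpow_zero]
      rw [Finset.mem_Ico] at hi
      have h3 : μ * (n : ℝ) ^ β ≤ (i : ℝ) ^ β := by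
        refine min_rpow_mul_le_rpow β one_pos (by norm_num) (by linarith) ?_ ?_
        · rw [one_mul]; exact_mod_cast (by omega : n ≤ i)
        · have := le_of_max_le_right hn
          exact_mod_cast (by omega : i ≤ 4 * n)
      rw [Real.mul_rpow hc.le (by positivity)]
      calc κ * c ^ p * (μ * (n : ℝ) ^ β) ≤ κ * c ^ p * (i : ℝ) ^ β := by gcongr
        _ = κ * c ^ p * (i : ℝ) ^ β * (((2 : ℝ) ^ i) ^ (-α) * (((2 : ℝ) ^ i) ^ (2 - N : ℝ)) ^ p *
            ((2 : ℝ) ^ i) ^ N) := by rw [h2, mul_one]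
        _ = _ := by ring
    have h2 := Finset.sum_le_sum h1
    rw [Finset.sum_const, Nat.card_Ico, nsmul_eq_mul,
      show 2 * n + 2 - (n + 2) = n by omega] at h2
    rw [Real.rpow_add_one (by linarith)]
    calc _ = ω * ((n : ℝ) * (κ * c ^ p * (μ * (n : ℝ) ^ β))) := by ring
      _ ≤ _ := by gcongr
  · rw [Finset.mem_Ico] at hi
    obtain ⟨h1, h2⟩ := norm_sub_bounds_of_outer (by omega) hx hy
    exact hK i (by omega) _ h1 h2
  · rw [Finset.mem_Ico] at hi
    have := le_of_max_le_left hn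
    exact hu i (by omega) y (mem_dyadicAnnulus.1 hy).1.le

/-- A lower bound for the convolution in terms of the profile. -/
lemma exists_le_kernelConv_profile (hN : 1 ≤ N) {α β p : ℝ} (hα : 0 ≤ α) (hp : 0 < p)
    {u : EuclideanSpace ℝ (Fin N) → ℝ} (hfin : ∀ x, kernelConv α β p u x < ∞) {c : ℝ} (hc : 0 < c)
    {g : ℕ → ℝ} {n₀ : ℕ} (hg : ∀ n, n₀ ≤ n → 0 ≤ g n)
    (hu : ∀ n, n₀ ≤ n → ∀ x : EuclideanSpace ℝ (Fin N), ‖x‖ ≤ 2 ^ (n + 3) →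
      c * (((2 : ℝ) ^ n) ^ (2 - N : ℝ) * g n) ≤ u x) :
    ∃ c' > 0, ∃ n₁ : ℕ, ∀ n, n₁ ≤ n → ∀ x ∈ dyadicAnnulus N n,
      c' * (((2 : ℝ) ^ n) ^ (-(α - N + (N - 2) * p)) * (n : ℝ) ^ β * g n ^ p) ≤
        (kernelConv α β p u x).toReal := by
  obtain ⟨κ, hκ, hK⟩ := exists_le_logKernel_dyadic N hα β
  set ω := volume.real (ball (0 : EuclideanSpace ℝ (Fin N)) 1) with hω
  have hω0 : 0 < ω := volume_real_ball_pos N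
  set μ := min ((1 : ℝ) ^ β) ((3 : ℝ) ^ β) with hμ
  have hμ0 : 0 < μ := lt_min (by positivity) (by positivity)
  refine ⟨ω * (κ * (4 : ℝ) ^ (-α) * μ * c ^ p), by positivity, max n₀ 1, fun n hn x hx => ?_⟩
  have hn1 : (1 : ℝ) ≤ n := by exact_mod_cast le_of_max_le_right hn
  have hg0 := hg n (le_of_max_le_left hn)
  -- One annulus suffices. The index n+2 is the first outer one with the required gap, and it lies
  -- inside the radius 2^(n+3) where the profile bound holds.
  refine le_trans ?_ (sum_dyadic_le_toReal_kernelConv hN hp (hfin x) {n + 2}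
    (fun i => κ * (((2 : ℝ) ^ i) ^ (-α) * (i : ℝ) ^ β))
    (fun _ => c * (((2 : ℝ) ^ n) ^ (2 - N : ℝ) * g n))
    (fun i _ => by positivity) (fun i _ => by positivity) (fun i hi y hy => ?_) fun i hi y hy => ?_)
  · rw [Finset.sum_singleton]
    have h1 : ((2 : ℝ) ^ n) ^ (-(α - N + (N - 2) * p)) =
        ((2 : ℝ) ^ n) ^ (-α) * (((2 : ℝ) ^ n) ^ (2 - N : ℝ)) ^ p * ((2 : ℝ) ^ n) ^ N := by
      rw [← Real.rpow_mul (by positivity), ← Real.rpow_natCast _ N,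
        ← Real.rpow_add (by positivity), ← Real.rpow_add (by positivity)]
      congr 1; ring
    have h2 : ((2 : ℝ) ^ (n + 2)) ^ (-α) = (4 : ℝ) ^ (-α) * ((2 : ℝ) ^ n) ^ (-α) := by
      rw [← Real.mul_rpow (by norm_num) (by positivity)]; congr 1; ring
    have h3 : μ * (n : ℝ) ^ β ≤ ((n + 2 : ℕ) : ℝ) ^ β := by
      refine min_rpow_mul_le_rpow β one_pos (by norm_num) (by linarith) ?_ ?_
      · push_cast; linarith
      · push_cast; linarith
    have h4 : ((2 : ℝ) ^ n) ^ N ≤ ((2 : ℝ) ^ (n + 2)) ^ N :=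
      pow_le_pow_left₀ (by positivity) (pow_le_pow_right₀ (by norm_num) (by omega)) N
    rw [h1, h2, Real.mul_rpow hc.le (by positivity), Real.mul_rpow (by positivity) hg0]
    calc _ = ω * (κ * ((4 : ℝ) ^ (-α) * ((2 : ℝ) ^ n) ^ (-α) * (μ * (n : ℝ) ^ β)) *
          (c ^ p * ((((2 : ℝ) ^ n) ^ (2 - N : ℝ)) ^ p * g n ^ p)) * ((2 : ℝ) ^ n) ^ N) := by ring
      _ ≤ _ := by gcongr
  · rw [Finset.mem_singleton.1 hi] at hy ⊢
    obtain ⟨h1, h2⟩ := norm_sub_bounds_of_outer le_rfl hx hy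
    exact hK (n + 2) (by omega) _ h1 h2
  · rw [Finset.mem_singleton.1 hi] at hy
    exact hu n (le_of_max_le_left hn) y (mem_dyadicAnnulus.1 hy).1.le

end Cases

/-! ### The main theorem: matching each condition with a convolution bound. -/

theorem theorem2 (N : ℕ) (hN : 1 ≤ N) (lam p q α β : ℝ)
    (hlam : 0 < lam) (hp : 0 < p) (hq : 0 < q)
    (hα₀ : 0 ≤ α) (hαN : α ≤ N) (hβ : α - N < β)
    (hcases :
      (N ≤ 2) ∨
      (3 ≤ N ∧ α ≤ 2 ∧ 1 ≤ p ∧ p < (N - α) / (N - 2)) ∨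
      (3 ≤ N ∧ α ≤ 2 ∧ p = (N - α) / (N - 2) ∧ -1 ≤ β) ∨
      (3 ≤ N ∧ 1 ≤ p ∧ p + q < (2 * N - α) / (N - 2)) ∨
      (3 ≤ N ∧ 1 ≤ p ∧ p + q = (2 * N - α) / (N - 2) ∧ 1 / (p + q) - 1 < β) ∨
      (3 ≤ N ∧ α < 2 ∧ 1 < q ∧ q < (N - α) / (N - 2)) ∨
      (3 ≤ N ∧ α < 2 ∧ q = (N - α) / (N - 2) ∧ 1 / q - 1 < β) ∨
      (3 ≤ N ∧ α < 2 ∧ p = N / (N - 2) ∧ q = (N - α) / (N - 2) ∧ -2 + 1 / q < β) ∨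
      (3 ≤ N ∧ α < 2 ∧ p = (N - α) / (N - 2) ∧ q = N / (N - 2) ∧ -2 + 1 / q < β)) :
    ¬ ∃ u : EuclideanSpace ℝ (Fin N) → ℝ,
      IsNonnegSolution lam p q α β u ∧ ∃ x, u x ≠ 0 := by
  rintro ⟨u, h, x₁, hx₁⟩
  have hx₁ : 0 < u x₁ := lt_of_le_of_ne (h.nonneg x₁) (Ne.symm hx₁)
  have hν {M : ℕ} (hM : 3 ≤ M) : (0 : ℝ) < M - 2 := by
    have : (3 : ℝ) ≤ M := by exact_mod_cast hM
    linarith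
  have hpq : N ≤ 2 ∨ 1 ≤ p ∨ 1 < q := by
    rcases hcases with h | h | ⟨h3, h⟩ | h | h | h | ⟨h3, h⟩ | ⟨h3, h⟩ | ⟨h3, h⟩
    · exact Or.inl h
    · exact Or.inr (Or.inl h.2.2.1)
    · refine Or.inr (Or.inl ?_)
      rw [h.2.1, le_div_iff₀ (hν h3)]; linarith
    · exact Or.inr (Or.inl h.2.1)
    · exact Or.inr (Or.inl h.2.1)
    · exact Or.inr (Or.inr h.2.2.1)
    · refine Or.inr (Or.inr ?_)
      rw [h.2.1, lt_div_iff₀ (hν h3)]; linarith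
    · refine Or.inr (Or.inr ?_)
      rw [h.2.2.1, lt_div_iff₀ (hν h3)]; linarith
    · refine Or.inr (Or.inl ?_)
      rw [h.2.1, le_div_iff₀ (hν h3)]; linarith
  obtain ⟨c, hc, g, n₀, hg⟩ := h.exists_dyadic_profile hN hlam hp hpq hx₁
  have hu : ∀ n, n₀ ≤ n → ∀ x : EuclideanSpace ℝ (Fin N), ‖x‖ ≤ 2 ^ (n + 1) →
      c ^ 2 * ((2 : ℝ) ^ n) ^ (2 - N : ℝ) ≤ u x := fun n hn x hx => by
    obtain ⟨h1, -, h3⟩ := hg n hn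
    refine le_trans ?_ (h3 x (hx.trans (pow_le_pow_right₀ (by norm_num) (by omega))))
    calc c ^ 2 * ((2 : ℝ) ^ n) ^ (2 - N : ℝ) = c * (((2 : ℝ) ^ n) ^ (2 - N : ℝ) * c) := by ring
      _ ≤ _ := by gcongr
  have hc2 : 0 < c ^ 2 := by positivity
  have hdiv := false_of_divergent hN hα₀ hp (β := β) (h.conv_lt_top 0) hc2 hu
  rcases hcases with hN2 | ⟨h3, -, -, hp1⟩ | ⟨h3, -, rfl, hβ1⟩ | ⟨h3, hp1, hpq1⟩ |
    ⟨h3, hp1, hpq1, hβ1⟩ | ⟨h3, hα2, hq1, hq2⟩ | ⟨h3, hα2, hq1, hβ1⟩ | ⟨h3, hα2, hp1, hq1, hβ1⟩ |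
    ⟨h3, hα2, hp1, hq1, hβ1⟩
  -- The exponent N − α + (2−N)p is non-negative. It vanishes only for N = 2 = α, where β > α − N =
  -- 0 ≥ −1.
  · refine hdiv ?_
    have hN2' : (N : ℝ) ≤ 2 := by exact_mod_cast hN2
    have h1 : 0 ≤ (2 - (N : ℝ)) * p := mul_nonneg (by linarith) hp.le
    rcases hαN.lt_or_eq with hlt | rfl
    · left; linarith
    · rcases h1.lt_or_eq with h2 | h2
      · left; linarith
      · right; constructor <;> linarith
  · rw [lt_div_iff₀ (hν h3)] at hp1
    exact hdiv (Or.inl (by linarith))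
  · have := (hν h3).ne'
    exact hdiv (Or.inr ⟨by field_simp; ring, hβ1⟩)
  -- The rate exponent becomes 2N − α − (N−2)(p+q), with Q = p + q.
  · obtain ⟨c', hc', n₁, hconv⟩ := exists_le_kernelConv_profile hN hα₀ hp (β := β)
      h.conv_lt_top hc (fun n hn => hc.le.trans (hg n hn).1) (fun n hn => (hg n hn).2.2)
    refine h.false_of_conv_bound hN hq hc hg hc' (by linarith) (Or.inl ?_) hconv
    rw [lt_div_iff₀ (hν h3)] at hpq1
    linarith
  · obtain ⟨c', hc', n₁, hconv⟩ := exists_le_kernelConv_profile hN hα₀ hp (β := β)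
      h.conv_lt_top hc (fun n hn => hc.le.trans (hg n hn).1) (fun n hn => (hg n hn).2.2)
    refine h.false_of_conv_bound hN hq hc hg hc' (by linarith) (Or.inr ⟨?_, hβ1⟩) hconv
    rw [eq_div_iff (hν h3).ne'] at hpq1
    linarith
  -- No profile factor enters the convolution bound, so p' = 0 and Q = q. The same holds in all
  -- remaining cases.
  · obtain ⟨c', hc', n₁, hconv⟩ := exists_le_kernelConv_dyadic hN hα₀ hp (β := β)
      h.conv_lt_top hc2 hu
    refine h.false_of_conv_bound hN hq hc hg (p' := 0) hc' (by linarith) (Or.inl ?_)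
      (by simpa using hconv)
    rw [lt_div_iff₀ (hν h3)] at hq2
    linarith
  · obtain ⟨c', hc', n₁, hconv⟩ := exists_le_kernelConv_dyadic hN hα₀ hp (β := β)
      h.conv_lt_top hc2 hu
    rw [eq_div_iff (hν h3).ne'] at hq1
    have hq2 : 1 < q := by nlinarith [hν h3]
    refine h.false_of_conv_bound hN hq hc hg (a := α) (γ := β) (p' := 0) hc' (by linarith)
      (Or.inr ⟨by linarith, by simpa using hβ1⟩) (by simpa using hconv)
  · rw [eq_div_iff (hν h3).ne'] at hp1 hq1
    obtain ⟨c', hc', n₁, hconv⟩ := exists_le_kernelConv_inner hN hα₀ hp (β := β)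
      (by linarith) h.conv_lt_top hc2 hu
    have hq2 : 1 < q := by nlinarith [hν h3]
    refine h.false_of_conv_bound hN hq hc hg (a := α) (γ := β + 1) (p' := 0) hc' (by linarith)
      (Or.inr ⟨by linarith, by rw [zero_add]; linarith⟩) (by simpa using hconv)
  -- The outer sum has no exponential decay, so a = 0 and the critical q is N/(N−2). The gain γ = β
  -- + 1 turns γ > 1/q − 1 into β > 1/q − 2.
  · rw [eq_div_iff (hν h3).ne'] at hp1 hq1
    obtain ⟨c', hc', n₁, hconv⟩ := exists_le_kernelConv_outer hN hα₀ hp (β := β)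
      (by linarith) h.conv_lt_top hc2 hu
    have hq2 : 1 < q := by nlinarith [hν h3]
    refine h.false_of_conv_bound hN hq hc hg (a := 0) (γ := β + 1) (p' := 0) hc' (by linarith)
      (Or.inr ⟨by linarith, by rw [zero_add]; linarith⟩) (by simpa using hconv)
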